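/- Let $L,T,\alpha>0$, $\Omega=(0,L]\times(0,T]$, and let $a$ be a $C^3$ function on $[0,\infty)\times[0,T]$ (the coefficient on $\bar\Omega$ together with a smooth extension to $x>L$) with $a\ge\alpha$ and $a_t(0,0)=0$. Let $\psi\in C^2([0,T])$, $\phi\in C^2([0,L])$, and let $x=g(t)$, $0\le t\le T$, be the characteristic through the origin: $g'(t)=a(g(t),t)$, $g(0)=0$. Fix constants $C_1$ and $\kappa>0$. Then there is a constant $C>0$, depending only on these data, such that the following holds for every $\varepsilon\in(0,1]$, every $f\in C^2([0,L])$ with $$|f^{(i)}(x)|\le C_1x^{2-i}\varepsilon^{i-3}e^{-x/\varepsilon},\qquad i=0,1,2,\ x\in[0,L],$$ which satisfies the compatibility conditions $\phi(0)=\psi(0)$, $\psi'(0)+a(0,0)\phi'(0)=f(0)$, $-\psi''(0)+\phi'(0)\,[a a_x-a_t](0,0)+a(0,0)^2\phi''(0)=a(0,0)f'(0)$, and every solution $u\in C^2(\bar\Omega)$ of $$u_t+a\,u_x=f(x)\ \text{in }\Omega,\qquad u(0,t)=\psi(t),\quad u(x,0)=\phi(x).$$ (1) There are $v,w,z\in C^2(\bar\Omega)$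 with $u=v+w+z$ on $\bar\Omega$ such that, in $\Omega$, $v_t+av_x=0$, $w_t+aw_x=f$, $z_t+az_x=0$, with $v=u$ on $x=0$ and on $t=0$; $w(0,t)=0$, $w(x,0)=\omega(x):=\int_0^x f(y)/a(y,0)\,dy$; $z(0,t)=0$, $z(x,0)=-\omega(x)$. (2) Let $N\ge2$ be even and $M\ge1$. Use $t_j=jT/M$ throughout, and write $D_t^-$, $D_x^-$, $D_s^-$ for backward and $D_s^+$ for forward difference quotients. For $\sigma\in(0,L/2]$ the Shishkin mesh with transition point $\sigma$ divides each of $[0,\sigma]$ and $[\sigma,L]$ into $N/2$ equal intervals. * $V$ solves $D_t^-V+aD_x^-V=0$ for $1\le i\le N$, $1\le j\le M$ on the uniform mesh $x_i=iL/N$, with $V(0,t_j)=\psi(t_j)$ for $j\ge1$ and $V(x_i,0)=\phi(x_i)$. * $W$ solves $D_t^-W+aD_x^-W=f(x_i)$ for $1\le i\le N$, $1\le j\le M$ on the Shishkin mesh with $\sigma=\min\{L/2,\varepsilon\ln N\}$, with $W(0,t_j)=0$ and $a(x_i,0)D_x^-W(x_i,0)=f(x_i)$ for $i\ge1$. * $Z$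 is defined in the variables $s=x-g(t)\in[0,L]$ and $t$, with $s_i$ the Shishkin mesh with transition point $\min\{L/2,\kappa\,\varepsilon\ln N\}$. With $c=a(s_i+g(t_j),t_j)-a(g(t_j),t_j)$, $$D_t^-Z+\tfrac12\left[(c+|c|)D_s^-Z+(c-|c|)D_s^+Z\right]=0,\qquad 0<i<N,\ 1\le j\le M,$$ $D_t^-Z(0,t_j)=0$ and $Z(L,t_j)=-\omega(L)$ for $j\ge1$, and $Z(s_i,0)=-\omega(s_i)$. Let $\bar V,\bar W$ be the piecewise bilinear interpolants of $V,W$ on $\bar\Omega$. Let $\bar Z(x,t)$ be the piecewise bilinear interpolant of $Z$ at $(x-g(t),t)$ if $x\ge g(t)$, and $\bar Z(x,t)=0$ if $x<g(t)$. Then $\bar U=\bar V+\bar W+\bar Z$ satisfies $$\max_{\bar\Omega}|\bar U-u|\le CN^{-1}(\ln N)^2+CM^{-1}.$$ -/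

import Mathlib

open Set

noncomputable section

namespace FlowAway

/-- `u ∈ C²([0,L] × [0,T])` solves `u_t + a u_x = F(x)` in `(0,L] × (0,T]`,
`u(0,t) = ψ(t)` and `u(x,0) = φ(x)`. -/
structure IsClassicalSolution (L T : ℝ) (a : ℝ → ℝ → ℝ) (F ψ φ : ℝ → ℝ)
    (u : ℝ → ℝ → ℝ) : Prop where
  contDiffOn : ContDiffOn ℝ 2 (fun p : ℝ × ℝ => u p.1 p.2) (Icc 0 L ×ˢ Icc 0 T)
  pde : ∀ x ∈ Ioc 0 L, ∀ t ∈ Ioc 0 T,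
    derivWithin (fun τ => u x τ) (Icc 0 T) t
      + a x t * derivWithin (fun y => u y t) (Icc 0 L) x = F x
  left : ∀ t ∈ Icc 0 T, u 0 t = ψ t
  initial : ∀ x ∈ Icc 0 L, u x 0 = φ x

/-- The compatibility conditions of order zero, one and two at the corner `(0,0)` for
`u_t + a u_x = f(x)`, `u(0,t) = ψ(t)`, `u(x,0) = φ(x)`. -/
structure Compatible (L T : ℝ) (a : ℝ → ℝ → ℝ) (f ψ φ : ℝ → ℝ) : Prop where
  order_zero : φ 0 = ψ 0
  order_one : derivWithin ψ (Icc 0 T) 0 + a 0 0 * derivWithin φ (Icc 0 L) 0 = f 0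
  order_two :
    - iteratedDerivWithin 2 ψ (Icc 0 T) 0
      + derivWithin φ (Icc 0 L) 0
        * (a 0 0 * derivWithin (fun x => a x 0) (Icc 0 L) 0
            - derivWithin (fun t => a 0 t) (Icc 0 T) 0)
      + (a 0 0) ^ 2 * iteratedDerivWithin 2 φ (Icc 0 L) 0
    = a 0 0 * derivWithin f (Icc 0 L) 0

/-- `f ∈ C²([0,L])` has an inflow layer:
`|f⁽ⁱ⁾(x)| ≤ C₁ x^(2-i) ε^(i-3) e^(-x/ε)` for `i = 0, 1, 2`. -/
structure HasInflowLayer (L C₁ ε : ℝ) (f : ℝ → ℝ) : Prop where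
  contDiffOn : ContDiffOn ℝ 2 f (Icc 0 L)
  bound : ∀ i : ℕ, i ≤ 2 → ∀ x ∈ Icc 0 L,
    |iteratedDerivWithin i f (Icc 0 L) x|
      ≤ C₁ * x ^ (2 - i) * ε ^ ((i : ℤ) - 3) * Real.exp (-x / ε)

/-- `g(t) = g(t;0,0)`: the characteristic curve `x = g(t)` through `(0,0)`. -/
structure IsCharacteristic (T : ℝ) (a : ℝ → ℝ → ℝ) (g : ℝ → ℝ) : Prop where
  start : g 0 = 0
  ode : ∀ t ∈ Icc 0 T, HasDerivWithinAt g (a (g t) t) (Icc 0 T) t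

/-- The initial value `w(x,0) = w₀(x,0) - w₀(0,0)` of the boundary layer component,
where `a ∂w₀/∂x = f`. -/
def layerInitial (a : ℝ → ℝ → ℝ) (f : ℝ → ℝ) (x : ℝ) : ℝ :=
  ∫ y in (0 : ℝ)..x, f y / a y 0

/-- The `i`-th node of the uniform mesh with `n` intervals on `[0,ℓ]`. -/
def uniformMesh (ℓ : ℝ) (n i : ℕ) : ℝ := ℓ * i / n

/-- The `i`-th node of the Shishkin mesh on `[0,L]`: `N/2` equal intervals on each of
`[0,σ]` and `[σ,L]` (for even `N`). -/
def shishkinMesh (L σ : ℝ) (N i : ℕ) : ℝ :=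
  if 2 * i ≤ N then 2 * σ / N * i else L - 2 * (L - σ) / N * (N - i)

/-- The transition point `min {L/2, κ ε ln N}`. -/
def transition (L κ ε : ℝ) (N : ℕ) : ℝ := min (L / 2) (κ * ε * Real.log N)

/-- Backward difference in the first variable, on the nodes `X`. -/
def Dx (X : ℕ → ℝ) (U : ℕ → ℕ → ℝ) (i j : ℕ) : ℝ :=
  (U i j - U (i - 1) j) / (X i - X (i - 1))

/-- Forward difference in the first variable, on the nodes `X`. -/
def DxPlus (X : ℕ → ℝ) (U : ℕ → ℕ → ℝ) (i j : ℕ) : ℝ :=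
  (U (i + 1) j - U i j) / (X (i + 1) - X i)

/-- Backward difference in time, on the time levels `τ`. -/
def Dt (τ : ℕ → ℝ) (U : ℕ → ℕ → ℝ) (i j : ℕ) : ℝ :=
  (U i j - U i (j - 1)) / (τ j - τ (j - 1))

/-- The classical upwind scheme for the regular component: `Lv = 0`, `v(0,t) = ψ`,
`v(x,0) = φ`, on the uniform rectangular mesh. -/
structure IsRegularScheme (L T : ℝ) (a : ℝ → ℝ → ℝ) (ψ φ : ℝ → ℝ) (N M : ℕ)
    (V : ℕ → ℕ → ℝ) : Prop where
  interior : ∀ i ∈ Finset.Icc 1 N, ∀ j ∈ Finset.Icc 1 M,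
    Dt (uniformMesh T M) V i j
      + a (uniformMesh L N i) (uniformMesh T M j) * Dx (uniformMesh L N) V i j = 0
  left : ∀ j ∈ Finset.Icc 1 M, V 0 j = ψ (uniformMesh T M j)
  initial : ∀ i ∈ Finset.Icc 0 N, V i 0 = φ (uniformMesh L N i)

/-- The upwind scheme for the boundary layer component on the spatial nodes `X`
and a uniform mesh in time; on the initial line `a(x_i,0) D⁻ W(x_i,0) = f(x_i)`. -/
structure IsBoundaryLayerScheme (T : ℝ) (a : ℝ → ℝ → ℝ) (f : ℝ → ℝ) (X : ℕ → ℝ)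
    (N M : ℕ) (W : ℕ → ℕ → ℝ) : Prop where
  interior : ∀ i ∈ Finset.Icc 1 N, ∀ j ∈ Finset.Icc 1 M,
    Dt (uniformMesh T M) W i j
      + a (X i) (uniformMesh T M j) * Dx X W i j = f (X i)
  left : ∀ j ∈ Finset.Icc 0 M, W 0 j = 0
  initial : ∀ i ∈ Finset.Icc 1 N, a (X i) 0 * Dx X W i 0 = f (X i)

/-- The convection coefficient `ã(s,t) - ã(0,t)` in the coordinates `s = x - g(t)`. -/
def shiftedSpeed (a : ℝ → ℝ → ℝ) (g : ℝ → ℝ) (s t : ℝ) : ℝ := a (s + g t) t - a (g t) t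

/-- The scheme aligned with the characteristic `x = g(t)`, on the nodes `S` for
`s = x - g(t) ∈ [0,L]`, started from `ζ`. It is upwinded according to the sign of the
convection coefficient, collapses to two points at `s = 0`, and keeps the far value `ζ(L)`
at `s = L`. -/
structure IsPulseScheme (T : ℝ) (a : ℝ → ℝ → ℝ) (g ζ : ℝ → ℝ) (S : ℕ → ℝ)
    (N M : ℕ) (Z : ℕ → ℕ → ℝ) : Prop where
  interior : ∀ i ∈ Finset.Ioo 0 N, ∀ j ∈ Finset.Icc 1 M,
    Dt (uniformMesh T M) Z i j
      + (1 / 2) *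
        ((shiftedSpeed a g (S i) (uniformMesh T M j)
              + |shiftedSpeed a g (S i) (uniformMesh T M j)|) * Dx S Z i j
          + (shiftedSpeed a g (S i) (uniformMesh T M j)
              - |shiftedSpeed a g (S i) (uniformMesh T M j)|) * DxPlus S Z i j) = 0
  left : ∀ j ∈ Finset.Icc 1 M, Dt (uniformMesh T M) Z 0 j = 0
  right : ∀ j ∈ Finset.Icc 1 M, Z N j = ζ (S N)
  initial : ∀ i ∈ Finset.Icc 0 N, Z i 0 = ζ (S i)

/-- The piecewise linear hat function of the node `X i` among `X 0 < ⋯ < X n`. -/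
def hat (X : ℕ → ℝ) (n i : ℕ) (x : ℝ) : ℝ :=
  if 0 < i ∧ X (i - 1) ≤ x ∧ x ≤ X i then (x - X (i - 1)) / (X i - X (i - 1))
  else if i < n ∧ X i ≤ x ∧ x ≤ X (i + 1) then (X (i + 1) - x) / (X (i + 1) - X i)
  else 0

/-- The piecewise bilinear interpolant of a mesh function. -/
def interpolant (X τ : ℕ → ℝ) (N M : ℕ) (U : ℕ → ℕ → ℝ) (x t : ℝ) : ℝ :=
  ∑ i ∈ Finset.range (N + 1), ∑ j ∈ Finset.range (M + 1), U i j * hat X N i x * hat τ M j t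

/-- The global approximation of the interior layer component: the bilinear interpolant in
the variables `(x - g(t), t)` to the right of the characteristic, and zero to its left. -/
def pulseInterpolant (g : ℝ → ℝ) (S τ : ℕ → ℝ) (N M : ℕ) (Z : ℕ → ℕ → ℝ) (x t : ℝ) : ℝ :=
  if g t ≤ x then interpolant S τ N M Z (x - g t) t else 0

end FlowAway

end

/-!
The bounds on `f` are much stronger than they look: those for `i = 0, 1` give `f(0) = f'(0) = 0`,
the one for `i = 2` gives `|f''(x)| ≤ C₁ ε⁻¹ e^(-x/ε)`, and the right-hand side has integral at most
`C₁`. Hence `|f'| ≤ C₁` uniformly in `ε` (`exists_isProfile`). It turns out that this one bound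
controls two derivatives of every component of the solution, uniformly in `ε`, so that each of the
three schemes converges with first order on every mesh with steps of order `1/N` and `1/M`. The
Shishkin meshes have steps at most `2 L / N`, and `1/N` is dominated by `(log N)² / N`.

*Coordinates.* The coefficient `a` extends to a `C³` velocity field `A` on the plane which is bounded
between positive constants (`exists_isGlobalSpeed`). Its characteristics form a `C²` flow `Y(η, t)`
with a `C²` first integral `ξ(x, t)`, the starting point of the characteristic through `(x, t)`
(`exists_isFlow`); in particular `g(t) = Y(0, t)`.

*Components.* Let `f` also denote the extension of the source by zero to the left half-line, `F` its
primitive and `ω` the primitive of `f / A(·, 0)`. Then `z = -ω(ξ)`, which vanishes for `x ≤ g(t)`.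
For `w`, subtracting `F(x) / A` from the equation `w_t + A w_x = F'(x)` leaves the source
`F (A_t + A A_x) / A²`, which is integrated along characteristics. All this involves only primitives
of `f`, whose first two derivatives are controlled by `C₁`
(`exists_isC2Bound_boundaryLayer`, `exists_isC2Bound_alignedLayer`). The remaining part
`v = u - w - z` solves a problem without `f`; by the maximum principle
(`IsClassicalSolution.unique`) it is one and the same function for all sources and all `ε`.

*Schemes.* The upwind schemes for `v` and `w` are first order consistent and stable in the maximum
norm (`upwind_interpolant_error`). The aligned scheme for `z` satisfies a discrete maximum principle
(`relOp_max_principle`), but at `s = L` it keeps the initial value and so makes an error of order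
`t`. In the original coordinates this error is made at `x = L + g(t)`, and it is carried away to the
right. Quantitatively, the function `exp (λ (s - L + g(t) - α t / 2))` is a supersolution of the
scheme when `λ` is a small multiple of the inverse of the mesh width (`relOp_barrier_nonneg`). At
`s = L` it is at least `λ α t / 2`, so a multiple of it of the order of the mesh width dominates the
boundary error there; where `x = s + g(t) ≤ L` it is at most one (`pulse_error`).
-/

namespace FlowAway

open Filter Topology Set MeasureTheory

/-! ### Extension of smooth functions across the sides of a rectangle -/

/-- Two Taylor series on closed sets which agree on the intersection glue to a Taylor series on
the union. -/
theorem hasFTaylorSeriesUpToOn_union {E F : Type*} [NormedAddCommGroup E] [NormedSpace ℝ E]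
    [NormedAddCommGroup F] [NormedSpace ℝ F] {n : ℕ} {f : E → F} {S₁ S₂ : Set E}
    {p₁ p₂ : E → FormalMultilinearSeries ℝ E F} [DecidablePred (· ∈ S₁)]
    (hS₁ : IsClosed S₁) (hS₂ : IsClosed S₂)
    (h₁ : HasFTaylorSeriesUpToOn n f p₁ S₁) (h₂ : HasFTaylorSeriesUpToOn n f p₂ S₂)
    (heq : ∀ x ∈ S₁ ∩ S₂, ∀ m : ℕ, m ≤ n → p₁ x m = p₂ x m) :
    HasFTaylorSeriesUpToOn n f (fun x => if x ∈ S₁ then p₁ x else p₂ x) (S₁ ∪ S₂) := by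
  have e₁ : ∀ x ∈ S₁, ∀ m : ℕ, (if x ∈ S₁ then p₁ x else p₂ x) m = p₁ x m := by
    intro x hx m; simp [hx]
  have e₂ : ∀ x ∈ S₂, ∀ m : ℕ, m ≤ n → (if x ∈ S₁ then p₁ x else p₂ x) m = p₂ x m := by
    intro x hx m hm
    by_cases h : x ∈ S₁
    · simp only [h, if_true]; exact heq x ⟨h, hx⟩ m hm
    · simp [h]
  refine ⟨?_, ?_, ?_⟩
  · intro x hx
    by_cases h : x ∈ S₁
    · simp only [h, if_true]; exact h₁.zero_eq x h
    · simp only [h, if_false]; exact h₂.zero_eq x (hx.resolve_left h)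
  · intro m hm x hx
    have hm' : m < n := by exact_mod_cast hm
    refine HasFDerivWithinAt.union ?_ ?_
    · by_cases h : x ∈ S₁
      · rw [show (if x ∈ S₁ then p₁ x else p₂ x) m.succ = p₁ x m.succ from e₁ x h _]
        exact (h₁.fderivWithin m hm x h).congr (fun y hy => e₁ y hy m) (e₁ x h m)
      · exact HasFDerivWithinAt.of_notMem_closure (by rwa [hS₁.closure_eq])
    · by_cases h : x ∈ S₂
      · rw [show (if x ∈ S₁ then p₁ x else p₂ x) m.succ = p₂ x m.succ from e₂ x h _ hm']
        exact (h₂.fderivWithin m hm x h).congr (fun y hy => e₂ y hy m hm'.le) (e₂ x h m hm'.le)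
      · exact HasFDerivWithinAt.of_notMem_closure (by rwa [hS₂.closure_eq])
  · intro m hm
    have hm' : m ≤ n := by exact_mod_cast hm
    exact ((h₁.cont m hm).congr (fun y hy => e₁ y hy m)).union_of_isClosed
      ((h₂.cont m hm).congr (fun y hy => e₂ y hy m hm')) hS₁ hS₂

/-- The linear map `(x, t) ↦ (c x, t)`. -/
noncomputable def stretch (c : ℝ) : ℝ × ℝ →L[ℝ] ℝ × ℝ :=
  (c • ContinuousLinearMap.fst ℝ ℝ ℝ).prod (ContinuousLinearMap.snd ℝ ℝ ℝ)

@[simp] theorem stretch_apply (c : ℝ) (p : ℝ × ℝ) : stretch c p = (c * p.1, p.2) := rfl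

/-- The weights `10, -20, 15, -4` satisfy `∑ cₖ (-k)ʲ = 1` for `j ≤ 3`; hence reflecting a
multilinear form of degree at most three with them reproduces the form. -/
theorem reflect_multilinear {m : ℕ} (hm : m ≤ 3)
    (q : ContinuousMultilinearMap ℝ (fun _ : Fin m => ℝ × ℝ) ℝ) :
    (10 : ℝ) • q.compContinuousLinearMap (fun _ => stretch (-1))
      + (-20 : ℝ) • q.compContinuousLinearMap (fun _ => stretch (-2))
      + (15 : ℝ) • q.compContinuousLinearMap (fun _ => stretch (-3))
      + (-4 : ℝ) • q.compContinuousLinearMap (fun _ => stretch (-4)) = q := by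
  apply ContinuousMultilinearMap.toMultilinearMap_injective
  refine Module.Basis.ext_multilinear (fun _ => Module.Basis.finTwoProd ℝ) fun σ => ?_
  have key : ∀ c : ℝ, q (fun i => stretch c (Module.Basis.finTwoProd ℝ (σ i)))
      = c ^ (Finset.univ.filter fun i => σ i = 0).card
        * q (fun i => Module.Basis.finTwoProd ℝ (σ i)) := by
    intro c
    have h1 : (fun i => stretch c (Module.Basis.finTwoProd ℝ (σ i)))
        = fun i => (if σ i = 0 then c else 1) • Module.Basis.finTwoProd ℝ (σ i) := by
      funext i
      obtain h | h : σ i = 0 ∨ σ i = 1 := by omega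
      · simp [h]
      · simp [h]
    rw [h1, q.map_smul_univ, Finset.prod_ite]
    simp
  have hc : (Finset.univ.filter fun i => σ i = 0).card ≤ 3 :=
    (Finset.card_le_univ _).trans (by simpa using hm)
  simp only [ContinuousMultilinearMap.coe_coe, add_apply,
    smul_apply, ContinuousMultilinearMap.compContinuousLinearMap_apply,
    smul_eq_mul]
  rw [key, key, key, key]
  generalize (Finset.univ.filter fun i => σ i = 0).card = j at hc
  interval_cases j <;> ring

/-- Extension across the side `x = 0` of a rectangle by a combination of the reflections
`f (-k x, t)` with `k ≤ 4`, which are defined for `x ≥ -r / 4`. The Taylor series match on the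
side. -/
theorem exists_contDiffOn_reflect {f : ℝ × ℝ → ℝ} {r c d : ℝ} (hr : 0 < r) (hcd : c < d)
    (hf : ContDiffOn ℝ 3 f (Icc 0 r ×ˢ Icc c d)) :
    ∃ F : ℝ × ℝ → ℝ, ContDiffOn ℝ 3 F (Icc (-(r / 4)) r ×ˢ Icc c d) ∧
      EqOn F f (Icc 0 r ×ˢ Icc c d) := by
  classical
  set S₁ : Set (ℝ × ℝ) := Icc 0 r ×ˢ Icc c d with hS₁
  set S₂ : Set (ℝ × ℝ) := Icc (-(r / 4)) 0 ×ˢ Icc c d with hS₂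
  have hud : UniqueDiffOn ℝ S₁ := (uniqueDiffOn_Icc hr).prod (uniqueDiffOn_Icc hcd)
  set p := ftaylorSeriesWithin ℝ f S₁
  have hp : HasFTaylorSeriesUpToOn (3 : ℕ) f p S₁ := hf.ftaylorSeriesWithin hud
  have hk : ∀ b k : ℝ, 0 ≤ k → k ≤ 4 →
      HasFTaylorSeriesUpToOn (3 : ℕ) (fun x => b • f (stretch (-k) x))
      (fun x m => b • (p (stretch (-k) x) m).compContinuousLinearMap fun _ => stretch (-k)) S₂ := by
    intro b k hk hk'
    have h1 := (hp.compContinuousLinearMap (stretch (-k))).mono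
      (t := S₂) (by
        rintro ⟨x, t⟩ ⟨hx, ht⟩
        simp only [mem_Icc] at hx
        refine ⟨?_, ht⟩
        simp only [stretch_apply, mem_Icc]
        constructor <;> nlinarith)
    exact h1.continuousLinearMap_comp (b • ContinuousLinearMap.id ℝ ℝ)
  have h2 := (((hk 10 1 (by norm_num) (by norm_num)).add (hk (-20) 2 (by norm_num)
    (by norm_num))).add (hk 15 3 (by norm_num) (by norm_num))).add
      (hk (-4) 4 (by norm_num) (by norm_num))
  set F : ℝ × ℝ → ℝ := fun x => if x ∈ S₁ then f x else
    (10 : ℝ) • f (stretch (-1) x) + (-20 : ℝ) • f (stretch (-2) x) + (15 : ℝ) • f (stretch (-3) x)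
      + (-4 : ℝ) • f (stretch (-4) x) with hF
  have hfix : ∀ x ∈ S₁ ∩ S₂, ∀ k : ℝ, stretch k x = x := by
    rintro ⟨x, t⟩ ⟨⟨hx, -⟩, ⟨hx', -⟩⟩ k
    have : x = 0 := le_antisymm hx'.2 hx.1
    simp [this]
  have hF1 : EqOn F f S₁ := fun x hx => by simp [hF, hx]
  have hF2 : ∀ x ∈ S₂, F x = (10 : ℝ) • f (stretch (-1) x) + (-20 : ℝ) • f (stretch (-2) x)
      + (15 : ℝ) • f (stretch (-3) x) + (-4 : ℝ) • f (stretch (-4) x) := by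
    intro x hx
    by_cases h : x ∈ S₁
    · simp only [hF, h, if_true, hfix x ⟨h, hx⟩, smul_eq_mul]; ring
    · simp only [hF, h, if_false]
  have hU : Icc (-(r / 4)) r ×ˢ Icc c d = S₁ ∪ S₂ := by
    rw [hS₁, hS₂, ← Set.union_prod, Set.union_comm, Icc_union_Icc_eq_Icc (by linarith) hr.le]
  refine ⟨F, ?_, hF1⟩
  rw [hU]
  have h3 := hasFTaylorSeriesUpToOn_union (f := F) (isClosed_Icc.prod isClosed_Icc)
    (isClosed_Icc.prod isClosed_Icc) (hp.congr hF1) (h2.congr hF2) (by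
      intro x hx m hm
      change p x m = (10 : ℝ) • (p (stretch (-1) x) m).compContinuousLinearMap _
        + (-20 : ℝ) • (p (stretch (-2) x) m).compContinuousLinearMap _
        + (15 : ℝ) • (p (stretch (-3) x) m).compContinuousLinearMap _
        + (-4 : ℝ) • (p (stretch (-4) x) m).compContinuousLinearMap _
      rw [hfix x hx, hfix x hx, hfix x hx, hfix x hx]
      exact (reflect_multilinear hm (p x m)).symm)
  exact h3.contDiffOn

/-- A `C³` function on a rectangle extends to a `C³` function on a larger rectangle, except that
the right-hand side of the rectangle is left in place. -/
theorem exists_contDiffOn_extend {f : ℝ × ℝ → ℝ} {r T : ℝ} (hr : 0 < r) (hT : 0 < T)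
    (hf : ContDiffOn ℝ 3 f (Icc 0 r ×ˢ Icc 0 T)) :
    ∃ F : ℝ × ℝ → ℝ, ContDiffOn ℝ 3 F (Icc (-(r / 4)) r ×ˢ Icc (-(T / 4)) (T + T / 4)) ∧
      EqOn F f (Icc 0 r ×ˢ Icc 0 T) := by
  obtain ⟨F₁, h₁, e₁⟩ := exists_contDiffOn_reflect hr hT hf
  -- The sides `t = 0` and `t = T` become the side `x = 0` after exchanging the variables and,
  -- for the second one, reversing time.
  have hswap : ContDiffOn ℝ 3 (F₁ ∘ Prod.swap) (Icc 0 T ×ˢ Icc (-(r / 4)) r) :=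
    h₁.comp (contDiff_snd.prodMk contDiff_fst).contDiffOn (fun p hp => ⟨hp.2, hp.1⟩)
  obtain ⟨F₂, h₂, e₂⟩ := exists_contDiffOn_reflect hT (by linarith) hswap
  have hflip : ContDiffOn ℝ 3 (fun p : ℝ × ℝ => F₂ (T - p.1, p.2))
      (Icc 0 (T + T / 4) ×ˢ Icc (-(r / 4)) r) :=
    h₂.comp (by fun_prop : ContDiff ℝ 3 fun p : ℝ × ℝ => (T - p.1, p.2)).contDiffOn
      (fun p hp => ⟨⟨by linarith [hp.1.2], by linarith [hp.1.1]⟩, hp.2⟩)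
  obtain ⟨F₃, h₃, e₃⟩ := exists_contDiffOn_reflect (by linarith) (by linarith) hflip
  refine ⟨fun p => F₃ (T - p.2, p.1), ?_, ?_⟩
  · refine h₃.comp (by fun_prop : ContDiff ℝ 3 fun p : ℝ × ℝ => (T - p.2, p.1)).contDiffOn
      (fun p hp => ⟨⟨?_, ?_⟩, hp.1⟩)
    · have := hp.2.2; simp only; linarith
    · have := hp.2.1; simp only; linarith
  · rintro ⟨x, t⟩ ⟨hx, ht⟩
    simp only [mem_Icc] at hx ht
    have hx' : x ∈ Icc (-(r / 4)) r := ⟨by linarith, hx.2⟩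
    have a₃ := e₃ (show (T - t, x) ∈ Icc 0 (T + T / 4) ×ˢ Icc (-(r / 4)) r from
      ⟨⟨by simp only; linarith, by simp only; linarith⟩, hx'⟩)
    have a₂ := e₂ (show (t, x) ∈ Icc 0 T ×ˢ Icc (-(r / 4)) r from ⟨ht, hx'⟩)
    have a₁ := e₁ (show (x, t) ∈ Icc 0 r ×ˢ Icc 0 T from ⟨hx, ht⟩)
    simp only [sub_sub_cancel, Function.comp, Prod.swap] at a₃ a₂
    exact a₃.trans (a₂.trans a₁)

/-- A velocity field on the whole plane: `C³`, bounded below by a positive constant, bounded, and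
uniformly Lipschitz in the space variable. -/
structure IsGlobalSpeed (α K : ℝ) (A : ℝ × ℝ → ℝ) : Prop where
  pos : 0 < α
  contDiff : ContDiff ℝ 3 A
  lower : ∀ p, α ≤ A p
  upper : ∀ p, A p ≤ K
  lipschitz : ∀ x y t, |A (x, t) - A (y, t)| ≤ K * |x - y|

/-- A positive `C³` function on a rectangle extends to a global velocity field. -/
theorem exists_isGlobalSpeed {a : ℝ × ℝ → ℝ} {R T α : ℝ} (hR : 0 < R) (hT : 0 < T) (hα : 0 < α)
    (ha : ContDiffOn ℝ 3 a (Ici 0 ×ˢ Icc 0 T)) (hpos : ∀ p ∈ Ici (0 : ℝ) ×ˢ Icc 0 T, α ≤ a p) :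
    ∃ K A, IsGlobalSpeed (α / 2) K A ∧ EqOn A a (Icc 0 R ×ˢ Icc 0 T) := by
  -- The extension does not cross the right-hand side, hence the rectangle of width `2 R`.
  obtain ⟨F, hF, hFa⟩ := exists_contDiffOn_extend (r := 2 * R) (by linarith) hT
    (ha.mono (prod_mono Icc_subset_Ici_self le_rfl))
  set O : Set (ℝ × ℝ) := Ioo (-(2 * R / 4)) (2 * R) ×ˢ Ioo (-(T / 4)) (T + T / 4) with hO
  have hOo : IsOpen O := isOpen_Ioo.prod isOpen_Ioo
  have hFO : ContDiffOn ℝ 3 F O := hF.mono (prod_mono Ioo_subset_Icc_self Ioo_subset_Icc_self)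
  set U : Set (ℝ × ℝ) := O ∩ F ⁻¹' Ioi (α / 2)
  have hU : IsOpen U := hFO.continuousOn.isOpen_inter_preimage hOo isOpen_Ioi
  set Q : Set (ℝ × ℝ) := Icc 0 R ×ˢ Icc 0 T
  have hQc : IsCompact Q := isCompact_Icc.prod isCompact_Icc
  have hQa : ∀ p ∈ Q, F p = a p := fun p hp => hFa ⟨⟨hp.1.1, by linarith [hp.1.2]⟩, hp.2⟩
  have hQU : Q ⊆ U := by
    intro p hp
    refine ⟨⟨⟨by linarith [hp.1.1], by linarith [hp.1.2]⟩, by linarith [hp.2.1],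
      by linarith [hp.2.2]⟩, ?_⟩
    have := hpos p ⟨hp.1.1, hp.2⟩
    rw [mem_preimage, hQa p hp, mem_Ioi]; linarith
  obtain ⟨K', hK'c, hQK', hK'U⟩ := exists_compact_between hQc hU hQU
  obtain ⟨ρ, hρ1, hρ0, hρ⟩ := exists_contMDiffMap_one_nhds_of_subset_interior
    (n := (3 : ℕ∞)) (modelWithCornersSelf ℝ (ℝ × ℝ)) hQc.isClosed hQK'
  have hρd : ContDiff ℝ 3 (ρ : ℝ × ℝ → ℝ) := ρ.contMDiff.contDiff
  have hρ1' : ∀ p ∈ Q, ρ p = 1 := fun p hp => (hρ1.self_of_nhdsSet) p hp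
  -- The velocity field is `α + B = ρ F + (1 - ρ) α`, and `F ≥ α / 2` on the support of `ρ`.
  set B : ℝ × ℝ → ℝ := fun p => ρ p * (F p - α) with hB
  have hBt : tsupport B ⊆ K' := by
    refine closure_minimal ?_ hK'c.isClosed
    intro p hp
    by_contra h
    exact hp (by simp [hB, hρ0 p h])
  have hBd : ContDiff ℝ 3 B := by
    refine (contMDiff_of_tsupport (I := modelWithCornersSelf ℝ (ℝ × ℝ))
      (n := 3) fun p hp => ?_).contDiff
    have hpU := hK'U (hBt hp)
    refine ContDiffAt.contMDiffAt ?_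
    exact hρd.contDiffAt.mul ((hFO.contDiffAt (hOo.mem_nhds hpU.1)).sub contDiffAt_const)
  have hBs : HasCompactSupport B := HasCompactSupport.intro' hK'c hK'c.isClosed
    (fun p hp => by simp [hB, hρ0 p hp])
  obtain ⟨C, hC⟩ := hBd.lipschitzWith_of_hasCompactSupport hBs (by norm_num)
  obtain ⟨D, hD⟩ := hBs.exists_bound_of_continuous hBd.continuous
  refine ⟨max C (D + α), fun p => α + B p, ⟨by linarith, contDiff_const.add hBd, ?_, ?_, ?_⟩, ?_⟩
  · intro p
    by_cases h : p ∈ K'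
    · have h1 : α / 2 < F p := (hK'U h).2
      have h2 := hρ p
      simp only [hB]
      nlinarith [h2.1, h2.2]
    · simp only [hB, hρ0 p h]; linarith
  · intro p
    have := (le_abs_self _).trans (hD p)
    exact le_trans (by linarith) (le_max_right _ _)
  · intro x y t
    have h := hC.dist_le_mul (x, t) (y, t)
    rw [Real.dist_eq, Prod.dist_eq, dist_self, max_eq_left dist_nonneg, Real.dist_eq] at h
    calc |α + B (x, t) - (α + B (y, t))| = |B (x, t) - B (y, t)| := by ring_nf
      _ ≤ C * |x - y| := h
      _ ≤ _ := by gcongr; exact le_max_left _ _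
  · intro p hp
    simp only [hB, hρ1' p hp, hQa p hp]; ring

/-! ### Partial derivatives in the plane and integrals depending on a parameter -/

/-- The partial derivative in the first (space) variable. -/
noncomputable def dx (h : ℝ × ℝ → ℝ) (p : ℝ × ℝ) : ℝ := fderiv ℝ h p (1, 0)

/-- The partial derivative in the second (time) variable. -/
noncomputable def dt (h : ℝ × ℝ → ℝ) (p : ℝ × ℝ) : ℝ := fderiv ℝ h p (0, 1)

theorem fderiv_apply_eq (h : ℝ × ℝ → ℝ) (p v : ℝ × ℝ) :
    fderiv ℝ h p v = v.1 * dx h p + v.2 * dt h p := by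
  have : v = v.1 • ((1, 0) : ℝ × ℝ) + v.2 • ((0, 1) : ℝ × ℝ) := by ext <;> simp
  conv_lhs => rw [this]
  rw [map_add, map_smul, map_smul]
  rfl

theorem ContDiff.dx {h : ℝ × ℝ → ℝ} {n m : WithTop ℕ∞} (hh : ContDiff ℝ n h) (hm : m + 1 ≤ n) :
    ContDiff ℝ m (dx h) := (hh.fderiv_right hm).clm_apply contDiff_const

theorem ContDiff.dt {h : ℝ × ℝ → ℝ} {n m : WithTop ℕ∞} (hh : ContDiff ℝ n h) (hm : m + 1 ≤ n) :
    ContDiff ℝ m (dt h) := (hh.fderiv_right hm).clm_apply contDiff_const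

theorem hasDerivAt_fst {h : ℝ × ℝ → ℝ} (hh : Differentiable ℝ h) (x t : ℝ) :
    HasDerivAt (fun y => h (y, t)) (dx h (x, t)) x := by
  have h1 : HasDerivAt (fun y : ℝ => (y, t)) ((1 : ℝ), (0 : ℝ)) x :=
    (hasDerivAt_id x).prodMk (hasDerivAt_const x t)
  exact (hh (x, t)).hasFDerivAt.comp_hasDerivAt x h1

theorem hasDerivAt_snd {h : ℝ × ℝ → ℝ} (hh : Differentiable ℝ h) (x t : ℝ) :
    HasDerivAt (fun s => h (x, s)) (dt h (x, t)) t := by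
  have h1 : HasDerivAt (fun s : ℝ => (x, s)) ((0 : ℝ), (1 : ℝ)) t :=
    (hasDerivAt_const t x).prodMk (hasDerivAt_id t)
  exact (hh (x, t)).hasFDerivAt.comp_hasDerivAt t h1

/-- The chain rule along a curve in the plane. -/
theorem hasDerivAt_along {h : ℝ × ℝ → ℝ} (hh : Differentiable ℝ h) {x y : ℝ → ℝ} {x' y' s : ℝ}
    (hx : HasDerivAt x x' s) (hy : HasDerivAt y y' s) :
    HasDerivAt (fun r => h (x r, y r)) (x' * dx h (x s, y s) + y' * dt h (x s, y s)) s := by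
  have h1 := (hh (x s, y s)).hasFDerivAt.comp_hasDerivAt s (hx.prodMk hy)
  rwa [fderiv_apply_eq] at h1

/-- The derivative of a function on the plane with continuous partial derivatives. -/
theorem hasFDerivAt_of_partials {h hx ht : ℝ × ℝ → ℝ}
    (h₁ : ∀ x t, HasDerivAt (fun y => h (y, t)) (hx (x, t)) x)
    (h₂ : ∀ x t, HasDerivAt (fun s => h (x, s)) (ht (x, t)) t)
    (c₁ : Continuous hx) (c₂ : Continuous ht) (p : ℝ × ℝ) :
    HasFDerivAt h (hx p • ContinuousLinearMap.fst ℝ ℝ ℝ + ht p • ContinuousLinearMap.snd ℝ ℝ ℝ)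
      p := by
  have key := hasStrictFDerivAt_uncurry_coprod (𝕜 := ℝ) (u := p) (f := fun x t => h (x, t))
    (f₁ := fun x t => hx (x, t) • (1 : ℝ →L[ℝ] ℝ)) (f₂ := fun x t => ht (x, t) • (1 : ℝ →L[ℝ] ℝ))
    (Eventually.of_forall fun v => (h₁ v.1 v.2).hasFDerivAt.congr_fderiv
      (by ext; simp [Function.HasUncurry.uncurry]))
    (Eventually.of_forall fun v => (h₂ v.1 v.2).hasFDerivAt.congr_fderiv
      (by ext; simp [Function.HasUncurry.uncurry]))
    (by
      have : Continuous fun q : ℝ × ℝ => hx (q.1, q.2) • (1 : ℝ →L[ℝ] ℝ) := by fun_prop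
      exact this.continuousAt)
    (by
      have : Continuous fun q : ℝ × ℝ => ht (q.1, q.2) • (1 : ℝ →L[ℝ] ℝ) := by fun_prop
      exact this.continuousAt)
  exact HasFDerivAt.congr_fderiv (f := h) key.hasFDerivAt
    (by ext <;> simp [Function.HasUncurry.uncurry])

theorem contDiff_succ_of_partials {h hx ht : ℝ × ℝ → ℝ} {n : ℕ}
    (h₁ : ∀ x t, HasDerivAt (fun y => h (y, t)) (hx (x, t)) x)
    (h₂ : ∀ x t, HasDerivAt (fun s => h (x, s)) (ht (x, t)) t)
    (c₁ : ContDiff ℝ n hx) (c₂ : ContDiff ℝ n ht) : ContDiff ℝ (n + 1 : ℕ) h := by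
  have key := hasFDerivAt_of_partials h₁ h₂ c₁.continuous c₂.continuous
  push_cast
  rw [contDiff_succ_iff_hasFDerivAt]
  exact ⟨_, (c₁.smul contDiff_const).add (c₂.smul contDiff_const), key⟩

theorem dx_eq {h : ℝ × ℝ → ℝ} (hh : Differentiable ℝ h) {c x t : ℝ}
    (h₁ : HasDerivAt (fun y => h (y, t)) c x) : dx h (x, t) = c :=
  (hasDerivAt_fst hh x t).unique h₁

theorem dt_eq {h : ℝ × ℝ → ℝ} (hh : Differentiable ℝ h) {c x t : ℝ}
    (h₁ : HasDerivAt (fun s => h (x, s)) c t) : dt h (x, t) = c :=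
  (hasDerivAt_snd hh x t).unique h₁

/-- The primitive in time of a function on the plane. -/
noncomputable def timePrimitive (k : ℝ × ℝ → ℝ) (p : ℝ × ℝ) : ℝ := ∫ s in (0 : ℝ)..p.2, k (p.1, s)

theorem continuous_timePrimitive {k : ℝ × ℝ → ℝ} (hk : Continuous k) :
    Continuous (timePrimitive k) :=
  intervalIntegral.continuous_parametric_primitive_of_continuous (f := fun x s => k (x, s))
    hk

theorem hasDerivAt_timePrimitive_snd {k : ℝ × ℝ → ℝ} (hk : Continuous k) (x t : ℝ) :
    HasDerivAt (fun s => timePrimitive k (x, s)) (k (x, t)) t := by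
  have hc : Continuous fun s => k (x, s) := by fun_prop
  exact intervalIntegral.integral_hasDerivAt_right (hc.intervalIntegrable _ _)
    (hc.stronglyMeasurableAtFilter _ _) hc.continuousAt

theorem hasDerivAt_timePrimitive_fst {k : ℝ × ℝ → ℝ} (hk : ContDiff ℝ 1 k) (x t : ℝ) :
    HasDerivAt (fun y => timePrimitive k (y, t)) (timePrimitive (dx k) (x, t)) x := by
  have hd : Continuous (dx k) := (ContDiff.dx (m := 0) hk (by norm_num)).continuous
  have hkc := hk.continuous
  obtain ⟨C, hC⟩ := ((isCompact_closedBall x 1).prod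
    (isCompact_uIcc (a := (0 : ℝ)) (b := t))).exists_bound_of_continuousOn hd.continuousOn
  refine (intervalIntegral.hasDerivAt_integral_of_dominated_loc_of_deriv_le (μ := volume)
    (F := fun y s => k (y, s)) (F' := fun y s => dx k (y, s)) (bound := fun _ => C)
    (Metric.closedBall_mem_nhds x one_pos) ?_ ?_ ?_ ?_ ?_ ?_).2
  · exact Eventually.of_forall fun y => Continuous.aestronglyMeasurable (by fun_prop)
  · exact Continuous.intervalIntegrable (by fun_prop) _ _
  · exact Continuous.aestronglyMeasurable (by fun_prop)
  · exact Eventually.of_forall fun s hs y hy => hC (y, s) ⟨hy, uIoc_subset_uIcc hs⟩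
  · exact intervalIntegrable_const
  · exact Eventually.of_forall fun s _ y _ => hasDerivAt_fst (hk.differentiable (by norm_num)) y s

theorem contDiff_one_timePrimitive {k : ℝ × ℝ → ℝ} (hk : ContDiff ℝ 1 k) :
    ContDiff ℝ 1 (timePrimitive k) :=
  contDiff_succ_of_partials (n := 0) (hasDerivAt_timePrimitive_fst hk)
    (hasDerivAt_timePrimitive_snd hk.continuous)
    (contDiff_zero.2 (continuous_timePrimitive
      (ContDiff.dx (m := 0) hk (by norm_num)).continuous)) (hk.of_le (by norm_num))

theorem contDiff_two_timePrimitive {k : ℝ × ℝ → ℝ} (hk : ContDiff ℝ 2 k) :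
    ContDiff ℝ 2 (timePrimitive k) :=
  contDiff_succ_of_partials (n := 1)
    (hasDerivAt_timePrimitive_fst (hk.of_le (by norm_num)))
    (hasDerivAt_timePrimitive_snd hk.continuous)
    (contDiff_one_timePrimitive (ContDiff.dx (m := 1) hk (by norm_num))) (hk.of_le (by norm_num))

/-! ### The characteristic flow and its first integral -/

/-- The averaged slope of `A` between `x` and `y` at time `t`, which depends continuously on all
variables. -/
noncomputable def meanSlope (A : ℝ × ℝ → ℝ) (x y t : ℝ) : ℝ :=
  ∫ r in (0 : ℝ)..1, dx A (y + r * (x - y), t)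

theorem continuous_meanSlope {A : ℝ × ℝ → ℝ} (hA : ContDiff ℝ 1 A) :
    Continuous fun q : ℝ × ℝ × ℝ => meanSlope A q.1 q.2.1 q.2.2 := by
  have hd : Continuous (dx A) := (ContDiff.dx (m := 0) hA (by norm_num)).continuous
  exact intervalIntegral.continuous_parametric_intervalIntegral_of_continuous'
    (f := fun (q : ℝ × ℝ × ℝ) r => dx A (q.2.1 + r * (q.1 - q.2.1), q.2.2))
    (by unfold Function.uncurry; fun_prop) 0 1

theorem meanSlope_self (A : ℝ × ℝ → ℝ) (x t : ℝ) : meanSlope A x x t = dx A (x, t) := by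
  simp [meanSlope]

theorem sub_eq_meanSlope_mul {A : ℝ × ℝ → ℝ} (hA : ContDiff ℝ 1 A) (x y t : ℝ) :
    A (x, t) - A (y, t) = meanSlope A x y t * (x - y) := by
  have hd : Continuous (dx A) := (ContDiff.dx (m := 0) hA (by norm_num)).continuous
  have h1 : ∀ r : ℝ, HasDerivAt (fun r => A (y + r * (x - y), t))
      (dx A (y + r * (x - y), t) * (x - y)) r := by
    intro r
    have h2 : HasDerivAt (fun r : ℝ => y + r * (x - y)) (x - y) r := by
      simpa using ((hasDerivAt_id r).mul_const (x - y)).const_add y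
    exact (hasDerivAt_fst (hA.differentiable (by norm_num)) (y + r * (x - y)) t).comp r h2
  have h3 := intervalIntegral.integral_eq_sub_of_hasDerivAt (a := 0) (b := 1)
    (fun r _ => h1 r) (Continuous.intervalIntegrable (by fun_prop) _ _)
  rw [intervalIntegral.integral_mul_const] at h3
  rw [meanSlope, h3]
  simp

namespace IsGlobalSpeed

variable {α K : ℝ} {A : ℝ × ℝ → ℝ}

theorem const_pos (hA : IsGlobalSpeed α K A) : 0 < K :=
  hA.pos.trans_le ((hA.lower 0).trans (hA.upper 0))

theorem lipschitzWith (hA : IsGlobalSpeed α K A) (t : ℝ) :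
    LipschitzWith K.toNNReal fun x => A (x, t) :=
  LipschitzWith.of_dist_le_mul fun x y => by
    rw [Real.dist_eq, Real.dist_eq, Real.coe_toNNReal _ hA.const_pos.le]
    exact hA.lipschitz x y t

theorem abs_meanSlope_le (hA : IsGlobalSpeed α K A) (x y t : ℝ) : |meanSlope A x y t| ≤ K := by
  have h1 : ∀ p, ‖dx A p‖ ≤ K := by
    intro p
    have h := hasDerivAt_fst (hA.contDiff.differentiable (by norm_num)) p.1 p.2
    have := h.le_of_lipschitz (hA.lipschitzWith p.2)
    rwa [Real.coe_toNNReal _ hA.const_pos.le] at this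
  have := intervalIntegral.norm_integral_le_of_norm_le_const (a := 0) (b := 1)
    (f := fun r => dx A (y + r * (x - y), t)) (fun r _ => h1 _)
  simpa [meanSlope] using this

/-- Characteristics exist for all times: the solutions given by the Picard–Lindelöf theorem on the
intervals `[t₀ - n, t₀ + n]` extend each other. -/
theorem exists_solution (hA : IsGlobalSpeed α K A) (t₀ x₀ : ℝ) :
    ∃ y : ℝ → ℝ, y t₀ = x₀ ∧ ∀ t, HasDerivAt y (A (y t, t)) t := by
  have hK := hA.const_pos
  have hAc : Continuous A := hA.contDiff.continuous
  have hloc : ∀ n : ℕ, ∃ y : ℝ → ℝ, y t₀ = x₀ ∧ ∀ t ∈ Icc (t₀ - (n + 1)) (t₀ + (n + 1)),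
      HasDerivWithinAt y (A (y t, t)) (Icc (t₀ - (n + 1)) (t₀ + (n + 1))) t := by
    intro n
    have hn : (0 : ℝ) < n + 1 := by positivity
    have hP : IsPicardLindelof (fun t x => A (x, t)) (tmin := t₀ - (n + 1)) (tmax := t₀ + (n + 1))
        ⟨t₀, by constructor <;> linarith⟩ x₀ (K * (n + 1)).toNNReal 0 K.toNNReal K.toNNReal := by
      refine ⟨fun t _ => (hA.lipschitzWith t).lipschitzOnWith, fun x _ => ?_, fun t _ x _ => ?_, ?_⟩
      · exact Continuous.continuousOn (by fun_prop)
      · rw [Real.coe_toNNReal _ hK.le, Real.norm_eq_abs, abs_of_pos (hA.pos.trans_le (hA.lower _))]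
        exact hA.upper _
      · rw [Real.coe_toNNReal _ hK.le, Real.coe_toNNReal _ (by positivity)]
        simp
    exact hP.exists_eq_forall_mem_Icc_hasDerivWithinAt₀
  choose y hy0 hy using hloc
  have hyd : ∀ (n : ℕ), ∀ t ∈ Ioo (t₀ - (n + 1)) (t₀ + (n + 1)),
      HasDerivAt (y n) (A (y n t, t)) t := fun n t ht =>
    (hy n t (Ioo_subset_Icc_self ht)).hasDerivAt (Icc_mem_nhds ht.1 ht.2)
  have huniq : ∀ n m : ℕ, n ≤ m → EqOn (y n) (y m) (Ioo (t₀ - (n + 1)) (t₀ + (n + 1))) := by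
    intro n m hnm
    have hnm' : (n : ℝ) ≤ m := by exact_mod_cast hnm
    have hn : (0 : ℝ) ≤ n := by positivity
    refine ODE_solution_unique_of_mem_Ioo (v := fun t x => A (x, t)) (s := fun _ => univ)
      (K := K.toNNReal) (t₀ := t₀) (fun t _ => (hA.lipschitzWith t).lipschitzOnWith)
      ⟨by linarith, by linarith⟩ (fun t ht => ⟨hyd n t ht, trivial⟩)
      (fun t ht => ⟨hyd m t ⟨by linarith [ht.1], by linarith [ht.2]⟩, trivial⟩)
      ((hy0 n).trans (hy0 m).symm)
  set z : ℝ → ℝ := fun t => y ⌈|t - t₀|⌉₊ t with hz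
  have hzy : ∀ (N : ℕ) (s : ℝ), |s - t₀| < N + 1 → z s = y (N + 1) s := by
    intro N s hs
    have h1 : ⌈|s - t₀|⌉₊ ≤ N + 1 := Nat.ceil_le.2 (by push_cast; exact hs.le)
    refine huniq _ _ h1 ?_
    have h2 := abs_le.1 (Nat.le_ceil |s - t₀|)
    exact ⟨by linarith, by linarith⟩
  refine ⟨z, by simp [hz, hy0], fun t => ?_⟩
  set N := ⌈|t - t₀|⌉₊
  have ht : |t - t₀| < N + 1 := (Nat.le_ceil _).trans_lt (by linarith)
  have h3 : z =ᶠ[𝓝 t] y (N + 1) := by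
    have : {s : ℝ | |s - t₀| < N + 1} ∈ 𝓝 t :=
      (isOpen_lt (by fun_prop) (by fun_prop)).mem_nhds ht
    filter_upwards [this] with s hs using hzy N s hs
  rw [hzy N t ht]
  refine (hyd (N + 1) t ?_).congr_of_eventuallyEq h3
  have := abs_lt.1 ht
  push_cast
  exact ⟨by linarith, by linarith⟩

/-- Two characteristics which meet coincide. -/
theorem solution_unique (hA : IsGlobalSpeed α K A) {y z : ℝ → ℝ} {t₀ : ℝ}
    (hy : ∀ t, HasDerivAt y (A (y t, t)) t) (hz : ∀ t, HasDerivAt z (A (z t, t)) t)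
    (h : y t₀ = z t₀) : y = z :=
  ODE_solution_unique_univ (v := fun t x => A (x, t)) (s := fun _ => univ)
    (fun t => (hA.lipschitzWith t).lipschitzOnWith) (fun t => ⟨hy t, trivial⟩)
    (fun t => ⟨hz t, trivial⟩) h

end IsGlobalSpeed

/-- `Y (η, t)` is the position at time `t` of the characteristic of `A` which starts at `η`, and
`ξ (x, t)` is the starting point of the characteristic through `(x, t)`. -/
structure IsFlow (A Y ξ : ℝ × ℝ → ℝ) : Prop where
  contDiff_flow : ContDiff ℝ 2 Y
  contDiff_foot : ContDiff ℝ 2 ξ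
  flow_zero : ∀ η, Y (η, 0) = η
  ode : ∀ η t, HasDerivAt (fun s => Y (η, s)) (A (Y (η, t), t)) t
  foot_flow : ∀ η t, ξ (Y (η, t), t) = η
  flow_foot : ∀ x t, Y (ξ (x, t), t) = x
  flow_strictMono : ∀ t, StrictMono fun η => Y (η, t)

section Construction

variable {α K : ℝ} {A Y : ℝ × ℝ → ℝ}

/-- Nearby characteristics: the distance evolves by the exponential of the averaged slope. -/
theorem flow_sub_flow (hA : IsGlobalSpeed α K A) (h0 : ∀ η, Y (η, 0) = η)
    (hY : ∀ η t, HasDerivAt (fun s => Y (η, s)) (A (Y (η, t), t)) t) (η η' t : ℝ) :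
    Y (η, t) - Y (η', t)
      = (η - η') * Real.exp (∫ s in (0 : ℝ)..t, meanSlope A (Y (η, s)) (Y (η', s)) s) := by
  have hA1 : ContDiff ℝ 1 A := hA.contDiff.of_le (by norm_num)
  have hYc : ∀ η, Continuous fun s => Y (η, s) := fun η =>
    continuous_iff_continuousAt.2 fun s => (hY η s).continuousAt
  set m : ℝ → ℝ := fun s => meanSlope A (Y (η, s)) (Y (η', s)) s with hm
  have hmc : Continuous m := (continuous_meanSlope hA1).comp
    ((hYc η).prodMk ((hYc η').prodMk continuous_id))
  set I : ℝ → ℝ := fun t => ∫ s in (0 : ℝ)..t, m s with hI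
  have hId : ∀ t, HasDerivAt I (m t) t := fun t =>
    intervalIntegral.integral_hasDerivAt_right (hmc.intervalIntegrable _ _)
      (hmc.stronglyMeasurableAtFilter _ _) hmc.continuousAt
  set Q : ℝ → ℝ := fun s => (Y (η, s) - Y (η', s)) * Real.exp (-I s) with hQ
  have hQd : ∀ s, HasDerivAt Q 0 s := by
    intro s
    have h1 := ((hY η s).sub (hY η' s)).mul ((hId s).neg.exp)
    refine HasDerivAt.congr_deriv (f := Q) h1 ?_
    rw [sub_eq_meanSlope_mul hA1]
    simp only [Pi.sub_apply, Pi.neg_apply, hm]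
    ring
  have hQ0 : Q t = Q 0 := is_const_of_deriv_eq_zero (fun s => (hQd s).differentiableAt)
    (fun s => (hQd s).deriv) t 0
  have hI0 : I 0 = 0 := by simp [hI]
  simp only [hQ, h0, hI0, neg_zero, Real.exp_zero, mul_one] at hQ0
  rw [← hQ0, mul_assoc, ← Real.exp_add]
  simp [hI]

theorem abs_integral_meanSlope_le (hA : IsGlobalSpeed α K A) (y z : ℝ → ℝ) (t : ℝ) :
    |∫ s in (0 : ℝ)..t, meanSlope A (y s) (z s) s| ≤ K * |t| := by
  have := intervalIntegral.norm_integral_le_of_norm_le_const (a := 0) (b := t)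
    (f := fun s => meanSlope A (y s) (z s) s) (fun s _ => hA.abs_meanSlope_le _ _ _)
  simpa using this

theorem abs_flow_sub_le (hA : IsGlobalSpeed α K A) (h0 : ∀ η, Y (η, 0) = η)
    (hY : ∀ η t, HasDerivAt (fun s => Y (η, s)) (A (Y (η, t), t)) t) (η η' t : ℝ) :
    |Y (η, t) - Y (η', t)| ≤ |η - η'| * Real.exp (K * |t|) := by
  rw [flow_sub_flow hA h0 hY, abs_mul, Real.abs_exp]
  gcongr
  exact (le_abs_self _).trans (abs_integral_meanSlope_le hA _ _ t)

theorem abs_sub_le_flow (hA : IsGlobalSpeed α K A) (h0 : ∀ η, Y (η, 0) = η)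
    (hY : ∀ η t, HasDerivAt (fun s => Y (η, s)) (A (Y (η, t), t)) t) (η η' t : ℝ) :
    |η - η'| ≤ |Y (η, t) - Y (η', t)| * Real.exp (K * |t|) := by
  rw [flow_sub_flow hA h0 hY, abs_mul, Real.abs_exp, mul_assoc, ← Real.exp_add]
  have h1 := neg_le_of_abs_le (abs_integral_meanSlope_le hA (fun s => Y (η, s))
    (fun s => Y (η', s)) t)
  exact le_mul_of_one_le_right (abs_nonneg _) (Real.one_le_exp (by linarith))

theorem continuous_flow (hA : IsGlobalSpeed α K A) (h0 : ∀ η, Y (η, 0) = η)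
    (hY : ∀ η t, HasDerivAt (fun s => Y (η, s)) (A (Y (η, t), t)) t) : Continuous Y := by
  rw [continuous_iff_continuousAt]
  rintro ⟨η, t⟩
  have hc : Continuous fun s => Y (η, s) :=
    continuous_iff_continuousAt.2 fun s => (hY η s).continuousAt
  have h1 : Tendsto (fun p : ℝ × ℝ => |p.1 - η| * Real.exp (K * |p.2|)) (𝓝 (η, t)) (𝓝 0) := by
    have : Continuous fun p : ℝ × ℝ => |p.1 - η| * Real.exp (K * |p.2|) := by fun_prop
    simpa using this.tendsto (η, t)
  have h2 : Tendsto (fun p : ℝ × ℝ => Y p - Y (η, p.2)) (𝓝 (η, t)) (𝓝 0) :=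
    squeeze_zero_norm (fun p => abs_flow_sub_le hA h0 hY p.1 η p.2) h1
  have h3 : Tendsto (fun p : ℝ × ℝ => Y (η, p.2)) (𝓝 (η, t)) (𝓝 (Y (η, t))) :=
    (hc.comp continuous_snd).tendsto (η, t)
  simpa [ContinuousAt] using h2.add h3

theorem hasDerivAt_flow_fst (hA : IsGlobalSpeed α K A) (h0 : ∀ η, Y (η, 0) = η)
    (hY : ∀ η t, HasDerivAt (fun s => Y (η, s)) (A (Y (η, t), t)) t) (η t : ℝ) :
    HasDerivAt (fun y => Y (y, t))
      (Real.exp (timePrimitive (fun p => dx A (Y p, p.2)) (η, t))) η := by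
  have hA1 : ContDiff ℝ 1 A := hA.contDiff.of_le (by norm_num)
  have hYc := continuous_flow hA h0 hY
  set E : ℝ → ℝ := fun y =>
    Real.exp (∫ s in (0 : ℝ)..t, meanSlope A (Y (y, s)) (Y (η, s)) s) with hE
  have hEc : Continuous E := by
    refine Real.continuous_exp.comp ?_
    refine intervalIntegral.continuous_parametric_intervalIntegral_of_continuous'
      (f := fun y s => meanSlope A (Y (y, s)) (Y (η, s)) s) ?_ 0 t
    refine (continuous_meanSlope hA1).comp
      (f := fun p : ℝ × ℝ => (Y (p.1, p.2), Y (η, p.2), p.2)) ?_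
    fun_prop
  have hE0 : E η = Real.exp (timePrimitive (fun p => dx A (Y p, p.2)) (η, t)) := by
    simp [hE, meanSlope_self, timePrimitive]
  rw [← hE0, hasDerivAt_iff_tendsto_slope]
  refine ((hEc.tendsto η).mono_left nhdsWithin_le_nhds).congr' ?_
  filter_upwards [self_mem_nhdsWithin] with y hy
  have hne : y - η ≠ 0 := sub_ne_zero.2 hy
  rw [slope_def_field, flow_sub_flow hA h0 hY y η t, mul_div_cancel_left₀ _ hne]

/-- The flow is of class `C²`: its derivative in the starting point is the exponential of an
integral along the characteristic, hence one order smoother than expected from the flow itself. -/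
theorem contDiff_flow (hA : IsGlobalSpeed α K A) (h0 : ∀ η, Y (η, 0) = η)
    (hY : ∀ η t, HasDerivAt (fun s => Y (η, s)) (A (Y (η, t), t)) t) : ContDiff ℝ 2 Y := by
  have hYc := continuous_flow hA h0 hY
  have hAx : ContDiff ℝ 2 (dx A) := ContDiff.dx hA.contDiff (by norm_num)
  have step : ∀ n : ℕ, n ≤ 1 → ContDiff ℝ n Y →
      ContDiff ℝ n (timePrimitive fun p => dx A (Y p, p.2)) → ContDiff ℝ (n + 1 : ℕ) Y := by
    intro n hn h1 h2
    refine contDiff_succ_of_partials (hx := fun p => Real.exp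
      (timePrimitive (fun p => dx A (Y p, p.2)) p)) (ht := fun p => A (Y p, p.2))
      (hasDerivAt_flow_fst hA h0 hY) hY h2.exp ?_
    exact (hA.contDiff.of_le (by exact_mod_cast hn.trans (by norm_num))).comp
      (h1.prodMk contDiff_snd)
  have h1 : ContDiff ℝ 1 Y := step 0 (by norm_num) (contDiff_zero.2 hYc)
    (contDiff_zero.2 (continuous_timePrimitive
      (hAx.continuous.comp (hYc.prodMk continuous_snd))))
  exact step 1 le_rfl h1 (contDiff_one_timePrimitive
    ((hAx.of_le (by norm_num)).comp (h1.prodMk contDiff_snd)))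

/-- The flow of a global velocity field exists and is a `C²` diffeomorphism. -/
theorem exists_isFlow (hA : IsGlobalSpeed α K A) : ∃ Y ξ, IsFlow A Y ξ := by
  choose y hy0 hy using hA.exists_solution 0
  set Y : ℝ × ℝ → ℝ := fun p => y p.1 p.2 with hYdef
  have h0 : ∀ η, Y (η, 0) = η := hy0
  have hY : ∀ η t, HasDerivAt (fun s => Y (η, s)) (A (Y (η, t), t)) t := hy
  have hYc := continuous_flow hA h0 hY
  have hY2 := contDiff_flow hA h0 hY
  have hsurj : ∀ x t, ∃ η, Y (η, t) = x := by
    intro x t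
    obtain ⟨z, hz0, hz⟩ := hA.exists_solution t x
    refine ⟨z 0, ?_⟩
    have : (fun s => Y (z 0, s)) = z := hA.solution_unique (t₀ := 0) (hY _) hz (h0 _)
    rw [← hz0]
    exact congrFun this t
  have hmono : ∀ t, StrictMono fun η => Y (η, t) := by
    intro t η η' h
    have := flow_sub_flow hA h0 hY η' η t
    have h2 : 0 < (η' - η) * Real.exp (∫ s in (0 : ℝ)..t, meanSlope A (Y (η', s)) (Y (η, s)) s) :=
      mul_pos (by linarith) (Real.exp_pos _)
    simp only
    linarith
  choose ξ' hξ' using hsurj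
  set ξ : ℝ × ℝ → ℝ := fun p => ξ' p.1 p.2 with hξdef
  have hYξ : ∀ x t, Y (ξ (x, t), t) = x := hξ'
  have hξY : ∀ η t, ξ (Y (η, t), t) = η := fun η t => (hmono t).injective (hYξ _ t)
  have hξc : Continuous ξ := by
    rw [continuous_iff_continuousAt]
    rintro ⟨x, t⟩
    set η := ξ (x, t) with hη
    have h1 : Tendsto (fun p : ℝ × ℝ => |p.1 - Y (η, p.2)| * Real.exp (K * |p.2|))
        (𝓝 (x, t)) (𝓝 0) := by
      have hc : Continuous fun p : ℝ × ℝ => |p.1 - Y (η, p.2)| * Real.exp (K * |p.2|) := by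
        fun_prop
      simpa [hη, hYξ] using hc.tendsto (x, t)
    have h2 : Tendsto (fun p : ℝ × ℝ => ξ p - η) (𝓝 (x, t)) (𝓝 0) := by
      refine squeeze_zero_norm (fun p => ?_) h1
      have := abs_sub_le_flow hA h0 hY (ξ p) η p.2
      rwa [hYξ p.1 p.2] at this
    simpa [ContinuousAt] using h2.add_const η
  -- The flow map is a homeomorphism of the plane whose derivative is invertible, since the
  -- derivative in the starting point is an exponential; so its inverse is as smooth as itself.
  let Φ : (ℝ × ℝ) ≃ₜ (ℝ × ℝ) :=
    { toFun := fun p => (Y p, p.2)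
      invFun := fun p => (ξ p, p.2)
      left_inv := fun p => Prod.ext (hξY p.1 p.2) rfl
      right_inv := fun p => Prod.ext (hYξ p.1 p.2) rfl
      continuous_toFun := hYc.prodMk continuous_snd
      continuous_invFun := hξc.prodMk continuous_snd }
  have hYd : Differentiable ℝ Y := hY2.differentiable (by norm_num)
  have hne : ∀ p, dx Y p ≠ 0 := by
    intro p
    rw [show p = (p.1, p.2) from rfl, dx_eq hYd (hasDerivAt_flow_fst hA h0 hY p.1 p.2)]
    exact (Real.exp_pos _).ne'
  let D : ℝ × ℝ → (ℝ × ℝ) ≃L[ℝ] (ℝ × ℝ) := fun p =>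
    ContinuousLinearEquiv.equivOfInverse
      ((fderiv ℝ Y p).prod (ContinuousLinearMap.snd ℝ ℝ ℝ))
      (((dx Y p)⁻¹ • (ContinuousLinearMap.fst ℝ ℝ ℝ - dt Y p • ContinuousLinearMap.snd ℝ ℝ ℝ)).prod
        (ContinuousLinearMap.snd ℝ ℝ ℝ))
      (fun v => by
        ext
        · simp only [ContinuousLinearMap.prod_apply, fderiv_apply_eq, smul_apply,
            sub_apply, ContinuousLinearMap.coe_fst', ContinuousLinearMap.coe_snd', smul_eq_mul]
          field_simp [hne p]
          ring
        · simp)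
      (fun v => by
        ext
        · simp only [ContinuousLinearMap.prod_apply, fderiv_apply_eq, smul_apply,
            sub_apply, ContinuousLinearMap.coe_fst', ContinuousLinearMap.coe_snd', smul_eq_mul]
          field_simp [hne p]
          ring
        · simp)
  have hΦ : ContDiff ℝ 2 Φ.symm := by
    refine Φ.contDiff_symm (f₀' := D) (fun p => ?_) (hY2.prodMk contDiff_snd)
    exact (hYd p).hasFDerivAt.prodMk hasFDerivAt_snd
  exact ⟨Y, ξ, hY2, hΦ.fst, h0, hY, hξY, hYξ, hmono⟩

end Construction

namespace IsFlow

variable {A Y ξ : ℝ × ℝ → ℝ}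

theorem foot_zero (h : IsFlow A Y ξ) (x : ℝ) : ξ (x, 0) = x := by
  conv_lhs => rw [← h.flow_zero x]
  exact h.foot_flow x 0

/-- The first integral solves the homogeneous transport equation. -/
theorem transport_foot (h : IsFlow A Y ξ) (x t : ℝ) : dt ξ (x, t) + A (x, t) * dx ξ (x, t) = 0 := by
  have h1 := hasDerivAt_along (h.contDiff_foot.differentiable (by norm_num))
    (h.ode (ξ (x, t)) t) (hasDerivAt_id t)
  have h2 : (fun r => ξ (Y (ξ (x, t), r), id r)) = fun _ => ξ (x, t) :=
    funext fun r => h.foot_flow _ r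
  rw [h2] at h1
  have h3 := h1.unique (hasDerivAt_const t (ξ (x, t)))
  simp only [id, h.flow_foot] at h3
  linarith

/-- In the coordinates `(ξ, t)` the transport operator is the derivative in time. -/
theorem transport_along (h : IsFlow A Y ξ) {H : ℝ × ℝ → ℝ} (hH : Differentiable ℝ H) (x t : ℝ) :
    dt (fun p => H (ξ p, p.2)) (x, t) + A (x, t) * dx (fun p => H (ξ p, p.2)) (x, t)
      = dt H (ξ (x, t), t) := by
  have hξ : Differentiable ℝ ξ := h.contDiff_foot.differentiable (by norm_num)
  have hd : Differentiable ℝ fun p : ℝ × ℝ => H (ξ p, p.2) :=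
    hH.comp (hξ.prodMk differentiable_snd)
  rw [dt_eq hd (hasDerivAt_along hH (hasDerivAt_snd hξ x t) (hasDerivAt_id t)),
    dx_eq hd (hasDerivAt_along hH (hasDerivAt_fst hξ x t) (hasDerivAt_const x t))]
  have := h.transport_foot x t
  linear_combination this * dx H (ξ (x, t), t)

end IsFlow

/-! ### Quantitative control of two derivatives -/

section C2Bound

variable {E F G : Type*} [NormedAddCommGroup E] [NormedSpace ℝ E]
  [NormedAddCommGroup F] [NormedSpace ℝ F] [NormedAddCommGroup G] [NormedSpace ℝ G]

/-- `h` is of class `C²`, and on `S` the function and its derivative are bounded by `B` and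
Lipschitz with constant `B`. The Lipschitz bound on the derivative stands in for a bound on the
second derivative. -/
structure IsC2Bound (S : Set E) (B : ℝ) (h : E → F) : Prop where
  contDiff : ContDiff ℝ 2 h
  norm_le : ∀ p ∈ S, ‖h p‖ ≤ B
  fderiv_le : ∀ p ∈ S, ‖fderiv ℝ h p‖ ≤ B
  lip : ∀ p ∈ S, ∀ q ∈ S, ‖h q - h p‖ ≤ B * ‖q - p‖
  fderiv_lip : ∀ p ∈ S, ∀ q ∈ S, ‖fderiv ℝ h q - fderiv ℝ h p‖ ≤ B * ‖q - p‖

namespace IsC2Bound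

variable {S : Set E} {B B' : ℝ} {h : E → F}

theorem differentiable (hh : IsC2Bound S B h) : Differentiable ℝ h :=
  hh.contDiff.differentiable (by norm_num)

/-- On a convex set the Lipschitz bound on the function follows from the one on the derivative. -/
theorem of_convex (hS : Convex ℝ S) (hc : ContDiff ℝ 2 h) (h0 : ∀ p ∈ S, ‖h p‖ ≤ B)
    (h1 : ∀ p ∈ S, ‖fderiv ℝ h p‖ ≤ B)
    (h2 : ∀ p ∈ S, ∀ q ∈ S, ‖fderiv ℝ h q - fderiv ℝ h p‖ ≤ B * ‖q - p‖) : IsC2Bound S B h :=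
  ⟨hc, h0, h1, fun _ hp _ hq => hS.norm_image_sub_le_of_norm_fderiv_le
    (fun x _ => hc.differentiable (by norm_num) x) h1 hp hq, h2⟩

theorem exists_of_contDiff (hS : Convex ℝ S) (hS' : IsCompact S) (hc : ContDiff ℝ 2 h) :
    ∃ B, 0 ≤ B ∧ IsC2Bound S B h := by
  have hc1 : ContDiff ℝ 1 (fderiv ℝ h) := hc.fderiv_right (by norm_num)
  obtain ⟨B₀, hB₀⟩ := hS'.exists_bound_of_continuousOn hc.continuous.continuousOn
  obtain ⟨B₁, hB₁⟩ := hS'.exists_bound_of_continuousOn hc1.continuous.continuousOn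
  obtain ⟨B₂, hB₂⟩ := hc1.contDiffOn.exists_lipschitzOnWith (by norm_num) hS hS'
  refine ⟨max 0 (max B₀ (max B₁ B₂)), le_max_left _ _, of_convex hS hc ?_ ?_ ?_⟩
  · intro p hp
    exact (hB₀ p hp).trans (by simp)
  · intro p hp
    exact (hB₁ p hp).trans (by simp)
  · intro p hp q hq
    have := hB₂.dist_le_mul q hq p hp
    rw [dist_eq_norm, dist_eq_norm] at this
    exact this.trans (by gcongr; simp)

theorem add {k : E → F} (hh : IsC2Bound S B h) (hk : IsC2Bound S B' k) :
    IsC2Bound S (B + B') (fun p => h p + k p) := by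
  have hd : ∀ p, fderiv ℝ (fun p => h p + k p) p = fderiv ℝ h p + fderiv ℝ k p := fun p =>
    fderiv_fun_add (hh.differentiable p) (hk.differentiable p)
  refine ⟨hh.contDiff.add hk.contDiff, ?_, ?_, ?_, ?_⟩
  · exact fun p hp => (norm_add_le _ _).trans (add_le_add (hh.norm_le p hp) (hk.norm_le p hp))
  · intro p hp
    rw [hd]
    exact (norm_add_le _ _).trans (add_le_add (hh.fderiv_le p hp) (hk.fderiv_le p hp))
  · intro p hp q hq
    rw [add_sub_add_comm, add_mul]
    exact (norm_add_le _ _).trans (add_le_add (hh.lip p hp q hq) (hk.lip p hp q hq))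
  · intro p hp q hq
    rw [hd, hd, add_sub_add_comm, add_mul]
    exact (norm_add_le _ _).trans (add_le_add (hh.fderiv_lip p hp q hq) (hk.fderiv_lip p hp q hq))

theorem neg (hh : IsC2Bound S B h) : IsC2Bound S B (fun p => - h p) := by
  have hd : ∀ p, fderiv ℝ (fun p => - h p) p = - fderiv ℝ h p := fun p => fderiv_fun_neg
  refine ⟨hh.contDiff.neg, ?_, ?_, ?_, ?_⟩
  · intro p hp; rw [norm_neg]; exact hh.norm_le p hp
  · intro p hp; rw [hd, norm_neg]; exact hh.fderiv_le p hp
  · intro p hp q hq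
    rw [neg_sub_neg, norm_sub_rev]; exact hh.lip p hp q hq
  · intro p hp q hq
    rw [hd, hd, neg_sub_neg, norm_sub_rev]; exact hh.fderiv_lip p hp q hq

theorem mul {h k : E → ℝ} (hB : 0 ≤ B) (hB' : 0 ≤ B') (hh : IsC2Bound S B h)
    (hk : IsC2Bound S B' k) : IsC2Bound S (4 * (B * B')) (fun p => h p * k p) := by
  have hd : ∀ p, fderiv ℝ (fun p => h p * k p) p = h p • fderiv ℝ k p + k p • fderiv ℝ h p :=
    fun p => fderiv_fun_mul (hh.differentiable p) (hk.differentiable p)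
  have hBB : 0 ≤ B * B' := mul_nonneg hB hB'
  refine ⟨hh.contDiff.mul hk.contDiff, ?_, ?_, ?_, ?_⟩
  · intro p hp
    rw [norm_mul]
    have := mul_le_mul (hh.norm_le p hp) (hk.norm_le p hp) (norm_nonneg _) hB
    linarith
  · intro p hp
    rw [hd]
    refine (norm_add_le _ _).trans ?_
    rw [norm_smul, norm_smul]
    have h1 := mul_le_mul (hh.norm_le p hp) (hk.fderiv_le p hp) (norm_nonneg _) hB
    have h2 := mul_le_mul (hk.norm_le p hp) (hh.fderiv_le p hp) (norm_nonneg _) hB'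
    linarith
  · intro p hp q hq
    have h1 := mul_le_mul (hh.norm_le q hq) (hk.lip p hp q hq) (norm_nonneg _) hB
    have h2 := mul_le_mul (hk.norm_le p hp) (hh.lip p hp q hq) (norm_nonneg _) hB'
    have h3 : h q * k q - h p * k p = h q * (k q - k p) + k p * (h q - h p) := by ring
    rw [h3]
    refine (norm_add_le _ _).trans ?_
    rw [norm_mul, norm_mul]
    have : 0 ≤ B * B' * ‖q - p‖ := by positivity
    linarith
  · intro p hp q hq
    have h1 := mul_le_mul (hh.norm_le q hq) (hk.fderiv_lip p hp q hq) (norm_nonneg _) hB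
    have h2 := mul_le_mul (hk.norm_le q hq) (hh.fderiv_lip p hp q hq) (norm_nonneg _) hB'
    have h3 := mul_le_mul (hh.lip p hp q hq) (hk.fderiv_le p hp) (norm_nonneg _) (by positivity)
    have h4 := mul_le_mul (hk.lip p hp q hq) (hh.fderiv_le p hp) (norm_nonneg _) (by positivity)
    have h5 : h q • fderiv ℝ k q + k q • fderiv ℝ h q - (h p • fderiv ℝ k p + k p • fderiv ℝ h p)
        = (h q • (fderiv ℝ k q - fderiv ℝ k p) + k q • (fderiv ℝ h q - fderiv ℝ h p))
          + ((h q - h p) • fderiv ℝ k p + (k q - k p) • fderiv ℝ h p) := by module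
    rw [hd, hd, h5]
    refine (norm_add_le _ _).trans ((add_le_add (norm_add_le _ _) (norm_add_le _ _)).trans ?_)
    simp only [norm_smul]
    linarith

theorem comp {S' : Set F} {k : F → G} (hB : 0 ≤ B) (hB' : 0 ≤ B') (hk : IsC2Bound S' B' k)
    (hh : IsC2Bound S B h) (hm : MapsTo h S S') :
    IsC2Bound S (B' * (1 + B) ^ 2) (fun p => k (h p)) := by
  have hd : ∀ p, fderiv ℝ (fun p => k (h p)) p = (fderiv ℝ k (h p)).comp (fderiv ℝ h p) :=
    fun p => fderiv_comp p (hk.differentiable _) (hh.differentiable p)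
  have hBB : 0 ≤ B * B' := mul_nonneg hB hB'
  have hB1 : B' * (1 + B) ^ 2 = B' + 2 * (B * B') + B' * B ^ 2 := by ring
  have hB2 : 0 ≤ B' * B ^ 2 := by positivity
  refine ⟨hk.contDiff.comp hh.contDiff, ?_, ?_, ?_, ?_⟩
  · intro p hp
    exact (hk.norm_le _ (hm hp)).trans (by rw [hB1]; linarith)
  · intro p hp
    rw [hd]
    refine (ContinuousLinearMap.opNorm_comp_le _ _).trans ?_
    refine (mul_le_mul (hk.fderiv_le _ (hm hp)) (hh.fderiv_le p hp) (norm_nonneg _) hB').trans ?_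
    rw [hB1]; linarith
  · intro p hp q hq
    refine (hk.lip _ (hm hp) _ (hm hq)).trans ?_
    refine (mul_le_mul_of_nonneg_left (hh.lip p hp q hq) hB').trans ?_
    rw [← mul_assoc]
    gcongr
    nlinarith
  · intro p hp q hq
    have h1 : (fderiv ℝ k (h q)).comp (fderiv ℝ h q) - (fderiv ℝ k (h p)).comp (fderiv ℝ h p)
        = (fderiv ℝ k (h q)).comp (fderiv ℝ h q - fderiv ℝ h p)
          + (fderiv ℝ k (h q) - fderiv ℝ k (h p)).comp (fderiv ℝ h p) := by
      ext v; simp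
    rw [hd, hd, h1]
    refine (norm_add_le _ _).trans ((add_le_add (ContinuousLinearMap.opNorm_comp_le _ _)
      (ContinuousLinearMap.opNorm_comp_le _ _)).trans ?_)
    have h2 := mul_le_mul (hk.fderiv_le _ (hm hq)) (hh.fderiv_lip p hp q hq) (norm_nonneg _) hB'
    have h3 : ‖fderiv ℝ k (h q) - fderiv ℝ k (h p)‖ ≤ B' * (B * ‖q - p‖) :=
      (hk.fderiv_lip _ (hm hp) _ (hm hq)).trans
        (mul_le_mul_of_nonneg_left (hh.lip p hp q hq) hB')
    have h4 := mul_le_mul h3 (hh.fderiv_le p hp) (norm_nonneg _) (by positivity)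
    have h5 : (B' * (1 + B) ^ 2) * ‖q - p‖ = B' * ‖q - p‖ + 2 * (B * B' * ‖q - p‖)
      + B' * B ^ 2 * ‖q - p‖ := by rw [hB1]; ring
    have h6 : 0 ≤ B * B' * ‖q - p‖ := by positivity
    have h7 : 0 ≤ B' * ‖q - p‖ := by positivity
    rw [h5]
    linarith

/-- The first order Taylor formula. -/
theorem taylor (hS : Convex ℝ S) (hB : 0 ≤ B) (hh : IsC2Bound S B h) {p q : E} (hp : p ∈ S)
    (hq : q ∈ S) : ‖h q - h p - fderiv ℝ h p (q - p)‖ ≤ B * ‖q - p‖ ^ 2 := by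
  have hseg : segment ℝ p q ⊆ S := hS.segment_subset hp hq
  have key := Convex.norm_image_sub_le_of_norm_hasFDerivWithin_le' (f := h) (f' := fderiv ℝ h)
    (φ := fderiv ℝ h p) (C := B * ‖q - p‖) (s := segment ℝ p q)
    (fun x _ => (hh.differentiable x).hasFDerivAt.hasFDerivWithinAt) (fun x hx => by
      refine (hh.fderiv_lip p hp x (hseg hx)).trans ?_
      gcongr
      obtain ⟨θ, hθ, rfl⟩ := segment_eq_image' ℝ p q ▸ hx
      rw [add_sub_cancel_left, norm_smul, Real.norm_of_nonneg hθ.1]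
      exact mul_le_of_le_one_left (norm_nonneg _) hθ.2)
    (convex_segment p q) (left_mem_segment ℝ p q) (right_mem_segment ℝ p q)
  calc _ ≤ _ := key
    _ = _ := by ring

end IsC2Bound

/-- On the line it suffices to bound the first two ordinary derivatives. -/
theorem isC2Bound_of_deriv {lo hi B : ℝ} {h h' h'' : ℝ → ℝ} (h1 : ∀ x, HasDerivAt h (h' x) x)
    (h2 : ∀ x, HasDerivAt h' (h'' x) x) (hc : Continuous h'') (b0 : ∀ x ∈ Icc lo hi, |h x| ≤ B)
    (b1 : ∀ x ∈ Icc lo hi, |h' x| ≤ B) (b2 : ∀ x ∈ Icc lo hi, |h'' x| ≤ B) :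
    IsC2Bound (Icc lo hi) B h := by
  have hd : deriv h = h' := funext fun x => (h1 x).deriv
  have hd' : deriv h' = h'' := funext fun x => (h2 x).deriv
  have hc1 : ContDiff ℝ 1 h' :=
    contDiff_one_iff_deriv.2 ⟨fun x => (h2 x).differentiableAt, by rwa [hd']⟩
  have hc2 : ContDiff ℝ 2 h := by
    have : ContDiff ℝ (1 + 1) h := contDiff_succ_iff_deriv.2
      ⟨fun x => (h1 x).differentiableAt, by simp, by rwa [hd]⟩
    simpa [one_add_one_eq_two] using this
  refine IsC2Bound.of_convex (convex_Icc _ _) hc2 b0 ?_ ?_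
  · intro x hx
    rw [← norm_deriv_eq_norm_fderiv, hd]
    exact b1 x hx
  · intro x hx y hy
    have h3 : fderiv ℝ h y - fderiv ℝ h x
        = ContinuousLinearMap.toSpanSingleton ℝ (h' y - h' x) := by
      rw [(h1 y).hasFDerivAt.fderiv, (h1 x).hasFDerivAt.fderiv]
      ext; simp
    rw [h3, ContinuousLinearMap.norm_toSpanSingleton]
    exact (convex_Icc lo hi).norm_image_sub_le_of_norm_hasDerivWithin_le
      (fun z _ => (h2 z).hasDerivWithinAt) b2 hx hy

theorem norm_clm_le (l : ℝ × ℝ →L[ℝ] ℝ) : ‖l‖ ≤ |l (1, 0)| + |l (0, 1)| := by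
  refine ContinuousLinearMap.opNorm_le_bound _ (by positivity) fun v => ?_
  have h1 : l v = v.1 * l (1, 0) + v.2 * l (0, 1) := by
    have : v = v.1 • ((1, 0) : ℝ × ℝ) + v.2 • ((0, 1) : ℝ × ℝ) := by ext <;> simp
    conv_lhs => rw [this]
    rw [map_add, map_smul, map_smul]; rfl
  rw [h1, Real.norm_eq_abs]
  refine (abs_add_le _ _).trans ?_
  rw [abs_mul, abs_mul, add_mul]
  have h2 : |v.1| ≤ ‖v‖ := norm_fst_le v
  have h3 : |v.2| ≤ ‖v‖ := norm_snd_le v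
  nlinarith [abs_nonneg (l (1, 0)), abs_nonneg (l (0, 1))]

theorem abs_dx_sub_le {h k : ℝ × ℝ → ℝ} (p q : ℝ × ℝ) :
    |dx h q - dx k p| ≤ ‖fderiv ℝ h q - fderiv ℝ k p‖ := by
  have := (fderiv ℝ h q - fderiv ℝ k p).le_opNorm (1, 0)
  simpa [dx, Prod.norm_def] using this

theorem abs_dx_le {h : ℝ × ℝ → ℝ} (p : ℝ × ℝ) : |dx h p| ≤ ‖fderiv ℝ h p‖ := by
  have := (fderiv ℝ h p).le_opNorm (1, 0)
  simpa [dx, Prod.norm_def] using this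

/-- The primitive in time of a function with two bounded derivatives. Its partial derivatives are
the primitive of `dx k`, and `k` itself. -/
theorem IsC2Bound.timePrimitive {k : ℝ × ℝ → ℝ} {lo hi T B : ℝ} (hT : 0 ≤ T) (hB : 0 ≤ B)
    (hk : IsC2Bound (Icc lo hi ×ˢ Icc 0 T) B k) :
    IsC2Bound (Icc lo hi ×ˢ Icc 0 T) (B * (T + 2)) (timePrimitive k) := by
  have hk1 : ContDiff ℝ 1 k := hk.contDiff.of_le (by norm_num)
  have hkx : ContDiff ℝ 1 (dx k) := ContDiff.dx hk.contDiff (by norm_num)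
  have hP : ContDiff ℝ 2 (FlowAway.timePrimitive k) := contDiff_two_timePrimitive hk.contDiff
  have hPd : Differentiable ℝ (FlowAway.timePrimitive k) := hP.differentiable (by norm_num)
  have ex : ∀ p, dx (FlowAway.timePrimitive k) p = FlowAway.timePrimitive (dx k) p := fun p =>
    dx_eq hPd (hasDerivAt_timePrimitive_fst hk1 p.1 p.2)
  have et : ∀ p, dt (FlowAway.timePrimitive k) p = k p := fun p =>
    dt_eq hPd (hasDerivAt_timePrimitive_snd hk1.continuous p.1 p.2)
  have hconv : Convex ℝ (Icc lo hi ×ˢ Icc 0 T) := (convex_Icc lo hi).prod (convex_Icc 0 T)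
  have hint : ∀ {f : ℝ → ℝ} {C s t : ℝ}, s ∈ Icc 0 T → t ∈ Icc 0 T →
      (∀ r ∈ Icc 0 T, |f r| ≤ C) → |∫ r in s..t, f r| ≤ C * |t - s| := by
    intro f C s t hs ht hf
    refine intervalIntegral.norm_integral_le_of_norm_le_const (f := f) (C := C) fun r hr => hf r ?_
    have := uIoc_subset_uIcc hr
    exact (convex_Icc (0 : ℝ) T).ordConnected.uIcc_subset hs ht this
  have h0 : (0 : ℝ) ∈ Icc 0 T := ⟨le_rfl, hT⟩
  have hle : ∀ p ∈ Icc lo hi ×ˢ Icc 0 T, ∀ f : ℝ → ℝ, (∀ r ∈ Icc 0 T, |f r| ≤ B) →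
      |∫ r in (0 : ℝ)..p.2, f r| ≤ B * T := by
    intro p hp f hf
    refine (hint h0 hp.2 hf).trans ?_
    gcongr
    rw [sub_zero, abs_of_nonneg hp.2.1]; exact hp.2.2
  have hdxB : ∀ p ∈ Icc lo hi ×ˢ Icc 0 T, |dx k p| ≤ B := fun p hp =>
    (abs_dx_le p).trans (hk.fderiv_le p hp)
  refine IsC2Bound.of_convex hconv hP ?_ ?_ ?_
  · intro p hp
    have := hle p hp (fun r => k (p.1, r)) (fun r hr => hk.norm_le _ ⟨hp.1, hr⟩)
    refine this.trans ?_
    nlinarith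
  · intro p hp
    refine (norm_clm_le _).trans ?_
    change |dx _ p| + |dt _ p| ≤ _
    rw [ex, et]
    have h1 := hle p hp (fun r => dx k (p.1, r)) (fun r hr => hdxB _ ⟨hp.1, hr⟩)
    have h2 := hk.norm_le p hp
    rw [Real.norm_eq_abs] at h2
    have h3 : |FlowAway.timePrimitive (dx k) p| ≤ B * T := h1
    linarith
  · intro p hp q hq
    refine (norm_clm_le _).trans ?_
    have e1 : (fderiv ℝ (FlowAway.timePrimitive k) q - fderiv ℝ (FlowAway.timePrimitive k) p) (1, 0)
        = dx (FlowAway.timePrimitive k) q - dx (FlowAway.timePrimitive k) p := rfl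
    have e2 : (fderiv ℝ (FlowAway.timePrimitive k) q - fderiv ℝ (FlowAway.timePrimitive k) p) (0, 1)
        = dt (FlowAway.timePrimitive k) q - dt (FlowAway.timePrimitive k) p := rfl
    rw [e1, e2, ex, ex, et, et]
    have n1 : |q.1 - p.1| ≤ ‖q - p‖ := norm_fst_le (q - p)
    have n2 : |q.2 - p.2| ≤ ‖q - p‖ := norm_snd_le (q - p)
    have hc : ∀ x, Continuous fun r => dx k (x, r) := fun x => by
      have := hkx.continuous; fun_prop
    have h1 : FlowAway.timePrimitive (dx k) q - FlowAway.timePrimitive (dx k) p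
        = (∫ r in p.2..q.2, dx k (q.1, r))
          + ∫ r in (0 : ℝ)..p.2, (dx k (q.1, r) - dx k (p.1, r)) := by
      rw [intervalIntegral.integral_sub ((hc _).intervalIntegrable _ _)
        ((hc _).intervalIntegrable _ _), ← intervalIntegral.integral_interval_sub_left
          ((hc q.1).intervalIntegrable 0 q.2) ((hc q.1).intervalIntegrable 0 p.2)]
      simp only [FlowAway.timePrimitive]
      ring
    have h2 : |∫ r in p.2..q.2, dx k (q.1, r)| ≤ B * ‖q - p‖ :=
      (hint hp.2 hq.2 fun r hr => hdxB (q.1, r) ⟨hq.1, hr⟩).trans (by gcongr)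
    have h3 : |∫ r in (0 : ℝ)..p.2, (dx k (q.1, r) - dx k (p.1, r))| ≤ B * ‖q - p‖ * T := by
      refine (hint (C := B * ‖q - p‖) h0 hp.2 fun r hr => ?_).trans ?_
      · refine (abs_dx_sub_le _ _).trans ((hk.fderiv_lip (p.1, r) ⟨hp.1, hr⟩ (q.1, r)
          ⟨hq.1, hr⟩).trans ?_)
        gcongr
        rw [Prod.mk_sub_mk, sub_self, Prod.norm_mk, norm_zero, max_eq_left (norm_nonneg _)]
        exact n1
      · gcongr
        rw [sub_zero, abs_of_nonneg hp.2.1]; exact hp.2.2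
    have h4 : |k q - k p| ≤ B * ‖q - p‖ := hk.lip p hp q hq
    rw [h1]
    have h5 := abs_add_le (∫ r in p.2..q.2, dx k (q.1, r))
      (∫ r in (0 : ℝ)..p.2, (dx k (q.1, r) - dx k (p.1, r)))
    nlinarith

end C2Bound

/-! ### The layer components -/

/-- A source profile on the whole line: of class `C¹`, vanishing on the left half-line, with
derivative bounded by `C`. -/
structure IsProfile (C : ℝ) (f : ℝ → ℝ) : Prop where
  contDiff : ContDiff ℝ 1 f
  zero : ∀ x ≤ 0, f x = 0
  deriv_le : ∀ x, |deriv f x| ≤ C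

/-- The primitive of `f k` which vanishes at the origin. -/
noncomputable def weightedPrimitive (f k : ℝ → ℝ) (x : ℝ) : ℝ := ∫ y in (0 : ℝ)..x, f y * k y

namespace IsProfile

variable {C : ℝ} {f k : ℝ → ℝ}

theorem const_nonneg (hf : IsProfile C f) : 0 ≤ C := (abs_nonneg _).trans (hf.deriv_le 0)

theorem abs_le (hf : IsProfile C f) (x : ℝ) : |f x| ≤ C * |x| := by
  have := convex_univ.norm_image_sub_le_of_norm_deriv_le (f := f) (C := C)
    (fun y _ => hf.contDiff.differentiable (by norm_num) y) (fun y _ => hf.deriv_le y)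
    (mem_univ 0) (mem_univ x)
  simpa [hf.zero 0 le_rfl] using this

theorem hasDerivAt_weightedPrimitive (hf : IsProfile C f) (hk : Continuous k) (x : ℝ) :
    HasDerivAt (weightedPrimitive f k) (f x * k x) x := by
  have hc : Continuous fun y => f y * k y := hf.contDiff.continuous.mul hk
  exact intervalIntegral.integral_hasDerivAt_right (hc.intervalIntegrable _ _)
    (hc.stronglyMeasurableAtFilter _ _) hc.continuousAt

theorem weightedPrimitive_eq_zero (hf : IsProfile C f) {x : ℝ} (hx : x ≤ 0) :
    weightedPrimitive f k x = 0 := by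
  rw [weightedPrimitive, intervalIntegral.integral_congr (g := fun _ => (0 : ℝ))]
  · simp
  · intro y hy
    rw [uIcc_of_ge hx] at hy
    simp [hf.zero y hy.2]

theorem contDiff_weightedPrimitive (hf : IsProfile C f) (hk : ContDiff ℝ 1 k) :
    ContDiff ℝ 2 (weightedPrimitive f k) := by
  have hd : deriv (weightedPrimitive f k) = fun x => f x * k x :=
    funext fun x => (hf.hasDerivAt_weightedPrimitive hk.continuous x).deriv
  have : ContDiff ℝ (1 + 1) (weightedPrimitive f k) := contDiff_succ_iff_deriv.2
    ⟨fun x => (hf.hasDerivAt_weightedPrimitive hk.continuous x).differentiableAt, by simp, by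
      rw [hd]; exact hf.contDiff.mul hk⟩
  simpa [one_add_one_eq_two] using this

end IsProfile

/-- Two derivatives of the primitive of a profile are bounded in terms of the bound on the profile
only. -/
theorem exists_isC2Bound_weightedPrimitive {k : ℝ → ℝ} (hk : ContDiff ℝ 1 k) {ρ : ℝ} (hρ : 0 ≤ ρ)
    {C : ℝ} (hC : 0 ≤ C) :
    ∃ B, 0 ≤ B ∧ ∀ f, IsProfile C f → IsC2Bound (Icc (-ρ) ρ) B (weightedPrimitive f k) := by
  have hk' : Continuous (deriv k) := hk.continuous_deriv (by norm_num)
  obtain ⟨D₁, hD₁⟩ := (isCompact_Icc (a := -ρ) (b := ρ)).exists_bound_of_continuousOn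
    hk.continuous.continuousOn
  obtain ⟨D₂, hD₂⟩ := (isCompact_Icc (a := -ρ) (b := ρ)).exists_bound_of_continuousOn
    hk'.continuousOn
  set D := max 0 (max D₁ D₂)
  have hD : 0 ≤ D := le_max_left _ _
  have k1 : ∀ x ∈ Icc (-ρ) ρ, |k x| ≤ D := fun x hx => (hD₁ x hx).trans (by simp [D])
  have k2 : ∀ x ∈ Icc (-ρ) ρ, |deriv k x| ≤ D := fun x hx => (hD₂ x hx).trans (by simp [D])
  refine ⟨C * D * (1 + ρ) ^ 2, by positivity, fun f hf => ?_⟩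
  have hCD : 0 ≤ C * D := by positivity
  have hx' : ∀ x ∈ Icc (-ρ) ρ, |x| ≤ ρ := fun x hx => abs_le.2 ⟨hx.1, hx.2⟩
  have f1 : ∀ x ∈ Icc (-ρ) ρ, |f x| ≤ C * ρ := fun x hx =>
    (hf.abs_le x).trans (by gcongr; exact hx' x hx)
  have fk : ∀ x ∈ Icc (-ρ) ρ, |f x * k x| ≤ C * ρ * D := by
    intro x hx
    rw [abs_mul]
    exact mul_le_mul (f1 x hx) (k1 x hx) (abs_nonneg _) (by positivity)
  have e1 : C * D * (1 + ρ) ^ 2 = C * D + 2 * (C * ρ * D) + C * ρ * D * ρ := by ring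
  have p1 : 0 ≤ C * ρ * D := by positivity
  have p2 : 0 ≤ C * ρ * D * ρ := by positivity
  refine isC2Bound_of_deriv (h' := fun x => f x * k x)
    (h'' := fun x => deriv f x * k x + f x * deriv k x)
    (hf.hasDerivAt_weightedPrimitive hk.continuous) ?_ ?_ ?_ ?_ ?_
  · intro x
    exact (hf.contDiff.differentiable (by norm_num) x).hasDerivAt.mul
      (hk.differentiable (by norm_num) x).hasDerivAt
  · exact ((hf.contDiff.continuous_deriv (by norm_num)).mul hk.continuous).add
      (hf.contDiff.continuous.mul hk')
  · intro x hx
    have : |weightedPrimitive f k x| ≤ C * ρ * D * |x - 0| := by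
      refine intervalIntegral.norm_integral_le_of_norm_le_const (f := fun y => f y * k y)
        (C := C * ρ * D) fun y hy => fk y ?_
      have := uIoc_subset_uIcc hy
      exact (convex_Icc (-ρ) ρ).ordConnected.uIcc_subset ⟨by linarith, hρ⟩ hx this
    rw [sub_zero] at this
    have h2 := mul_le_mul_of_nonneg_left (hx' x hx) p1
    linarith
  · intro x hx
    have := fk x hx
    linarith
  · intro x hx
    refine (abs_add_le _ _).trans ?_
    rw [abs_mul, abs_mul]
    have h1 := mul_le_mul (hf.deriv_le x) (k1 x hx) (abs_nonneg _) hC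
    have h2 := mul_le_mul (f1 x hx) (k2 x hx) (abs_nonneg _) (by positivity)
    linarith

section Layers

variable {α K : ℝ} {A Y ξ : ℝ × ℝ → ℝ}

/-- The reciprocal speed at time zero, as a weight for primitives. -/
noncomputable def initialWeight (A : ℝ × ℝ → ℝ) (y : ℝ) : ℝ := 1 / A (y, 0)

/-- `(A_t + A A_x) / A²`: the factor of the source which remains after subtracting `F(x) / A`
from the solution of `w_t + A w_x = F'(x)`. -/
noncomputable def sourceWeight (A : ℝ × ℝ → ℝ) (p : ℝ × ℝ) : ℝ :=
  (dt A p + A p * dx A p) / A p ^ 2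

/-- The primitive `F` of the source profile. -/
noncomputable def sourcePrimitive (f : ℝ → ℝ) : ℝ → ℝ := weightedPrimitive f fun _ => 1

/-- The initial value of the boundary layer component. -/
noncomputable def initialPrimitive (A : ℝ × ℝ → ℝ) (f : ℝ → ℝ) : ℝ → ℝ :=
  weightedPrimitive f (initialWeight A)

/-- The part of the boundary layer component which is obtained by integration along
characteristics, as a function of the starting point and of time. The summands without an integral
are constant along characteristics and correct the initial value. -/
noncomputable def lagrangianPart (A Y : ℝ × ℝ → ℝ) (f : ℝ → ℝ) (p : ℝ × ℝ) : ℝ :=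
  timePrimitive (fun q => sourcePrimitive f (Y q) * sourceWeight A (Y q, q.2)) p
    + (initialPrimitive A f p.1 + -(sourcePrimitive f p.1 * initialWeight A p.1))

/-- The boundary layer component `w`, the solution with source `f`. Splitting off `F(x) / A` leaves
a transport equation whose source involves `f` only through its primitive `F`; so `w` has one
derivative more than integration of `f` along characteristics would show. -/
noncomputable def boundaryLayer (A Y ξ : ℝ × ℝ → ℝ) (f : ℝ → ℝ) (p : ℝ × ℝ) : ℝ :=
  sourcePrimitive f p.1 * (1 / A p) + lagrangianPart A Y f (ξ p, p.2)

/-- The interior layer component `z`: minus the initial value of the boundary layer component,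
carried along by the characteristics. -/
noncomputable def interiorLayer (A ξ : ℝ × ℝ → ℝ) (f : ℝ → ℝ) (p : ℝ × ℝ) : ℝ :=
  -initialPrimitive A f (ξ p)

/-- The interior layer component in the coordinate `s = x - Y(0, t)` aligned with the
characteristic through the origin. -/
noncomputable def alignedLayer (A Y ξ : ℝ × ℝ → ℝ) (f : ℝ → ℝ) (p : ℝ × ℝ) : ℝ :=
  -initialPrimitive A f (ξ (p.1 + Y (0, p.2), p.2))

theorem IsGlobalSpeed.ne_zero (hA : IsGlobalSpeed α K A) (p : ℝ × ℝ) : A p ≠ 0 :=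
  (hA.pos.trans_le (hA.lower p)).ne'

theorem contDiff_initialWeight (hA : IsGlobalSpeed α K A) : ContDiff ℝ 3 (initialWeight A) :=
  contDiff_const.div (hA.contDiff.comp (contDiff_id.prodMk contDiff_const)) fun _ => hA.ne_zero _

theorem contDiff_sourceWeight (hA : IsGlobalSpeed α K A) : ContDiff ℝ 2 (sourceWeight A) := by
  have h : ContDiff ℝ 2 A := hA.contDiff.of_le (by norm_num)
  exact ((ContDiff.dt hA.contDiff (by norm_num)).add
    (h.mul (ContDiff.dx hA.contDiff (by norm_num)))).div (h.pow 2)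
      fun p => pow_ne_zero 2 (hA.ne_zero p)

variable {C : ℝ} {f : ℝ → ℝ}

theorem contDiff_sourcePrimitive (hf : IsProfile C f) : ContDiff ℝ 2 (sourcePrimitive f) :=
  hf.contDiff_weightedPrimitive contDiff_const

theorem contDiff_initialPrimitive (hA : IsGlobalSpeed α K A) (hf : IsProfile C f) :
    ContDiff ℝ 2 (initialPrimitive A f) :=
  hf.contDiff_weightedPrimitive ((contDiff_initialWeight hA).of_le (by norm_num))

theorem contDiff_source_along (hA : IsGlobalSpeed α K A) (hY : IsFlow A Y ξ)
    (hf : IsProfile C f) :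
    ContDiff ℝ 2 fun q : ℝ × ℝ => sourcePrimitive f (Y q) * sourceWeight A (Y q, q.2) :=
  ((contDiff_sourcePrimitive hf).comp hY.contDiff_flow).mul
    ((contDiff_sourceWeight hA).comp (hY.contDiff_flow.prodMk contDiff_snd))

theorem contDiff_lagrangianPart (hA : IsGlobalSpeed α K A) (hY : IsFlow A Y ξ)
    (hf : IsProfile C f) : ContDiff ℝ 2 (lagrangianPart A Y f) := by
  have hw : ContDiff ℝ 2 (initialWeight A) := (contDiff_initialWeight hA).of_le (by norm_num)
  exact (contDiff_two_timePrimitive (contDiff_source_along hA hY hf)).add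
    (((contDiff_initialPrimitive hA hf).comp contDiff_fst).add
      (((contDiff_sourcePrimitive hf).comp contDiff_fst).mul (hw.comp contDiff_fst)).neg)

theorem contDiff_boundaryLayer (hA : IsGlobalSpeed α K A) (hY : IsFlow A Y ξ)
    (hf : IsProfile C f) : ContDiff ℝ 2 (boundaryLayer A Y ξ f) :=
  (((contDiff_sourcePrimitive hf).comp contDiff_fst).mul
    (contDiff_const.div (hA.contDiff.of_le (by norm_num)) hA.ne_zero)).add
      ((contDiff_lagrangianPart hA hY hf).comp (hY.contDiff_foot.prodMk contDiff_snd))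

theorem contDiff_interiorLayer (hA : IsGlobalSpeed α K A) (hY : IsFlow A Y ξ)
    (hf : IsProfile C f) : ContDiff ℝ 2 (interiorLayer A ξ f) :=
  ((contDiff_initialPrimitive hA hf).comp hY.contDiff_foot).neg

/-! #### Transport equations and boundary values -/

theorem transport_boundaryLayer (hA : IsGlobalSpeed α K A) (hY : IsFlow A Y ξ)
    (hf : IsProfile C f) (x t : ℝ) :
    dt (boundaryLayer A Y ξ f) (x, t) + A (x, t) * dx (boundaryLayer A Y ξ f) (x, t) = f x := by
  have hAd : Differentiable ℝ A := hA.contDiff.differentiable (by norm_num)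
  have hH := (contDiff_lagrangianPart hA hY hf).differentiable (by norm_num)
  have hξ : Differentiable ℝ ξ := hY.contDiff_foot.differentiable (by norm_num)
  have hHd : Differentiable ℝ fun p : ℝ × ℝ => lagrangianPart A Y f (ξ p, p.2) :=
    hH.comp (hξ.prodMk differentiable_snd)
  have hWd := (contDiff_boundaryLayer hA hY hf).differentiable (by norm_num)
  have hne := hA.ne_zero (x, t)
  have h1 := hf.hasDerivAt_weightedPrimitive (k := fun _ => 1) continuous_const x
  have ex : dx (boundaryLayer A Y ξ f) (x, t) = _ := dx_eq hWd
    ((h1.mul ((hasDerivAt_const x (1 : ℝ)).div (hasDerivAt_fst hAd x t) hne)).add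
      (hasDerivAt_fst hHd x t))
  have et : dt (boundaryLayer A Y ξ f) (x, t) = _ := dt_eq hWd
    ((((hasDerivAt_const t (1 : ℝ)).div (hasDerivAt_snd hAd x t) hne).const_mul
      (sourcePrimitive f x)).add (hasDerivAt_snd hHd x t))
  have h2 := hY.transport_along hH x t
  have h3 : dt (lagrangianPart A Y f) (ξ (x, t), t)
      = sourcePrimitive f x * sourceWeight A (x, t) := by
    refine dt_eq hH ?_
    have h4 := (hasDerivAt_timePrimitive_snd (contDiff_source_along hA hY hf).continuous
      (ξ (x, t)) t).add_const (initialPrimitive A f (ξ (x, t))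
        + -(sourcePrimitive f (ξ (x, t)) * initialWeight A (ξ (x, t))))
    simp only [hY.flow_foot] at h4
    exact h4
  rw [h3, sourceWeight] at h2
  have h5 : weightedPrimitive f (fun _ => 1) x = sourcePrimitive f x := rfl
  have h6 : ((fun _ : ℝ => (1 : ℝ)) / fun y => A (y, t)) x = 1 / A (x, t) := rfl
  rw [ex, et, h5, h6]
  linear_combination h2 + (by
    field_simp
    ring : A (x, t) * ((f x * 1) * (1 / A (x, t)) + sourcePrimitive f x
        * ((0 * A (x, t) - 1 * dx A (x, t)) / A (x, t) ^ 2))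
      + sourcePrimitive f x * ((0 * A (x, t) - 1 * dt A (x, t)) / A (x, t) ^ 2)
      + sourcePrimitive f x * ((dt A (x, t) + A (x, t) * dx A (x, t)) / A (x, t) ^ 2) = f x)

theorem boundaryLayer_initial (hY : IsFlow A Y ξ) (x : ℝ) :
    boundaryLayer A Y ξ f (x, 0) = initialPrimitive A f x := by
  simp only [boundaryLayer, lagrangianPart, timePrimitive, hY.foot_zero, initialWeight,
    intervalIntegral.integral_same]
  ring

theorem flow_monotone (hA : IsGlobalSpeed α K A) (hY : IsFlow A Y ξ) (η : ℝ) :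
    Monotone fun t => Y (η, t) :=
  monotone_of_hasDerivAt_nonneg (hY.ode η) fun _ => (hA.pos.trans_le (hA.lower _)).le

theorem foot_nonpos_iff (hY : IsFlow A Y ξ) (x t : ℝ) : ξ (x, t) ≤ 0 ↔ x ≤ Y (0, t) := by
  rw [← (hY.flow_strictMono t).le_iff_le]
  simp only [hY.flow_foot]

theorem foot_left_nonpos (hA : IsGlobalSpeed α K A) (hY : IsFlow A Y ξ) {t : ℝ} (ht : 0 ≤ t) :
    ξ (0, t) ≤ 0 := by
  rw [foot_nonpos_iff hY]
  calc (0 : ℝ) = Y (0, 0) := (hY.flow_zero 0).symm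
    _ ≤ Y (0, t) := flow_monotone hA hY 0 ht

/-- The boundary layer component vanishes at the inflow boundary, because `f` and hence its
primitives vanish on the left half-line. -/
theorem boundaryLayer_left (hA : IsGlobalSpeed α K A) (hY : IsFlow A Y ξ) (hf : IsProfile C f)
    {t : ℝ} (ht : 0 ≤ t) : boundaryLayer A Y ξ f (0, t) = 0 := by
  have h0 := foot_left_nonpos hA hY ht
  have hF : ∀ {x : ℝ}, x ≤ 0 → sourcePrimitive f x = 0 := fun hx =>
    hf.weightedPrimitive_eq_zero hx
  have hO : initialPrimitive A f (ξ (0, t)) = 0 := hf.weightedPrimitive_eq_zero h0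
  -- Before it reaches the point `(0, t)`, the characteristic runs in the left half-plane.
  have hI : ∫ s in (0 : ℝ)..t, sourcePrimitive f (Y (ξ (0, t), s))
      * sourceWeight A (Y (ξ (0, t), s), s) = 0 := by
    rw [intervalIntegral.integral_congr (g := fun _ => (0 : ℝ))]
    · simp
    · intro s hs
      rw [uIcc_of_le ht] at hs
      have h1 : Y (ξ (0, t), s) ≤ Y (ξ (0, t), t) := flow_monotone hA hY _ hs.2
      rw [hY.flow_foot] at h1
      simp [hF h1]
  simp only [boundaryLayer, lagrangianPart, timePrimitive, hI, hF le_rfl, hF h0, hO]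
  ring

theorem transport_interiorLayer (hA : IsGlobalSpeed α K A) (hY : IsFlow A Y ξ)
    (hf : IsProfile C f) (x t : ℝ) :
    dt (interiorLayer A ξ f) (x, t) + A (x, t) * dx (interiorLayer A ξ f) (x, t) = 0 := by
  have hH : Differentiable ℝ fun p : ℝ × ℝ => -initialPrimitive A f p.1 :=
    (((contDiff_initialPrimitive hA hf).differentiable (by norm_num)).comp differentiable_fst).neg
  have h := hY.transport_along hH x t
  rw [dt_eq hH (hasDerivAt_const t (-initialPrimitive A f (ξ (x, t))))] at h
  exact h

theorem interiorLayer_eq_zero (hY : IsFlow A Y ξ) (hf : IsProfile C f) {x t : ℝ}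
    (hx : x ≤ Y (0, t)) : interiorLayer A ξ f (x, t) = 0 := by
  have : initialPrimitive A f (ξ (x, t)) = 0 :=
    hf.weightedPrimitive_eq_zero ((foot_nonpos_iff hY x t).2 hx)
  simp [interiorLayer, this]

theorem interiorLayer_initial (hY : IsFlow A Y ξ) (x : ℝ) :
    interiorLayer A ξ f (x, 0) = -initialPrimitive A f x := by
  simp only [interiorLayer, hY.foot_zero]

theorem alignedLayer_eq (x t : ℝ) :
    alignedLayer A Y ξ f (x - Y (0, t), t) = interiorLayer A ξ f (x, t) := by
  simp [alignedLayer, interiorLayer]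

theorem alignedLayer_left (hY : IsFlow A Y ξ) (hf : IsProfile C f) (t : ℝ) :
    alignedLayer A Y ξ f (0, t) = 0 := by
  have := alignedLayer_eq (A := A) (Y := Y) (ξ := ξ) (f := f) (Y (0, t)) t
  rw [sub_self] at this
  rw [this, interiorLayer_eq_zero hY hf le_rfl]

theorem alignedLayer_initial (hY : IsFlow A Y ξ) (s : ℝ) :
    alignedLayer A Y ξ f (s, 0) = -initialPrimitive A f s := by
  simp only [alignedLayer, hY.flow_zero, hY.foot_zero, add_zero]

/-- In aligned coordinates the interior layer is transported with the relative speed. -/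
theorem transport_alignedLayer (hA : IsGlobalSpeed α K A) (hY : IsFlow A Y ξ)
    (hf : IsProfile C f) (hd : Differentiable ℝ (alignedLayer A Y ξ f)) (s t : ℝ) :
    dt (alignedLayer A Y ξ f) (s, t)
      + (A (s + Y (0, t), t) - A (Y (0, t), t)) * dx (alignedLayer A Y ξ f) (s, t) = 0 := by
  have hZ := (contDiff_interiorLayer hA hY hf).differentiable (by norm_num)
  have e1 := dt_eq hd (hasDerivAt_along hZ ((hY.ode 0 t).const_add s) (hasDerivAt_id t))
  have e2 := dx_eq hd (hasDerivAt_along hZ ((hasDerivAt_id s).add_const (Y (0, t)))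
    (hasDerivAt_const s t))
  rw [e1, e2]
  have := transport_interiorLayer hA hY hf (s + Y (0, t)) t
  linear_combination this

/-! #### Bounds independent of the profile -/

/-- The profile enters the boundary layer component only through its primitives, which
`exists_isC2Bound_weightedPrimitive` controls; everything else is fixed and smooth. -/
theorem exists_isC2Bound_boundaryLayer (hA : IsGlobalSpeed α K A) (hY : IsFlow A Y ξ) {R T C : ℝ}
    (hR : 0 ≤ R) (hT : 0 ≤ T) (hC : 0 ≤ C) :
    ∃ B, 0 ≤ B ∧ ∀ f, IsProfile C f →
      IsC2Bound (Icc 0 R ×ˢ Icc 0 T) B (boundaryLayer A Y ξ f) := by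
  have cQ : IsCompact (Icc 0 R ×ˢ Icc 0 T) := isCompact_Icc.prod isCompact_Icc
  have vQ : Convex ℝ (Icc 0 R ×ˢ Icc 0 T) := (convex_Icc _ _).prod (convex_Icc _ _)
  obtain ⟨ρ₁, hρ₁⟩ := cQ.exists_bound_of_continuousOn hY.contDiff_foot.continuous.continuousOn
  have hρ₁0 : 0 ≤ ρ₁ := (norm_nonneg _).trans (hρ₁ (0, 0) ⟨⟨le_rfl, hR⟩, le_rfl, hT⟩)
  have cJ : IsCompact (Icc (-ρ₁) ρ₁ ×ˢ Icc 0 T) := isCompact_Icc.prod isCompact_Icc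
  have vJ : Convex ℝ (Icc (-ρ₁) ρ₁ ×ˢ Icc 0 T) := (convex_Icc _ _).prod (convex_Icc _ _)
  obtain ⟨ρ₂, hρ₂⟩ := cJ.exists_bound_of_continuousOn hY.contDiff_flow.continuous.continuousOn
  have hρ₂0 : 0 ≤ ρ₂ :=
    (norm_nonneg _).trans (hρ₂ (0, 0) ⟨⟨by simpa using hρ₁0, hρ₁0⟩, le_rfl, hT⟩)
  have hiw : ContDiff ℝ 2 (initialWeight A) := (contDiff_initialWeight hA).of_le (by norm_num)
  obtain ⟨b₁, p₁, h₁⟩ := IsC2Bound.exists_of_contDiff vQ cQ (contDiff_fst (𝕜 := ℝ) (n := 2))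
  obtain ⟨b₂, p₂, h₂⟩ := IsC2Bound.exists_of_contDiff vQ cQ
    (contDiff_const.div (hA.contDiff.of_le (by norm_num)) hA.ne_zero :
      ContDiff ℝ 2 fun p => 1 / A p)
  obtain ⟨b₃, p₃, h₃⟩ := IsC2Bound.exists_of_contDiff vQ cQ
    (hY.contDiff_foot.prodMk contDiff_snd : ContDiff ℝ 2 fun p => (ξ p, p.2))
  obtain ⟨b₄, p₄, h₄⟩ := IsC2Bound.exists_of_contDiff vJ cJ hY.contDiff_flow
  obtain ⟨b₅, p₅, h₅⟩ := IsC2Bound.exists_of_contDiff vJ cJ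
    ((contDiff_sourceWeight hA).comp (hY.contDiff_flow.prodMk contDiff_snd))
  obtain ⟨b₆, p₆, h₆⟩ := IsC2Bound.exists_of_contDiff vJ cJ (contDiff_fst (𝕜 := ℝ) (n := 2))
  obtain ⟨b₇, p₇, h₇⟩ := IsC2Bound.exists_of_contDiff vJ cJ (hiw.comp contDiff_fst)
  obtain ⟨d₁, q₁, k₁⟩ := exists_isC2Bound_weightedPrimitive
    (contDiff_const : ContDiff ℝ 1 fun _ : ℝ => (1 : ℝ)) hR hC
  obtain ⟨d₂, q₂, k₂⟩ := exists_isC2Bound_weightedPrimitive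
    (contDiff_const : ContDiff ℝ 1 fun _ : ℝ => (1 : ℝ)) hρ₂0 hC
  obtain ⟨d₃, q₃, k₃⟩ := exists_isC2Bound_weightedPrimitive
    (contDiff_const : ContDiff ℝ 1 fun _ : ℝ => (1 : ℝ)) hρ₁0 hC
  obtain ⟨d₄, q₄, k₄⟩ := exists_isC2Bound_weightedPrimitive
    (hiw.of_le (by norm_num)) hρ₁0 hC
  have mR : MapsTo (Prod.fst : ℝ × ℝ → ℝ) (Icc 0 R ×ˢ Icc 0 T) (Icc (-R) R) := fun p hp =>
    ⟨by linarith [hp.1.1], hp.1.2⟩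
  have mJ : MapsTo (Prod.fst : ℝ × ℝ → ℝ) (Icc (-ρ₁) ρ₁ ×ˢ Icc 0 T) (Icc (-ρ₁) ρ₁) :=
    fun p hp => hp.1
  have mY : MapsTo Y (Icc (-ρ₁) ρ₁ ×ˢ Icc 0 T) (Icc (-ρ₂) ρ₂) := fun p hp =>
    abs_le.1 (hρ₂ p hp)
  have mξ : MapsTo (fun p : ℝ × ℝ => (ξ p, p.2)) (Icc 0 R ×ˢ Icc 0 T)
      (Icc (-ρ₁) ρ₁ ×ˢ Icc 0 T) := fun p hp => ⟨abs_le.1 (hρ₁ p hp), hp.2⟩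
  exact ⟨_, by positivity, fun f hf =>
    (((k₁ f hf).comp p₁ q₁ h₁ mR).mul (by positivity) p₂ h₂).add
      ((((((k₂ f hf).comp p₄ q₂ h₄ mY).mul (by positivity) p₅ h₅).timePrimitive hT
        (by positivity)).add (((k₄ f hf).comp p₆ q₄ h₆ mJ).add
          (((k₃ f hf).comp p₆ q₃ h₆ mJ).mul (by positivity) p₇ h₇).neg)).comp p₃
            (by positivity) h₃ mξ)⟩

theorem contDiff_alignedFoot (hY : IsFlow A Y ξ) :
    ContDiff ℝ 2 fun p : ℝ × ℝ => ξ (p.1 + Y (0, p.2), p.2) :=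
  hY.contDiff_foot.comp ((contDiff_fst.add (hY.contDiff_flow.comp
    (contDiff_const.prodMk contDiff_snd))).prodMk contDiff_snd)

theorem exists_isC2Bound_alignedLayer (hA : IsGlobalSpeed α K A) (hY : IsFlow A Y ξ) {L T C : ℝ}
    (hL : 0 ≤ L) (hT : 0 ≤ T) (hC : 0 ≤ C) :
    ∃ B, 0 ≤ B ∧ ∀ f, IsProfile C f →
      IsC2Bound (Icc 0 L ×ˢ Icc 0 T) B (alignedLayer A Y ξ f) := by
  have cQ : IsCompact (Icc 0 L ×ˢ Icc 0 T) := isCompact_Icc.prod isCompact_Icc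
  have vQ : Convex ℝ (Icc 0 L ×ˢ Icc 0 T) := (convex_Icc _ _).prod (convex_Icc _ _)
  have hc := contDiff_alignedFoot hY
  obtain ⟨ρ, hρ⟩ := cQ.exists_bound_of_continuousOn hc.continuous.continuousOn
  have hρ0 : 0 ≤ ρ := (norm_nonneg _).trans (hρ (0, 0) ⟨⟨le_rfl, hL⟩, le_rfl, hT⟩)
  obtain ⟨b, p, h⟩ := IsC2Bound.exists_of_contDiff vQ cQ hc
  obtain ⟨d, q, k⟩ := exists_isC2Bound_weightedPrimitive
    ((contDiff_initialWeight hA).of_le (by norm_num)) hρ0 hC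
  refine ⟨d * (1 + b) ^ 2, by positivity, fun f hf => ?_⟩
  exact ((k f hf).comp p q h fun p hp => abs_le.1 (hρ p hp)).neg

end Layers

/-! ### Extension of the source -/

/-- The layer bounds force `|f'| ≤ C₁` uniformly in `ε`, because `f'` vanishes at the origin and
`|f''|` has integral at most `C₁`. The extension below keeps this bound on the whole line. -/
theorem exists_isProfile {L C₁ ε : ℝ} {f : ℝ → ℝ} (hL : 0 < L) (hε : 0 < ε)
    (hf : HasInflowLayer L C₁ ε f) : ∃ F, IsProfile C₁ F ∧ EqOn F f (Icc 0 L) := by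
  have hu : UniqueDiffOn ℝ (Icc 0 L) := uniqueDiffOn_Icc hL
  have h0L : (0 : ℝ) ∈ Icc 0 L := ⟨le_rfl, hL.le⟩
  set f₁ := derivWithin f (Icc 0 L) with hf₁
  have hc1 : ContDiffOn ℝ 1 f₁ (Icc 0 L) := hf.contDiffOn.derivWithin hu (by norm_num)
  have hd0 : ∀ x ∈ Icc 0 L, HasDerivWithinAt f (f₁ x) (Icc 0 L) x := fun x hx =>
    ((hf.contDiffOn.differentiableOn (by norm_num)) x hx).hasDerivWithinAt
  have hd1 : ∀ x ∈ Icc 0 L, HasDerivWithinAt f₁ (derivWithin f₁ (Icc 0 L) x) (Icc 0 L) x :=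
    fun x hx => ((hc1.differentiableOn (by norm_num)) x hx).hasDerivWithinAt
  have hf0 : f 0 = 0 := by
    have := hf.bound 0 (by norm_num) 0 h0L
    simpa using this
  have hf10 : f₁ 0 = 0 := by
    have := hf.bound 1 (by norm_num) 0 h0L
    simpa [iteratedDerivWithin_one] using this
  have hf2 : ∀ x ∈ Icc 0 L, |derivWithin f₁ (Icc 0 L) x| ≤ C₁ * ε⁻¹ * Real.exp (-x / ε) := by
    intro x hx
    have := hf.bound 2 le_rfl x hx
    have e : iteratedDerivWithin 2 f (Icc 0 L) x = derivWithin f₁ (Icc 0 L) x := by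
      rw [show (2 : ℕ) = 1 + 1 from rfl, iteratedDerivWithin_succ]
      refine derivWithin_congr (fun y hy => ?_) ?_ <;> rw [iteratedDerivWithin_one]
    rw [e] at this
    rwa [Nat.sub_self, pow_zero, mul_one, show ((2 : ℕ) : ℤ) - 3 = -1 by norm_num,
      zpow_neg_one] at this
  have hC₁ : 0 ≤ C₁ := by
    have := (abs_nonneg _).trans (hf2 0 h0L)
    simp only [neg_zero, zero_div, Real.exp_zero, mul_one] at this
    exact nonneg_of_mul_nonneg_left this (by positivity)
  have hb1 : ∀ x ∈ Icc 0 L, |f₁ x| ≤ C₁ := by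
    intro x hx
    have hB : ∀ y, HasDerivAt (fun y => C₁ * (1 - Real.exp (-y / ε)))
        (C₁ * ε⁻¹ * Real.exp (-y / ε)) y := by
      intro y
      have h1 : HasDerivAt (fun y : ℝ => -y / ε) (-1 / ε) y := (hasDerivAt_neg y).div_const ε
      refine ((h1.exp.const_sub 1).const_mul C₁).congr_deriv ?_
      field_simp
    have key := image_norm_le_of_norm_deriv_right_le_deriv_boundary (f := f₁) (a := 0) (b := L)
      (f' := derivWithin f₁ (Icc 0 L)) hc1.continuousOn
      (fun y hy => (hd1 y (Ico_subset_Icc_self hy)).mono_of_mem_nhdsWithin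
        (Icc_mem_nhdsGE_of_mem hy)) (B := fun y => C₁ * (1 - Real.exp (-y / ε)))
      (by simp [hf10]) hB (fun y hy => hf2 y (Ico_subset_Icc_self hy)) hx
    refine key.trans ?_
    have : 0 < Real.exp (-x / ε) := Real.exp_pos _
    nlinarith
  -- The derivative of the extension: constant beyond the end points of `[0, L]`.
  set e : ℝ → ℝ := IccExtend hL.le ((Icc 0 L).domRestrict f₁) with he
  have hec : Continuous e := by
    exact (continuousOn_iff_continuous_domRestrict.1 hc1.continuousOn).Icc_extend'
  have heq : ∀ x ∈ Icc 0 L, e x = f₁ x := fun x hx => by rw [he, IccExtend_of_mem _ _ hx]; rfl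
  have heb : ∀ x, |e x| ≤ C₁ := fun x => hb1 _ (projIcc 0 L hL.le x).2
  have he0 : ∀ x ≤ 0, e x = 0 := fun x hx => by rw [he, IccExtend_of_le_left _ _ hx]; exact hf10
  have hFd : ∀ x, HasDerivAt (fun x => ∫ y in (0 : ℝ)..x, e y) (e x) x := fun x =>
    intervalIntegral.integral_hasDerivAt_right (hec.intervalIntegrable _ _)
      (hec.stronglyMeasurableAtFilter _ _) hec.continuousAt
  have hFd' : deriv (fun x => ∫ y in (0 : ℝ)..x, e y) = e := funext fun x => (hFd x).deriv
  refine ⟨fun x => ∫ y in (0 : ℝ)..x, e y, ⟨?_, ?_, ?_⟩, ?_⟩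
  · exact contDiff_one_iff_deriv.2 ⟨fun x => (hFd x).differentiableAt, by rwa [hFd']⟩
  · intro x hx
    rw [intervalIntegral.integral_congr (g := fun _ => (0 : ℝ))]
    · simp
    · intro y hy
      rw [uIcc_of_ge hx] at hy
      exact he0 y hy.2
  · intro x; rw [hFd']; exact heb x
  · intro x hx
    have h1 := intervalIntegral.integral_eq_sub_of_hasDeriv_right_of_le hx.1
      (f := f) (f' := e) (hf.contDiffOn.continuousOn.mono (Icc_subset_Icc_right hx.2))
      (fun y hy => by
        have hy' : y ∈ Ico 0 L := ⟨hy.1.le, hy.2.trans_le hx.2⟩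
        rw [heq y (Ico_subset_Icc_self hy')]
        exact (hd0 y (Ico_subset_Icc_self hy')).mono_of_mem_nhdsWithin
          (nhdsWithin_mono y Ioi_subset_Ici_self (Icc_mem_nhdsGE_of_mem hy')))
      (hec.intervalIntegrable _ _)
    simp only [h1, hf0, sub_zero]

/-! ### Meshes and interpolation -/

/-- The nodes `X 0 < ⋯ < X N` divide `[0, ℓ]` into intervals of length at most `h`. -/
structure IsMesh (X : ℕ → ℝ) (ℓ h : ℝ) (N : ℕ) : Prop where
  pos : 0 < N
  first : X 0 = 0
  last : X N = ℓ
  lt_succ : ∀ i < N, X i < X (i + 1)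
  step_le : ∀ i < N, X (i + 1) - X i ≤ h

theorem isMesh_uniformMesh {ℓ : ℝ} (hℓ : 0 < ℓ) {N : ℕ} (hN : 0 < N) :
    IsMesh (uniformMesh ℓ N) ℓ (ℓ / N) N := by
  have hN' : (0 : ℝ) < N := by exact_mod_cast hN
  have hs : ∀ i, uniformMesh ℓ N (i + 1) - uniformMesh ℓ N i = ℓ / N := by
    intro i; simp only [uniformMesh]; push_cast; field_simp; ring
  refine ⟨hN, by simp [uniformMesh], ?_, fun i _ => ?_, fun i _ => (hs i).le⟩
  · simp only [uniformMesh]; field_simp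
  · have := hs i
    have : 0 < ℓ / N := by positivity
    linarith

theorem isMesh_shishkinMesh {L σ : ℝ} (hσ : 0 < σ) (hσL : σ ≤ L / 2) {N : ℕ} (hN : 0 < N)
    (hE : Even N) : IsMesh (shishkinMesh L σ N) L (2 * L / N) N := by
  have hN' : (0 : ℝ) < N := by exact_mod_cast hN
  obtain ⟨n, rfl⟩ := hE
  have hn : 0 < n := by omega
  have hs : ∀ i < n + n, 0 < shishkinMesh L σ (n + n) (i + 1) - shishkinMesh L σ (n + n) i ∧
      shishkinMesh L σ (n + n) (i + 1) - shishkinMesh L σ (n + n) i ≤ 2 * L / (n + n : ℕ) := by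
    intro i hi
    have hfine : 0 < 2 * σ / (n + n : ℕ) := by positivity
    have hcoarse : 0 < 2 * (L - σ) / (n + n : ℕ) := div_pos (by linarith) hN'
    by_cases h1 : i + 1 ≤ n
    · have e : shishkinMesh L σ (n + n) (i + 1) - shishkinMesh L σ (n + n) i
          = 2 * σ / (n + n : ℕ) := by
        rw [shishkinMesh, shishkinMesh, if_pos (by omega), if_pos (by omega)]
        push_cast; ring
      rw [e]
      refine ⟨hfine, ?_⟩
      gcongr
      linarith
    · have e : shishkinMesh L σ (n + n) (i + 1) - shishkinMesh L σ (n + n) i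
          = 2 * (L - σ) / (n + n : ℕ) := by
        rw [shishkinMesh, if_neg (by omega)]
        by_cases h2 : i ≤ n
        · -- At the transition point both branches give the value `σ`.
          have h3 : i = n := by omega
          subst h3
          have : (0 : ℝ) < i := by exact_mod_cast hn
          rw [shishkinMesh, if_pos (by omega)]
          push_cast
          field_simp
          ring
        · rw [shishkinMesh, if_neg (by omega)]
          push_cast; ring
      rw [e]
      refine ⟨hcoarse, ?_⟩
      gcongr
      linarith
  refine ⟨hN, by simp [shishkinMesh], ?_, fun i hi => sub_pos.1 (hs i hi).1,
    fun i hi => (hs i hi).2⟩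
  rw [shishkinMesh, if_neg (by omega)]
  simp

theorem transition_pos {L κ ε : ℝ} (hL : 0 < L) (hκ : 0 < κ) (hε : 0 < ε) {N : ℕ} (hN : 2 ≤ N) :
    0 < transition L κ ε N :=
  lt_min (by linarith) (mul_pos (mul_pos hκ hε) (Real.log_pos (by exact_mod_cast hN)))

namespace IsMesh

variable {X : ℕ → ℝ} {ℓ h : ℝ} {N : ℕ}

theorem lt_of_lt (hX : IsMesh X ℓ h N) {i j : ℕ} (hij : i < j) (hj : j ≤ N) : X i < X j := by
  induction j, hij using Nat.le_induction with
  | base => exact hX.lt_succ i (by omega)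
  | succ j hij ih => exact (ih (by omega)).trans (hX.lt_succ j (by omega))

theorem le_of_le (hX : IsMesh X ℓ h N) {i j : ℕ} (hij : i ≤ j) (hj : j ≤ N) : X i ≤ X j := by
  rcases hij.eq_or_lt with rfl | h
  · rfl
  · exact (hX.lt_of_lt h hj).le

theorem mem_Icc (hX : IsMesh X ℓ h N) {i : ℕ} (hi : i ≤ N) : X i ∈ Icc 0 ℓ :=
  ⟨hX.first ▸ hX.le_of_le (Nat.zero_le i) hi, hX.last ▸ hX.le_of_le hi le_rfl⟩

theorem mem_Ioc (hX : IsMesh X ℓ h N) {i : ℕ} (hi : i ∈ Finset.Icc 1 N) : X i ∈ Ioc 0 ℓ := by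
  rw [Finset.mem_Icc] at hi
  exact ⟨hX.first ▸ hX.lt_of_lt (by omega) hi.2, (hX.mem_Icc hi.2).2⟩

theorem step_pos (hX : IsMesh X ℓ h N) {i : ℕ} (hi : i ∈ Finset.Icc 1 N) :
    0 < X i - X (i - 1) := by
  rw [Finset.mem_Icc] at hi
  have := hX.lt_of_lt (i := i - 1) (j := i) (by omega) hi.2
  linarith

theorem step_le' (hX : IsMesh X ℓ h N) {i : ℕ} (hi : i ∈ Finset.Icc 1 N) :
    X i - X (i - 1) ≤ h := by
  rw [Finset.mem_Icc] at hi
  have := hX.step_le (i - 1) (by omega)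
  rwa [Nat.sub_add_cancel hi.1] at this

theorem width_pos (hX : IsMesh X ℓ h N) : 0 < h := by
  have h1 := hX.lt_succ 0 hX.pos
  have h2 := hX.step_le 0 hX.pos
  linarith

theorem exists_cell (hX : IsMesh X ℓ h N) {x : ℝ} (hx : x ∈ Icc 0 ℓ) :
    ∃ i < N, X i ≤ x ∧ x ≤ X (i + 1) := by
  by_contra! hcon
  have h1 : ∀ i ≤ N, X i ≤ x := by
    intro i
    induction i with
    | zero => intro _; rw [hX.first]; exact hx.1
    | succ i ih => intro hi; exact (hcon i (by omega) (ih (by omega))).le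
  have h2 := hcon (N - 1) (by have := hX.pos; omega) (h1 _ (by omega))
  rw [Nat.sub_add_cancel hX.pos, hX.last] at h2
  exact absurd hx.2 (not_le.2 h2)

end IsMesh

theorem hat_nonneg (X : ℕ → ℝ) (n i : ℕ) (x : ℝ) : 0 ≤ hat X n i x := by
  unfold hat
  split_ifs with h1 h2
  · exact div_nonneg (by linarith [h1.2.1]) (by linarith [h1.2.1, h1.2.2])
  · exact div_nonneg (by linarith [h2.2.2]) (by linarith [h2.2.1, h2.2.2])
  · exact le_rfl

theorem abs_sub_le_of_hat_ne_zero {X : ℕ → ℝ} {ℓ h : ℝ} {N : ℕ} (hX : IsMesh X ℓ h N) {i : ℕ}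
    (hi : i ≤ N) {x : ℝ} (hne : hat X N i x ≠ 0) : |X i - x| ≤ h := by
  unfold hat at hne
  split_ifs at hne with h1 h2
  · have := hX.step_le' (Finset.mem_Icc.2 ⟨h1.1, hi⟩)
    rw [abs_le]; constructor <;> linarith [h1.2.1, h1.2.2]
  · have := hX.step_le i h2.1
    rw [abs_le]; constructor <;> linarith [h2.2.1, h2.2.2]
  · exact absurd rfl hne

/-- On the interval `[X i, X (i + 1)]`, end points included, only the hat functions of its two end
points contribute. -/
theorem hat_eq {X : ℕ → ℝ} {ℓ h : ℝ} {N : ℕ} (hX : IsMesh X ℓ h N) {i : ℕ} (hi : i < N) {x : ℝ}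
    (h1 : X i ≤ x) (h2 : x ≤ X (i + 1)) {m : ℕ} (hm : m ≤ N) :
    hat X N m x = (if m = i then (X (i + 1) - x) / (X (i + 1) - X i) else 0)
      + (if m = i + 1 then (x - X i) / (X (i + 1) - X i) else 0) := by
  have hlt := hX.lt_succ i hi
  have hne : X (i + 1) - X i ≠ 0 := by linarith
  unfold hat
  rcases lt_trichotomy m i with h | h | h
  · rw [if_neg (show ¬m = i by omega), if_neg (show ¬m = i + 1 by omega), add_zero]
    have hmi : X m < X i := hX.lt_of_lt h (by omega)
    rw [if_neg (fun hc => by linarith [hc.2.2])]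
    split_ifs with hc
    · have := hX.le_of_le (i := m + 1) (j := i) (by omega) (by omega)
      rw [show X (m + 1) - x = 0 by linarith [hc.2.2], zero_div]
    · rfl
  · subst h
    rw [if_pos rfl, if_neg (show ¬m = m + 1 by omega), add_zero]
    split_ifs with hc hc'
    · have hx : x = X m := le_antisymm hc.2.2 h1
      have := hX.lt_of_lt (i := m - 1) (j := m) (by omega) hm
      rw [hx, div_self hne, div_self (by linarith)]
    · rfl
    · exact absurd ⟨hi, h1, h2⟩ hc'
  · rcases (Nat.succ_le_of_lt h).eq_or_lt with h' | h'
    · have h'' : m = i + 1 := h'.symm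
      subst h''
      rw [if_neg (show ¬i + 1 = i by omega), if_pos rfl, zero_add,
        if_pos ⟨by omega, by simpa using h1, h2⟩]
      simp
    · rw [if_neg (show ¬m = i by omega), if_neg (show ¬m = i + 1 by omega), add_zero]
      have hmi : X (i + 1) < X m := hX.lt_of_lt h' hm
      split_ifs with hc hc'
      · have := hX.le_of_le (i := i + 1) (j := m - 1) (by omega) (by omega)
        rw [show x - X (m - 1) = 0 by linarith [hc.2.1], zero_div]
      · linarith [hc'.2.1]
      · rfl

theorem sum_hat {X : ℕ → ℝ} {ℓ h : ℝ} {N : ℕ} (hX : IsMesh X ℓ h N) {x : ℝ}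
    (hx : x ∈ Icc 0 ℓ) : ∑ i ∈ Finset.range (N + 1), hat X N i x = 1 := by
  obtain ⟨i, hi, h1, h2⟩ := hX.exists_cell hx
  have hne : X (i + 1) - X i ≠ 0 := by linarith [hX.lt_succ i hi]
  rw [Finset.sum_congr rfl fun m hm =>
    hat_eq hX hi h1 h2 (Nat.lt_succ_iff.1 (Finset.mem_range.1 hm)), Finset.sum_add_distrib,
    Finset.sum_ite_eq', Finset.sum_ite_eq', if_pos (Finset.mem_range.2 (by omega)),
    if_pos (Finset.mem_range.2 (by omega))]
  field_simp
  ring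

/-- The bilinear interpolant is a convex combination of the nodal values at the nodes adjacent to
the point. -/
theorem abs_interpolant_sub_le {X τ : ℕ → ℝ} {ℓ T h k B v x t : ℝ} {N M : ℕ} {U : ℕ → ℕ → ℝ}
    (hX : IsMesh X ℓ h N) (hτ : IsMesh τ T k M) (hx : x ∈ Icc 0 ℓ) (ht : t ∈ Icc 0 T)
    (hU : ∀ i ≤ N, ∀ j ≤ M, |X i - x| ≤ h → |τ j - t| ≤ k → |U i j - v| ≤ B) :
    |interpolant X τ N M U x t - v| ≤ B := by
  have hone : ∀ c : ℝ, ∑ i ∈ Finset.range (N + 1), ∑ j ∈ Finset.range (M + 1),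
      c * hat X N i x * hat τ M j t = c := by
    intro c
    simp_rw [← Finset.mul_sum, sum_hat hτ ht, mul_one, ← Finset.mul_sum, sum_hat hX hx, mul_one]
  have h1 : interpolant X τ N M U x t - v = ∑ i ∈ Finset.range (N + 1),
      ∑ j ∈ Finset.range (M + 1), (U i j - v) * hat X N i x * hat τ M j t := by
    rw [interpolant]
    conv_lhs => rw [← hone v]
    simp_rw [← Finset.sum_sub_distrib]
    exact Finset.sum_congr rfl fun i _ => Finset.sum_congr rfl fun j _ => by ring
  rw [h1]
  refine (Finset.abs_sum_le_sum_abs _ _).trans ?_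
  conv_rhs => rw [← hone B]
  refine Finset.sum_le_sum fun i hi => (Finset.abs_sum_le_sum_abs _ _).trans
    (Finset.sum_le_sum fun j hj => ?_)
  rw [abs_mul, abs_mul, abs_of_nonneg (hat_nonneg X N i x), abs_of_nonneg (hat_nonneg τ M j t)]
  have hi' : i ≤ N := Nat.lt_succ_iff.1 (Finset.mem_range.1 hi)
  have hj' : j ≤ M := Nat.lt_succ_iff.1 (Finset.mem_range.1 hj)
  by_cases e1 : hat X N i x = 0
  · simp [e1]
  by_cases e2 : hat τ M j t = 0
  · simp [e2]
  have := hU i hi' j hj' (abs_sub_le_of_hat_ne_zero hX hi' e1) (abs_sub_le_of_hat_ne_zero hτ hj' e2)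
  exact mul_le_mul_of_nonneg_right (mul_le_mul_of_nonneg_right this (hat_nonneg _ _ _ _))
    (hat_nonneg _ _ _ _)

/-! ### Consistency and stability of the upwind scheme -/

/-- First order Taylor formulae in each variable for `u` on `S × J`, with `ux` and `ut` in the role
of the partial derivatives, and a Lipschitz bound. -/
structure IsTaylorBound (S J : Set ℝ) (B : ℝ) (u ux ut : ℝ → ℝ → ℝ) : Prop where
  space : ∀ x ∈ S, ∀ y ∈ S, ∀ t ∈ J, |u y t - u x t - (y - x) * ux x t| ≤ B * (y - x) ^ 2
  time : ∀ x ∈ S, ∀ t ∈ J, ∀ s ∈ J, |u x s - u x t - (s - t) * ut x t| ≤ B * (s - t) ^ 2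
  lip : ∀ x ∈ S, ∀ y ∈ S, ∀ t ∈ J, ∀ s ∈ J, |u y s - u x t| ≤ B * (|y - x| + |s - t|)

theorem abs_quotient_sub_le {d δ c B : ℝ} (hδ : δ ≠ 0) (h : |d - δ * c| ≤ B * δ ^ 2) :
    |d / δ - c| ≤ B * |δ| := by
  have h1 : d / δ - c = (d - δ * c) / δ := by field_simp
  rw [h1, abs_div, div_le_iff₀ (abs_pos.2 hδ), mul_assoc, ← sq, sq_abs]
  exact h

namespace IsTaylorBound

variable {S J : Set ℝ} {B : ℝ} {u ux ut : ℝ → ℝ → ℝ}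

theorem abs_backward_space (hu : IsTaylorBound S J B u ux ut) {x y t : ℝ} (hx : x ∈ S)
    (hy : y ∈ S) (ht : t ∈ J) (hyx : y < x) :
    |(u x t - u y t) / (x - y) - ux x t| ≤ B * (x - y) := by
  have h := abs_quotient_sub_le (by linarith) (hu.space x hx y hy t ht)
  rw [abs_of_neg (by linarith : y - x < 0), neg_sub] at h
  rwa [← neg_sub (u y t), ← neg_sub y x, neg_div_neg_eq, neg_sub]

theorem abs_forward_space (hu : IsTaylorBound S J B u ux ut) {x y t : ℝ} (hx : x ∈ S)
    (hy : y ∈ S) (ht : t ∈ J) (hxy : x < y) :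
    |(u y t - u x t) / (y - x) - ux x t| ≤ B * (y - x) := by
  have h := abs_quotient_sub_le (by linarith) (hu.space x hx y hy t ht)
  rwa [abs_of_pos (by linarith : 0 < y - x)] at h

theorem abs_backward_time (hu : IsTaylorBound S J B u ux ut) {x t s : ℝ} (hx : x ∈ S)
    (ht : t ∈ J) (hs : s ∈ J) (hst : s < t) :
    |(u x t - u x s) / (t - s) - ut x t| ≤ B * (t - s) := by
  have h := abs_quotient_sub_le (by linarith) (hu.time x hx t ht s hs)
  rw [abs_of_neg (by linarith : s - t < 0), neg_sub] at h
  rwa [← neg_sub (u x s), ← neg_sub s t, neg_div_neg_eq, neg_sub]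

end IsTaylorBound

theorem Dt_sub (τ : ℕ → ℝ) (U V : ℕ → ℕ → ℝ) (i j : ℕ) :
    Dt τ (fun i j => U i j - V i j) i j = Dt τ U i j - Dt τ V i j := by
  simp only [Dt]; rw [← sub_div]; congr 1; ring

theorem Dx_sub (X : ℕ → ℝ) (U V : ℕ → ℕ → ℝ) (i j : ℕ) :
    Dx X (fun i j => U i j - V i j) i j = Dx X U i j - Dx X V i j := by
  simp only [Dx]; rw [← sub_div]; congr 1; ring

theorem DxPlus_sub (X : ℕ → ℝ) (U V : ℕ → ℕ → ℝ) (i j : ℕ) :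
    DxPlus X (fun i j => U i j - V i j) i j = DxPlus X U i j - DxPlus X V i j := by
  simp only [DxPlus]; rw [← sub_div]; congr 1; ring

/-- Maximum norm stability of the implicit upwind scheme with positive speed. -/
theorem upwind_stability {X τ : ℕ → ℝ} {ℓ T h k b r : ℝ} {N M : ℕ} {E c : ℕ → ℕ → ℝ}
    (hX : IsMesh X ℓ h N) (hτ : IsMesh τ T k M) (hr : 0 ≤ r)
    (hc : ∀ i ∈ Finset.Icc 1 N, ∀ j ∈ Finset.Icc 1 M, 0 ≤ c i j)
    (hE : ∀ i ∈ Finset.Icc 1 N, ∀ j ∈ Finset.Icc 1 M, |Dt τ E i j + c i j * Dx X E i j| ≤ r)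
    (hleft : ∀ j ∈ Finset.Icc 1 M, |E 0 j| ≤ b) (hinit : ∀ i ≤ N, |E i 0| ≤ b) :
    ∀ j ≤ M, ∀ i ≤ N, |E i j| ≤ b + r * τ j := by
  intro j
  induction j with
  | zero => intro _ i hi; rw [hτ.first, mul_zero, add_zero]; exact hinit i hi
  | succ j ihj =>
    intro hj i
    have hj' : j + 1 ∈ Finset.Icc 1 M := Finset.mem_Icc.2 ⟨by omega, hj⟩
    have hk := hτ.step_pos hj'
    rw [Nat.add_sub_cancel] at hk
    induction i with
    | zero =>
      intro _
      have h1 := hleft _ hj'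
      have h2 := mul_nonneg hr (hτ.mem_Icc hj).1
      linarith
    | succ i ihi =>
      intro hi
      have hi' : i + 1 ∈ Finset.Icc 1 N := Finset.mem_Icc.2 ⟨by omega, hi⟩
      have hh := hX.step_pos hi'
      rw [Nat.add_sub_cancel] at hh
      have h1 := hE _ hi' _ hj'
      have h2 := ihj (by omega) (i + 1) hi
      have h3 := ihi (by omega)
      have hq := hc _ hi' _ hj'
      simp only [Dt, Dx, Nat.add_sub_cancel] at h1
      set δ := τ (j + 1) - τ j with hδ
      set η := X (i + 1) - X i with hη
      set q := c (i + 1) (j + 1) / η with hqdef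
      have hq0 : 0 ≤ q := div_nonneg hq hh.le
      -- The scheme, solved for the new value.
      have h4 : (1 + q * δ) * E (i + 1) (j + 1) = E (i + 1) j + q * δ * E i (j + 1)
          + δ * ((E (i + 1) (j + 1) - E (i + 1) j) / δ
            + c (i + 1) (j + 1) * ((E (i + 1) (j + 1) - E i (j + 1)) / η)) := by
        rw [hqdef]; field_simp; ring
      have hqδ : 0 ≤ q * δ := mul_nonneg hq0 hk.le
      have h5 : (1 + q * δ) * |E (i + 1) (j + 1)| ≤ (1 + q * δ) * (b + r * τ (j + 1)) := by
        rw [← abs_of_nonneg (by linarith : 0 ≤ 1 + q * δ), ← abs_mul, h4,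
          abs_of_nonneg (by linarith : 0 ≤ 1 + q * δ)]
        refine (abs_add_le _ _).trans ((add_le_add_left (abs_add_le _ _) _).trans ?_)
        rw [abs_mul (q * δ), abs_of_nonneg hqδ, abs_mul δ, abs_of_pos hk]
        have h6 := mul_le_mul_of_nonneg_left h3 hqδ
        have h7 := mul_le_mul_of_nonneg_left h1 hk.le
        have h8 : r * τ (j + 1) = r * τ j + δ * r := by rw [hδ]; ring
        linarith
      exact le_of_mul_le_mul_left h5 (by linarith)

/-- The error of the upwind scheme at the nodes. -/
theorem upwind_error {X τ : ℕ → ℝ} {L T h k b B Ka : ℝ} {N M : ℕ} {a : ℝ → ℝ → ℝ} {f : ℝ → ℝ}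
    {u ux ut : ℝ → ℝ → ℝ} {U : ℕ → ℕ → ℝ} (hX : IsMesh X L h N) (hτ : IsMesh τ T k M)
    (hB : 0 ≤ B) (hu : IsTaylorBound (Icc 0 L) (Icc 0 T) B u ux ut)
    (hpde : ∀ x ∈ Ioc 0 L, ∀ t ∈ Ioc 0 T, ut x t + a x t * ux x t = f x)
    (ha0 : ∀ x ∈ Icc 0 L, ∀ t ∈ Icc 0 T, 0 ≤ a x t)
    (ha : ∀ x ∈ Icc 0 L, ∀ t ∈ Icc 0 T, a x t ≤ Ka)
    (hU : ∀ i ∈ Finset.Icc 1 N, ∀ j ∈ Finset.Icc 1 M,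
      Dt τ U i j + a (X i) (τ j) * Dx X U i j = f (X i))
    (hleft : ∀ j ∈ Finset.Icc 1 M, U 0 j = u 0 (τ j)) (hb : 0 ≤ b)
    (hinit : ∀ i ≤ N, |U i 0 - u (X i) 0| ≤ b) :
    ∀ i ≤ N, ∀ j ≤ M, |U i j - u (X i) (τ j)| ≤ b + B * (k + Ka * h) * T := by
  have hk := hτ.width_pos
  have hh := hX.width_pos
  have hKa : 0 ≤ Ka := (ha0 _ (hX.mem_Icc (Nat.zero_le _)) _ (hτ.mem_Icc (Nat.zero_le _))).trans
    (ha _ (hX.mem_Icc (Nat.zero_le _)) _ (hτ.mem_Icc (Nat.zero_le _)))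
  have key := upwind_stability (E := fun i j => U i j - u (X i) (τ j))
    (c := fun i j => a (X i) (τ j)) (b := b) (r := B * (k + Ka * h)) hX hτ (by positivity)
    (fun i hi j hj => ha0 _ (hX.mem_Icc (Finset.mem_Icc.1 hi).2) _
      (hτ.mem_Icc (Finset.mem_Icc.1 hj).2)) ?_ ?_ ?_
  · intro i hi j hj
    refine (key j hj i hi).trans ?_
    gcongr
    exact (hτ.mem_Icc hj).2
  · intro i hi j hj
    have hi2 := (Finset.mem_Icc.1 hi).2
    have hj2 := (Finset.mem_Icc.1 hj).2
    have hxi := hX.mem_Icc hi2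
    have hxi' := hX.mem_Icc (i := i - 1) (by omega)
    have htj := hτ.mem_Icc hj2
    have htj' := hτ.mem_Icc (i := j - 1) (by omega)
    have e1 := hu.abs_backward_time hxi htj htj' (sub_pos.1 (hτ.step_pos hj))
    have e2 := hu.abs_backward_space hxi hxi' htj (sub_pos.1 (hX.step_pos hi))
    have hp := hpde _ (hX.mem_Ioc hi) _ (hτ.mem_Ioc hj)
    have hs := hU i hi j hj
    rw [Dt_sub, Dx_sub]
    have e3 : Dt τ (fun i j => u (X i) (τ j)) i j
      = (u (X i) (τ j) - u (X i) (τ (j - 1))) / (τ j - τ (j - 1)) := rfl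
    have e4 : Dx X (fun i j => u (X i) (τ j)) i j
      = (u (X i) (τ j) - u (X (i - 1)) (τ j)) / (X i - X (i - 1)) := rfl
    rw [← e3] at e1
    rw [← e4] at e2
    have e5 : Dt τ U i j - Dt τ (fun i j => u (X i) (τ j)) i j
        + a (X i) (τ j) * (Dx X U i j - Dx X (fun i j => u (X i) (τ j)) i j)
        = -(Dt τ (fun i j => u (X i) (τ j)) i j - ut (X i) (τ j))
          + -(a (X i) (τ j) * (Dx X (fun i j => u (X i) (τ j)) i j - ux (X i) (τ j))) := by
      linear_combination hs - hp
    rw [e5]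
    refine (abs_add_le _ _).trans ?_
    rw [abs_neg, abs_neg, abs_mul, abs_of_nonneg (ha0 _ hxi _ htj)]
    have s1 := hτ.step_le' hj
    have s2 := hX.step_le' hi
    have e6 : |Dx X (fun i j => u (X i) (τ j)) i j - ux (X i) (τ j)| ≤ B * h :=
      e2.trans (by gcongr)
    have e7 := mul_le_mul (ha _ hxi _ htj) e6 (abs_nonneg _) hKa
    have e8 : B * (τ j - τ (j - 1)) ≤ B * k := by gcongr
    linarith
  · intro j hj
    simp only [hX.first, hleft j hj, sub_self, abs_zero, hb]
  · intro i hi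
    simpa only [hτ.first] using hinit i hi

/-- The error of the interpolated upwind scheme. -/
theorem upwind_interpolant_error {X τ : ℕ → ℝ} {L T h k b B Ka : ℝ} {N M : ℕ} {a : ℝ → ℝ → ℝ}
    {f : ℝ → ℝ} {u ux ut : ℝ → ℝ → ℝ} {U : ℕ → ℕ → ℝ} (hX : IsMesh X L h N)
    (hτ : IsMesh τ T k M) (hB : 0 ≤ B) (hu : IsTaylorBound (Icc 0 L) (Icc 0 T) B u ux ut)
    (hpde : ∀ x ∈ Ioc 0 L, ∀ t ∈ Ioc 0 T, ut x t + a x t * ux x t = f x)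
    (ha0 : ∀ x ∈ Icc 0 L, ∀ t ∈ Icc 0 T, 0 ≤ a x t)
    (ha : ∀ x ∈ Icc 0 L, ∀ t ∈ Icc 0 T, a x t ≤ Ka)
    (hU : ∀ i ∈ Finset.Icc 1 N, ∀ j ∈ Finset.Icc 1 M,
      Dt τ U i j + a (X i) (τ j) * Dx X U i j = f (X i))
    (hleft : ∀ j ∈ Finset.Icc 1 M, U 0 j = u 0 (τ j)) (hb : 0 ≤ b)
    (hinit : ∀ i ≤ N, |U i 0 - u (X i) 0| ≤ b) {x t : ℝ} (hx : x ∈ Icc 0 L) (ht : t ∈ Icc 0 T) :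
    |interpolant X τ N M U x t - u x t| ≤ b + B * (k + Ka * h) * T + B * (h + k) := by
  have key := upwind_error hX hτ hB hu hpde ha0 ha hU hleft hb hinit
  refine abs_interpolant_sub_le hX hτ hx ht fun i hi j hj h1 h2 => ?_
  have h3 := hu.lip x hx _ (hX.mem_Icc hi) t ht _ (hτ.mem_Icc hj)
  have h4 : B * (|X i - x| + |τ j - t|) ≤ B * (h + k) := by gcongr
  have h5 := abs_sub_le (U i j) (u (X i) (τ j)) (u x t)
  have h6 := key i hi j hj
  linarith

/-! ### The scheme aligned with the characteristic -/

/-- The upwind operator for a relative speed of either sign. -/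
noncomputable def relOp (X τ : ℕ → ℝ) (c : ℕ → ℕ → ℝ) (U : ℕ → ℕ → ℝ) (i j : ℕ) : ℝ :=
  Dt τ U i j + (1 / 2) * ((c i j + |c i j|) * Dx X U i j + (c i j - |c i j|) * DxPlus X U i j)

theorem relOp_sub (X τ : ℕ → ℝ) (c U V : ℕ → ℕ → ℝ) (i j : ℕ) :
    relOp X τ c (fun i j => U i j - V i j) i j = relOp X τ c U i j - relOp X τ c V i j := by
  simp only [relOp, Dt_sub, Dx_sub, DxPlus_sub]; ring

theorem relOp_neg (X τ : ℕ → ℝ) (c U : ℕ → ℕ → ℝ) (i j : ℕ) :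
    relOp X τ c (fun i j => -U i j) i j = -relOp X τ c U i j := by
  have h := relOp_sub X τ c (fun _ _ => 0) U i j
  have h0 : relOp X τ c (fun _ _ => 0) i j = 0 := by simp [relOp, Dt, Dx, DxPlus]
  simpa [h0] using h

section Comparison

variable {X τ : ℕ → ℝ} {ℓ T h k : ℝ} {N M : ℕ} {c : ℕ → ℕ → ℝ}

/-- The discrete maximum principle: at an interior positive maximum over a time level both space
terms are nonnegative, whatever the sign of the speed, and the time difference is positive. -/
theorem relOp_max_principle (hX : IsMesh X ℓ h N) (hτ : IsMesh τ T k M) {D : ℕ → ℕ → ℝ}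
    (hD : ∀ i ∈ Finset.Ioo 0 N, ∀ j ∈ Finset.Icc 1 M, relOp X τ c D i j ≤ 0)
    (hl : ∀ j ∈ Finset.Icc 1 M, D 0 j ≤ 0) (hr : ∀ j ∈ Finset.Icc 1 M, D N j ≤ 0)
    (hi : ∀ i ≤ N, D i 0 ≤ 0) : ∀ j ≤ M, ∀ i ≤ N, D i j ≤ 0 := by
  intro j
  induction j with
  | zero => intro _; exact hi
  | succ j ih =>
    intro hj
    have hj' : j + 1 ∈ Finset.Icc 1 M := Finset.mem_Icc.2 ⟨by omega, hj⟩
    obtain ⟨m, hm, hmax⟩ := Finset.exists_max_image (Finset.range (N + 1)) (fun i => D i (j + 1))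
      ⟨0, by simp⟩
    have hmN : m ≤ N := Nat.lt_succ_iff.1 (Finset.mem_range.1 hm)
    suffices hms : D m (j + 1) ≤ 0 from fun i hiN =>
      (hmax i (Finset.mem_range.2 (by omega))).trans hms
    rcases Nat.eq_zero_or_pos m with h0 | h0
    · rw [h0]; exact hl _ hj'
    rcases hmN.eq_or_lt with h1 | h1
    · rw [h1]; exact hr _ hj'
    by_contra! hpos
    have hop := hD m (Finset.mem_Ioo.2 ⟨h0, h1⟩) _ hj'
    have hk := hτ.step_pos hj'
    have hx := hX.step_pos (Finset.mem_Icc.2 ⟨h0, hmN⟩)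
    have hx' := hX.lt_succ m h1
    have d1 : 0 < Dt τ D m (j + 1) := by
      have := ih (by omega) m hmN
      exact div_pos (by simp only [Nat.add_sub_cancel]; linarith) hk
    have d2 : 0 ≤ Dx X D m (j + 1) :=
      div_nonneg (sub_nonneg.2 (hmax _ (Finset.mem_range.2 (by omega)))) hx.le
    have d3 : DxPlus X D m (j + 1) ≤ 0 :=
      div_nonpos_of_nonpos_of_nonneg
        (sub_nonpos.2 (hmax _ (Finset.mem_range.2 (by omega)))) (by linarith)
    have c1 : 0 ≤ c m (j + 1) + |c m (j + 1)| := by linarith [neg_abs_le (c m (j + 1))]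
    have c2 : c m (j + 1) - |c m (j + 1)| ≤ 0 := by linarith [le_abs_self (c m (j + 1))]
    have m1 := mul_nonneg c1 d2
    have m2 := mul_nonneg_of_nonpos_of_nonpos c2 d3
    simp only [relOp] at hop
    linarith

/-- A barrier dominates every mesh function whose residual and boundary values it dominates. -/
theorem relOp_comparison (hX : IsMesh X ℓ h N) (hτ : IsMesh τ T k M) {E Φ : ℕ → ℕ → ℝ}
    (hE : ∀ i ∈ Finset.Ioo 0 N, ∀ j ∈ Finset.Icc 1 M, |relOp X τ c E i j| ≤ relOp X τ c Φ i j)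
    (hl : ∀ j ∈ Finset.Icc 1 M, |E 0 j| ≤ Φ 0 j) (hr : ∀ j ∈ Finset.Icc 1 M, |E N j| ≤ Φ N j)
    (hi : ∀ i ≤ N, |E i 0| ≤ Φ i 0) : ∀ j ≤ M, ∀ i ≤ N, |E i j| ≤ Φ i j := by
  intro j hj i hiN
  have h1 := relOp_max_principle (D := fun i j => E i j - Φ i j) (c := c) hX hτ
    (fun i hi j hj => by rw [relOp_sub]; linarith [(abs_le.1 (hE i hi j hj)).2])
    (fun j hj => by linarith [(abs_le.1 (hl j hj)).2])
    (fun j hj => by linarith [(abs_le.1 (hr j hj)).2])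
    (fun i h => by linarith [(abs_le.1 (hi i h)).2]) j hj i hiN
  have h2 := relOp_max_principle (D := fun i j => -E i j - Φ i j) (c := c) hX hτ
    (fun i hi j hj => by
      rw [relOp_sub X τ c (fun i j => -E i j), relOp_neg]
      linarith [(abs_le.1 (hE i hi j hj)).1])
    (fun j hj => by linarith [(abs_le.1 (hl j hj)).1])
    (fun j hj => by linarith [(abs_le.1 (hr j hj)).1])
    (fun i h => by linarith [(abs_le.1 (hi i h)).1]) j hj i hiN
  exact abs_le.2 ⟨by linarith, by linarith⟩

/-- The residual of a smooth solution of `u_t + c u_s = 0` in the scheme. -/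
theorem abs_relOp_le (hX : IsMesh X ℓ h N) (hτ : IsMesh τ T k M) {B Kc : ℝ} (hB : 0 ≤ B)
    {u ux ut : ℝ → ℝ → ℝ} (hu : IsTaylorBound (Icc 0 ℓ) (Icc 0 T) B u ux ut) {i j : ℕ}
    (hi : i ∈ Finset.Ioo 0 N) (hj : j ∈ Finset.Icc 1 M) (hc : |c i j| ≤ Kc)
    (hp : ut (X i) (τ j) + c i j * ux (X i) (τ j) = 0) :
    |relOp X τ c (fun i j => u (X i) (τ j)) i j| ≤ B * (k + Kc * h) := by
  have hi2 := Finset.mem_Ioo.1 hi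
  have hi' : i ∈ Finset.Icc 1 N := Finset.mem_Icc.2 ⟨hi2.1, hi2.2.le⟩
  have hxi := hX.mem_Icc hi2.2.le
  have htj := hτ.mem_Icc (Finset.mem_Icc.1 hj).2
  have e1 := hu.abs_backward_time hxi htj (hτ.mem_Icc (i := j - 1)
    (by have := (Finset.mem_Icc.1 hj).2; omega)) (sub_pos.1 (hτ.step_pos hj))
  have e2 := hu.abs_backward_space hxi (hX.mem_Icc (i := i - 1) (by omega)) htj
    (sub_pos.1 (hX.step_pos hi'))
  have e3 := hu.abs_forward_space hxi (hX.mem_Icc (i := i + 1) (by omega)) htj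
    (hX.lt_succ i hi2.2)
  have s1 := hτ.step_le' hj
  have s2 := hX.step_le' hi'
  have s3 := hX.step_le i hi2.2
  set ct := c i j
  set a₁ := Dt τ (fun i j => u (X i) (τ j)) i j with ha₁
  set a₂ := Dx X (fun i j => u (X i) (τ j)) i j with ha₂
  set a₃ := DxPlus X (fun i j => u (X i) (τ j)) i j with ha₃
  have e1' : |a₁ - ut (X i) (τ j)| ≤ B * k := e1.trans (by gcongr)
  have e2' : |a₂ - ux (X i) (τ j)| ≤ B * h := e2.trans (by gcongr)
  have e3' : |a₃ - ux (X i) (τ j)| ≤ B * h := e3.trans (by gcongr)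
  have c1 : 0 ≤ ct + |ct| := by linarith [neg_abs_le ct]
  have c2 : 0 ≤ |ct| - ct := by linarith [le_abs_self ct]
  have e4 : relOp X τ c (fun i j => u (X i) (τ j)) i j = (a₁ - ut (X i) (τ j))
      + ((1 / 2) * ((ct + |ct|) * (a₂ - ux (X i) (τ j)))
        + -((1 / 2) * ((|ct| - ct) * (a₃ - ux (X i) (τ j))))) := by
    simp only [relOp]
    linear_combination hp
  rw [e4]
  refine (abs_add_le _ _).trans ((add_le_add e1' (abs_add_le _ _)).trans ?_)
  rw [abs_neg, abs_mul, abs_mul, abs_mul, abs_mul, abs_of_nonneg c1, abs_of_nonneg c2,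
    abs_of_pos (by norm_num : (0 : ℝ) < 1 / 2)]
  have m1 := mul_le_mul_of_nonneg_left e2' c1
  have m2 := mul_le_mul_of_nonneg_left e3' c2
  have m3 : |ct| * (B * h) ≤ Kc * (B * h) :=
    mul_le_mul_of_nonneg_right hc (mul_nonneg hB hX.width_pos.le)
  linarith

end Comparison

theorem one_sub_exp_neg_ge {y : ℝ} (h0 : 0 ≤ y) (h1 : y ≤ 1) : y - y ^ 2 ≤ 1 - Real.exp (-y) := by
  have := Real.abs_exp_sub_one_sub_id_le (x := -y) (by rwa [abs_neg, abs_of_nonneg h0])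
  have := (abs_le.1 this).2
  nlinarith

theorem exp_sub_one_le {y : ℝ} (h0 : 0 ≤ y) (h1 : y ≤ 1) : Real.exp y - 1 ≤ y + y ^ 2 := by
  have := Real.abs_exp_sub_one_sub_id_le (x := y) (by rwa [abs_of_nonneg h0])
  have := (abs_le.1 this).2
  linarith

/-- Data of a problem `u_t + c u_s = 0` in coordinates `s = x - γ(t)` which move with a curve `γ`,
such that the absolute speed `c + γ'` is at least `α`. The last three fields are quantitative forms
of `α ≤ γ' ≤ G` and of a bound on the second derivative of `γ`. -/
structure IsRelativeSpeed (L T α G D Kc : ℝ) (c : ℝ → ℝ → ℝ) (γ γ' : ℝ → ℝ) : Prop where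
  α_pos : 0 < α
  G_nonneg : 0 ≤ G
  D_nonneg : 0 ≤ D
  Kc_nonneg : 0 ≤ Kc
  start : γ 0 = 0
  speed : ∀ s ∈ Icc 0 L, ∀ t ∈ Icc 0 T, α ≤ c s t + γ' t
  bound : ∀ s ∈ Icc 0 L, ∀ t ∈ Icc 0 T, |c s t| ≤ Kc
  lower : ∀ t ∈ Icc 0 T, ∀ r ∈ Icc 0 T, r ≤ t → α * (t - r) ≤ γ t - γ r
  upper : ∀ t ∈ Icc 0 T, ∀ r ∈ Icc 0 T, r ≤ t → γ t - γ r ≤ G * (t - r)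
  taylor : ∀ t ∈ Icc 0 T, ∀ r ∈ Icc 0 T, |γ r - γ t - (r - t) * γ' t| ≤ D * (r - t) ^ 2

/-- The decay rate of the barrier, in units of the inverse mesh width. -/
noncomputable def barrierRate (α G Kc : ℝ) : ℝ := α / (4 * (G ^ 2 + Kc) + α * (1 + G))

section Barrier

variable {L T α G D Kc : ℝ} {c : ℝ → ℝ → ℝ} {γ γ' : ℝ → ℝ}

theorem barrierRate_pos (hα : 0 < α) (hG : 0 ≤ G) (hK : 0 ≤ Kc) : 0 < barrierRate α G Kc := by
  unfold barrierRate; positivity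

theorem barrierRate_mul_le_one (hα : 0 < α) (hG : 0 ≤ G) (hK : 0 ≤ Kc) :
    barrierRate α G Kc * (1 + G) ≤ 1 := by
  have h : 0 < 4 * (G ^ 2 + Kc) + α * (1 + G) := by positivity
  rw [barrierRate, div_mul_eq_mul_div, div_le_one h]
  have : 0 ≤ 4 * (G ^ 2 + Kc) := by positivity
  linarith

theorem barrierRate_mul_le (hα : 0 < α) (hG : 0 ≤ G) (hK : 0 ≤ Kc) :
    barrierRate α G Kc * (G ^ 2 + Kc) ≤ α / 4 := by
  have h : 0 < 4 * (G ^ 2 + Kc) + α * (1 + G) := by positivity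
  rw [barrierRate, div_mul_eq_mul_div, div_le_div_iff₀ h (by norm_num)]
  have : 0 ≤ α * (α * (1 + G)) := by positivity
  linarith

/-- The function `exp (λ (s - L + γ t - α t / 2))`. In the original coordinates it is a wave which
leaves `x = L` to the right at half the minimal speed; hence it grows at `s = L` and is bounded
where `x ≤ L`. -/
noncomputable def barrier (L α lam : ℝ) (γ : ℝ → ℝ) (s t : ℝ) : ℝ :=
  Real.exp (lam * (s - L + γ t - α / 2 * t))

/-- The barrier is a supersolution of the scheme when its rate is a small multiple of the inverse
mesh width. -/
theorem relOp_barrier_nonneg (hc : IsRelativeSpeed L T α G D Kc c γ γ') {X τ : ℕ → ℝ} {h k : ℝ}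
    {N M : ℕ} (hX : IsMesh X L h N) (hτ : IsMesh τ T k M) (hk : D * k ≤ α / 4) {i j : ℕ}
    (hi : i ∈ Finset.Ioo 0 N) (hj : j ∈ Finset.Icc 1 M) :
    0 ≤ relOp X τ (fun i j => c (X i) (τ j))
      (fun i j => barrier L α (barrierRate α G Kc / (h + k)) γ (X i) (τ j)) i j := by
  have hα := hc.α_pos
  have hG := hc.G_nonneg
  have hKc := hc.Kc_nonneg
  have hh0 := hX.width_pos
  have hk0 := hτ.width_pos
  set θ := barrierRate α G Kc with hθ
  have hθ0 : 0 < θ := barrierRate_pos hα hG hKc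
  have hθ1 : θ * (1 + G) ≤ 1 := barrierRate_mul_le_one hα hG hKc
  have hθ2 : θ * (G ^ 2 + Kc) ≤ α / 4 := barrierRate_mul_le hα hG hKc
  have hθG : 0 ≤ θ * G := by positivity
  set lam := θ / (h + k) with hlam
  have hlam0 : 0 < lam := by positivity
  have hlh : lam * h ≤ θ := by
    rw [hlam, div_mul_eq_mul_div, div_le_iff₀ (by positivity)]
    exact mul_le_mul_of_nonneg_left (by linarith) hθ0.le
  have hlk : lam * k ≤ θ := by
    rw [hlam, div_mul_eq_mul_div, div_le_iff₀ (by positivity)]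
    exact mul_le_mul_of_nonneg_left (by linarith) hθ0.le
  have hi2 := Finset.mem_Ioo.1 hi
  have hi' : i ∈ Finset.Icc 1 N := Finset.mem_Icc.2 ⟨hi2.1, hi2.2.le⟩
  have hxi := hX.mem_Icc hi2.2.le
  have hj2 := (Finset.mem_Icc.1 hj).2
  have htj := hτ.mem_Icc hj2
  have htj' := hτ.mem_Icc (i := j - 1) (by omega)
  have δ0 := hτ.step_pos hj
  have δk := hτ.step_le' hj
  have η0 := hX.step_pos hi'
  have ηh := hX.step_le' hi'
  have ζ0 : 0 < X (i + 1) - X i := sub_pos.2 (hX.lt_succ i hi2.2)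
  have ζh := hX.step_le i hi2.2
  set b : ℝ → ℝ → ℝ := barrier L α lam γ with hb
  have hbpos : 0 < b (X i) (τ j) := Real.exp_pos _
  set P := b (X i) (τ j) with hP
  set δ := τ j - τ (j - 1) with hδ
  set η := X i - X (i - 1) with hη
  set ζ := X (i + 1) - X i with hζ
  set m := γ (τ j) - γ (τ (j - 1)) - α / 2 * δ with hm
  have low : α * δ ≤ γ (τ j) - γ (τ (j - 1)) := hc.lower _ htj _ htj' (by linarith)
  have upp : γ (τ j) - γ (τ (j - 1)) ≤ G * δ := hc.upper _ htj _ htj' (by linarith)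
  have hαδ : 0 < α * δ := mul_pos hα δ0
  have hm0 : 0 ≤ m := by linarith
  have hmG : m ≤ G * δ := by linarith
  have hmk : lam * m ≤ θ * G := by
    calc lam * m ≤ lam * (G * k) := by gcongr; exact hmG.trans (by gcongr)
      _ = (lam * k) * G := by ring
      _ ≤ θ * G := by gcongr
  -- The three neighbouring values of the barrier.
  have n1 : b (X i) (τ (j - 1)) = P * Real.exp (-(lam * m)) := by
    rw [hP, hb, barrier, barrier, ← Real.exp_add]; congr 1; rw [hm, hδ]; ring
  have n2 : b (X (i - 1)) (τ j) = P * Real.exp (-(lam * η)) := by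
    rw [hP, hb, barrier, barrier, ← Real.exp_add]; congr 1; rw [hη]; ring
  have n3 : b (X (i + 1)) (τ j) = P * Real.exp (lam * ζ) := by
    rw [hP, hb, barrier, barrier, ← Real.exp_add]; congr 1; rw [hζ]; ring
  have hlη : lam * η ≤ θ := (mul_le_mul_of_nonneg_left ηh hlam0.le).trans hlh
  have hlζ : lam * ζ ≤ θ := (mul_le_mul_of_nonneg_left ζh hlam0.le).trans hlh
  have tay := hc.taylor _ htj _ htj'
  have hmt : δ * (γ' (τ j) - α / 2 - D * k) ≤ m := by
    have h1 : -(D * δ ^ 2) ≤ γ (τ j) - γ (τ (j - 1)) - δ * γ' (τ j) := by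
      have := (abs_le.1 tay).2
      have e : (τ (j - 1) - τ j) ^ 2 = δ ^ 2 := by rw [hδ]; ring
      rw [e] at this
      have e' : (τ (j - 1) - τ j) * γ' (τ j) = -(δ * γ' (τ j)) := by rw [hδ]; ring
      rw [e'] at this
      linarith
    have h2 : D * δ ^ 2 ≤ D * (δ * k) := by
      rw [sq]; exact mul_le_mul_of_nonneg_left (mul_le_mul_of_nonneg_left δk δ0.le) hc.D_nonneg
    have h3 : δ * (γ' (τ j) - α / 2 - D * k)
        = δ * γ' (τ j) - α / 2 * δ - D * (δ * k) := by ring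
    rw [h3]
    linarith
  -- The difference quotients of the exponential agree with its derivatives up to a relative error
  -- of order `θ`.
  have t1 : P * lam * (γ' (τ j) - α / 2 - D * k - θ * G ^ 2)
      ≤ Dt τ (fun i j => b (X i) (τ j)) i j := by
    have h1 := one_sub_exp_neg_ge (y := lam * m) (by positivity) (by linarith)
    have h2 : Dt τ (fun i j => b (X i) (τ j)) i j = P * (1 - Real.exp (-(lam * m))) / δ := by
      simp only [Dt]; rw [n1, ← hP]; ring
    rw [h2, le_div_iff₀ δ0]
    have h3 : lam * m ^ 2 ≤ θ * G ^ 2 * δ := by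
      calc lam * m ^ 2 = (lam * m) * m := by ring
        _ ≤ (θ * G) * (G * δ) := mul_le_mul hmk hmG hm0 hθG
        _ = θ * G ^ 2 * δ := by ring
    calc P * lam * (γ' (τ j) - α / 2 - D * k - θ * G ^ 2) * δ
        = P * (lam * (δ * (γ' (τ j) - α / 2 - D * k) - θ * G ^ 2 * δ)) := by ring
      _ ≤ P * (lam * (m - lam * m ^ 2)) := by gcongr
      _ = P * (lam * m - (lam * m) ^ 2) := by ring
      _ ≤ P * (1 - Real.exp (-(lam * m))) := by gcongr
  have t2 : P * lam * (1 - θ) ≤ Dx X (fun i j => b (X i) (τ j)) i j := by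
    have h1 := one_sub_exp_neg_ge (y := lam * η) (by positivity) (by linarith)
    have h2 : Dx X (fun i j => b (X i) (τ j)) i j = P * (1 - Real.exp (-(lam * η))) / η := by
      simp only [Dx]; rw [n2, ← hP]; ring
    rw [h2, le_div_iff₀ η0]
    calc P * lam * (1 - θ) * η = P * (lam * η * (1 - θ)) := by ring
      _ ≤ P * (lam * η * (1 - lam * η)) := by gcongr
      _ = P * (lam * η - (lam * η) ^ 2) := by ring
      _ ≤ P * (1 - Real.exp (-(lam * η))) := by gcongr
  have t3 : DxPlus X (fun i j => b (X i) (τ j)) i j ≤ P * lam * (1 + θ) := by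
    have h1 := exp_sub_one_le (y := lam * ζ) (by positivity) (by linarith)
    have h2 : DxPlus X (fun i j => b (X i) (τ j)) i j = P * (Real.exp (lam * ζ) - 1) / ζ := by
      simp only [DxPlus]; rw [n3, ← hP]; ring
    rw [h2, div_le_iff₀ ζ0]
    calc P * (Real.exp (lam * ζ) - 1) ≤ P * (lam * ζ + (lam * ζ) ^ 2) := by gcongr
      _ = P * (lam * ζ * (1 + lam * ζ)) := by ring
      _ ≤ P * (lam * ζ * (1 + θ)) := by gcongr
      _ = P * lam * (1 + θ) * ζ := by ring
  set ct := c (X i) (τ j) with hct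
  have hcb : |ct| ≤ Kc := hc.bound _ hxi _ htj
  have hsp : α ≤ ct + γ' (τ j) := hc.speed _ hxi _ htj
  have c1 : 0 ≤ ct + |ct| := by linarith [neg_abs_le ct]
  have c2 : 0 ≤ |ct| - ct := by linarith [le_abs_self ct]
  have m1 := mul_le_mul_of_nonneg_left t2 c1
  have m2 := mul_le_mul_of_nonneg_left t3 c2
  -- The exact derivatives would give `P λ (c + γ' - α / 2) ≥ P λ α / 2`; the choice of `θ` and the
  -- bound on `k` limit the errors to `P λ α / 2`.
  have m3 : 0 ≤ P * lam * (ct + γ' (τ j) - α / 2 - D * k - θ * G ^ 2 - θ * |ct|) := by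
    have : θ * |ct| ≤ θ * Kc := by gcongr
    have : θ * (G ^ 2 + Kc) = θ * G ^ 2 + θ * Kc := by ring
    exact mul_nonneg (by positivity) (by linarith)
  have e : P * lam * (ct + γ' (τ j) - α / 2 - D * k - θ * G ^ 2 - θ * |ct|)
      = P * lam * (γ' (τ j) - α / 2 - D * k - θ * G ^ 2)
        + (1 / 2) * ((ct + |ct|) * (P * lam * (1 - θ)) - (|ct| - ct) * (P * lam * (1 + θ))) := by
    ring
  have e' : ∀ a₁ a₂ a₃ : ℝ, a₁ + (1 / 2) * ((ct + |ct|) * a₂ + (ct - |ct|) * a₃)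
      = a₁ + (1 / 2) * ((ct + |ct|) * a₂ - (|ct| - ct) * a₃) := fun _ _ _ => by ring
  rw [relOp, e']
  linarith

/-- The nodal error of the aligned scheme, at nodes which in the original coordinates lie at most
slightly to the right of `x = L`. At `s = L` the scheme keeps the initial value, so that its
boundary error is of order `t`; the barrier shows that this error does not reach `x ≤ L`. -/
theorem pulse_error (hc : IsRelativeSpeed L T α G D Kc c γ γ') {X τ : ℕ → ℝ} {h k B : ℝ}
    {N M : ℕ} (hX : IsMesh X L h N) (hτ : IsMesh τ T k M) (hT : 0 ≤ T) (hB : 0 ≤ B)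
    {u ux ut : ℝ → ℝ → ℝ} (hu : IsTaylorBound (Icc 0 L) (Icc 0 T) B u ux ut)
    (hpde : ∀ s ∈ Icc 0 L, ∀ t ∈ Icc 0 T, ut s t + c s t * ux s t = 0) {Z : ℕ → ℕ → ℝ}
    (hZ : ∀ i ∈ Finset.Ioo 0 N, ∀ j ∈ Finset.Icc 1 M,
      relOp X τ (fun i j => c (X i) (τ j)) Z i j = 0)
    (hleft : ∀ j ≤ M, Z 0 j = u 0 (τ j)) (hright : ∀ j ∈ Finset.Icc 1 M, Z N j = u L 0)
    (hinit : ∀ i ≤ N, Z i 0 = u (X i) 0) {i j : ℕ} (hi : i ≤ N) (hj : j ≤ M)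
    (hpos : X i - L + γ (τ j) ≤ (1 + G) * (h + k)) :
    |Z i j - u (X i) (τ j)| ≤ (B * (1 + Kc) * T + (2 * B / (barrierRate α G Kc * α)) * Real.exp 1
      + 4 * D * B * T / α) * (h + k) := by
  have hα := hc.α_pos
  have hG := hc.G_nonneg
  have hKc := hc.Kc_nonneg
  have hD := hc.D_nonneg
  have hh0 := hX.width_pos
  have hk0 := hτ.width_pos
  set θ := barrierRate α G Kc with hθ
  have hθ0 : 0 < θ := barrierRate_pos hα hG hKc
  have hθ1 : θ * (1 + G) ≤ 1 := barrierRate_mul_le_one hα hG hKc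
  set r := B * (k + Kc * h) with hr
  have hr0 : 0 ≤ r := by positivity
  have hrle : r ≤ B * (1 + Kc) * (h + k) := by
    rw [hr, mul_assoc]; gcongr; nlinarith
  set E : ℕ → ℕ → ℝ := fun i j => Z i j - u (X i) (τ j) with hE
  have hEr : ∀ i ∈ Finset.Ioo 0 N, ∀ j ∈ Finset.Icc 1 M,
      |relOp X τ (fun i j => c (X i) (τ j)) E i j| ≤ r := by
    intro i hi j hj
    have hxi := hX.mem_Icc (Finset.mem_Ioo.1 hi).2.le
    have htj := hτ.mem_Icc (Finset.mem_Icc.1 hj).2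
    rw [hE, relOp_sub, hZ i hi j hj, zero_sub, abs_neg]
    exact abs_relOp_le hX hτ hB hu hi hj (hc.bound _ hxi _ htj) (hpde _ hxi _ htj)
  have hE0 : ∀ j ≤ M, E 0 j = 0 := fun j hj => by simp only [hE, hX.first, hleft j hj, sub_self]
  have hEi : ∀ i ≤ N, E i 0 = 0 := fun i hi => by simp only [hE, hτ.first, hinit i hi, sub_self]
  have hEN : ∀ j ∈ Finset.Icc 1 M, |E N j| ≤ B * τ j := by
    intro j hj
    have htj := hτ.mem_Icc (Finset.mem_Icc.1 hj).2
    have hL := hX.mem_Icc le_rfl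
    rw [hX.last] at hL
    have := hu.lip L hL L hL _ htj 0 ⟨le_rfl, hT⟩
    rw [sub_self, abs_zero, zero_add, zero_sub, abs_neg, abs_of_nonneg htj.1] at this
    simpa only [hE, hX.last, hright j hj] using this
  have hτop : ∀ (q : ℝ) (i j : ℕ), j ∈ Finset.Icc 1 M →
      ∀ V : ℕ → ℕ → ℝ, relOp X τ (fun i j => c (X i) (τ j)) (fun i j => r * τ j + q * V i j) i j
        = r + q * relOp X τ (fun i j => c (X i) (τ j)) V i j := by
    intro q i j hj V
    have hδ := hτ.step_pos hj
    have e1 : Dt τ (fun i j => r * τ j + q * V i j) i j = r + q * Dt τ V i j := by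
      simp only [Dt]; field_simp; ring
    have e2 : Dx X (fun i j => r * τ j + q * V i j) i j = q * Dx X V i j := by
      simp only [Dx]; rw [← mul_div_assoc]; congr 1; ring
    have e3 : DxPlus X (fun i j => r * τ j + q * V i j) i j = q * DxPlus X V i j := by
      simp only [DxPlus]; rw [← mul_div_assoc]; congr 1; ring
    simp only [relOp, e1, e2, e3]; ring
  have htj := hτ.mem_Icc hj
  have hrT : r * τ j ≤ B * (1 + Kc) * T * (h + k) := by
    calc r * τ j ≤ (B * (1 + Kc) * (h + k)) * T := mul_le_mul hrle htj.2 htj.1 (by positivity)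
      _ = _ := by ring
  have p1 : 0 ≤ 2 * B / (θ * α) * Real.exp 1 * (h + k) := by positivity
  have p2 : 0 ≤ 4 * D * B * T / α * (h + k) := by positivity
  by_cases hk : D * k ≤ α / 4
  · set lam := θ / (h + k) with hlam
    -- With this factor the barrier dominates the boundary error `B t` at `s = L`.
    set q := 2 * B / (lam * α) with hq
    have hlam0 : 0 < lam := by positivity
    have hq0 : 0 ≤ q := by positivity
    have hb0 : ∀ s t, 0 ≤ barrier L α lam γ s t := fun s t => (Real.exp_pos _).le
    have key := relOp_comparison (c := fun i j => c (X i) (τ j)) hX hτ (E := E)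
      (Φ := fun i j => r * τ j + q * barrier L α lam γ (X i) (τ j))
      (fun i hi j hj => by
        rw [hτop q i j hj fun i j => barrier L α lam γ (X i) (τ j)]
        have := mul_nonneg hq0 (relOp_barrier_nonneg hc hX hτ hk hi hj)
        have := hEr i hi j hj
        linarith)
      (fun j hj => by
        have h1 := mul_nonneg hr0 (hτ.mem_Icc (Finset.mem_Icc.1 hj).2).1
        have h2 := mul_nonneg hq0 (hb0 (X 0) (τ j))
        rw [hE0 j (Finset.mem_Icc.1 hj).2, abs_zero]
        linarith)
      (fun j hj => by
        have htj := hτ.mem_Icc (Finset.mem_Icc.1 hj).2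
        have h1 := mul_nonneg hr0 htj.1
        -- At `s = L` the exponent is at least `λ α t / 2`.
        have h2 : lam * (α / 2 * τ j) ≤ barrier L α lam γ (X N) (τ j) := by
          have h3 := hc.lower _ htj 0 ⟨le_rfl, hT⟩ htj.1
          rw [hc.start, sub_zero, sub_zero] at h3
          have h4 := Real.add_one_le_exp (lam * (X N - L + γ (τ j) - α / 2 * τ j))
          have h5 : lam * (α / 2 * τ j) ≤ lam * (X N - L + γ (τ j) - α / 2 * τ j) := by
            rw [hX.last]; gcongr; linarith
          rw [barrier]
          linarith
        have h6 : B * τ j = q * (lam * (α / 2 * τ j)) := by rw [hq]; field_simp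
        have h7 := mul_le_mul_of_nonneg_left h2 hq0
        have h8 := hEN j hj
        linarith)
      (fun i hi => by
        have h2 := mul_nonneg hq0 (hb0 (X i) (τ 0))
        rw [hEi i hi, abs_zero, hτ.first, mul_zero, zero_add]
        rwa [hτ.first] at h2) j hj i hi
    have hbar : barrier L α lam γ (X i) (τ j) ≤ Real.exp 1 := by
      rw [barrier]
      apply Real.exp_le_exp.2
      have h1 : 0 ≤ α / 2 * τ j := mul_nonneg (by positivity) htj.1
      calc lam * (X i - L + γ (τ j) - α / 2 * τ j) ≤ lam * ((1 + G) * (h + k)) := by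
            gcongr; linarith
        _ = θ * (1 + G) := by rw [hlam]; field_simp
        _ ≤ 1 := hθ1
    have hqe : q = 2 * B / (θ * α) * (h + k) := by rw [hq, hlam]; field_simp
    have h9 := mul_le_mul_of_nonneg_left hbar hq0
    have h10 : q * Real.exp 1 = 2 * B / (θ * α) * Real.exp 1 * (h + k) := by rw [hqe]; ring
    refine key.trans ?_
    rw [add_mul, add_mul]
    linarith
  · -- For large time steps the boundary error is of the order of the time step itself.
    push Not at hk
    have key := relOp_comparison (c := fun i j => c (X i) (τ j)) hX hτ (E := E)
      (Φ := fun i j => r * τ j + (B * T) * 1)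
      (fun i hi j hj => by
        rw [hτop (B * T) i j hj fun _ _ => 1]
        have h0 : relOp X τ (fun i j => c (X i) (τ j)) (fun _ _ => 1) i j = 0 := by
          simp [relOp, Dt, Dx, DxPlus]
        rw [h0, mul_zero, add_zero]
        exact hEr i hi j hj)
      (fun j hj => by
        have h1 := mul_nonneg hr0 (hτ.mem_Icc (Finset.mem_Icc.1 hj).2).1
        have h2 := mul_nonneg hB hT
        rw [hE0 j (Finset.mem_Icc.1 hj).2, abs_zero]
        linarith)
      (fun j hj => by
        have htj := hτ.mem_Icc (Finset.mem_Icc.1 hj).2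
        have h1 := mul_nonneg hr0 htj.1
        have h2 := mul_le_mul_of_nonneg_left htj.2 hB
        have := hEN j hj
        linarith)
      (fun i hi => by
        have h2 := mul_nonneg hB hT
        rw [hEi i hi, abs_zero, hτ.first]
        linarith) j hj i hi
    have h3 : B * T ≤ 4 * D * B * T / α * (h + k) := by
      rw [div_mul_eq_mul_div, le_div_iff₀ hα]
      have h4 : α ≤ 4 * (D * (h + k)) := by nlinarith
      calc B * T * α ≤ B * T * (4 * (D * (h + k))) := by gcongr
        _ = _ := by ring
    refine key.trans ?_
    rw [add_mul, add_mul]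
    linarith

/-- The error of the interpolated aligned scheme at points with `x ≤ L`. -/
theorem pulse_interpolant_error (hc : IsRelativeSpeed L T α G D Kc c γ γ') {X τ : ℕ → ℝ}
    {h k B : ℝ} {N M : ℕ} (hX : IsMesh X L h N) (hτ : IsMesh τ T k M) (hT : 0 ≤ T) (hB : 0 ≤ B)
    {u ux ut : ℝ → ℝ → ℝ} (hu : IsTaylorBound (Icc 0 L) (Icc 0 T) B u ux ut)
    (hpde : ∀ s ∈ Icc 0 L, ∀ t ∈ Icc 0 T, ut s t + c s t * ux s t = 0) {Z : ℕ → ℕ → ℝ}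
    (hZ : ∀ i ∈ Finset.Ioo 0 N, ∀ j ∈ Finset.Icc 1 M,
      relOp X τ (fun i j => c (X i) (τ j)) Z i j = 0)
    (hleft : ∀ j ≤ M, Z 0 j = u 0 (τ j)) (hright : ∀ j ∈ Finset.Icc 1 M, Z N j = u L 0)
    (hinit : ∀ i ≤ N, Z i 0 = u (X i) 0) {s t : ℝ} (hs : s ∈ Icc 0 L) (ht : t ∈ Icc 0 T)
    (hst : s + γ t ≤ L) :
    |interpolant X τ N M Z s t - u s t| ≤ (B * (1 + Kc) * T
      + (2 * B / (barrierRate α G Kc * α)) * Real.exp 1 + 4 * D * B * T / α + B) * (h + k) := by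
  refine abs_interpolant_sub_le hX hτ hs ht fun i hi j hj h1 h2 => ?_
  have hh0 := hX.width_pos
  have hk0 := hτ.width_pos
  have hG := hc.G_nonneg
  have htj := hτ.mem_Icc hj
  have hγ : γ (τ j) - γ t ≤ G * k := by
    rcases le_total (τ j) t with hle | hle
    · have h3 := hc.lower _ ht _ htj hle
      have h4 : 0 ≤ α * (t - τ j) := mul_nonneg hc.α_pos.le (by linarith)
      have h5 : 0 ≤ G * k := by positivity
      linarith
    · refine (hc.upper _ htj _ ht hle).trans ?_
      gcongr
      exact (le_abs_self _).trans h2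
  have h3 : X i - L + γ (τ j) ≤ (1 + G) * (h + k) := by
    have := (abs_le.1 h1).2
    nlinarith
  have h4 := pulse_error hc hX hτ hT hB hu hpde hZ hleft hright hinit hi hj h3
  have h5 := hu.lip s hs _ (hX.mem_Icc hi) t ht _ htj
  have h6 : B * (|X i - s| + |τ j - t|) ≤ B * (h + k) := by gcongr
  have h7 := abs_sub_le (Z i j) (u (X i) (τ j)) (u s t)
  rw [add_mul _ B]
  linarith

end Barrier

/-! ### Classical solutions -/

theorem IsC2Bound.isTaylorBound {h : ℝ × ℝ → ℝ} {L T B : ℝ} (hB : 0 ≤ B)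
    (hh : IsC2Bound (Icc 0 L ×ˢ Icc 0 T) B h) :
    IsTaylorBound (Icc 0 L) (Icc 0 T) B (fun x t => h (x, t)) (fun x t => dx h (x, t))
      fun x t => dt h (x, t) := by
  have hS : Convex ℝ (Icc (0 : ℝ) L ×ˢ Icc (0 : ℝ) T) := (convex_Icc 0 L).prod (convex_Icc 0 T)
  refine ⟨fun x hx y hy t ht => ?_, fun x hx t ht s hs => ?_, fun x hx y hy t ht s hs => ?_⟩
  · have := hh.taylor hS hB (p := (x, t)) (q := (y, t)) ⟨hx, ht⟩ ⟨hy, ht⟩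
    simpa [fderiv_apply_eq, Prod.norm_def] using this
  · have := hh.taylor hS hB (p := (x, t)) (q := (x, s)) ⟨hx, ht⟩ ⟨hx, hs⟩
    simpa [fderiv_apply_eq, Prod.norm_def] using this
  · refine (hh.lip (x, t) ⟨hx, ht⟩ (y, s) ⟨hy, hs⟩).trans (mul_le_mul_of_nonneg_left ?_ hB)
    exact max_le (le_add_of_nonneg_right (abs_nonneg _)) (le_add_of_nonneg_left (abs_nonneg _))

section Slices

variable {L T : ℝ} {u : ℝ → ℝ → ℝ}

theorem differentiableWithinAt_slice_fst
    (hu : DifferentiableOn ℝ (fun p : ℝ × ℝ => u p.1 p.2) (Icc 0 L ×ˢ Icc 0 T)) {x t : ℝ}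
    (hx : x ∈ Icc 0 L) (ht : t ∈ Icc 0 T) :
    DifferentiableWithinAt ℝ (fun y => u y t) (Icc 0 L) x :=
  (hu (x, t) ⟨hx, ht⟩).comp (f := fun y => (y, t)) x (by fun_prop) fun _ hy => ⟨hy, ht⟩

theorem differentiableWithinAt_slice_snd
    (hu : DifferentiableOn ℝ (fun p : ℝ × ℝ => u p.1 p.2) (Icc 0 L ×ˢ Icc 0 T)) {x t : ℝ}
    (hx : x ∈ Icc 0 L) (ht : t ∈ Icc 0 T) :
    DifferentiableWithinAt ℝ (fun s => u x s) (Icc 0 T) t :=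
  (hu (x, t) ⟨hx, ht⟩).comp (f := fun s => (x, s)) t (by fun_prop) fun _ hs => ⟨hx, hs⟩

theorem uniqueDiffOn_rectangle (hL : 0 < L) (hT : 0 < T) :
    UniqueDiffOn ℝ (Icc 0 L ×ˢ Icc 0 T) :=
  (uniqueDiffOn_Icc hL).prod (uniqueDiffOn_Icc hT)

theorem fderivWithin_fst_eq (hL : 0 < L)
    (hu : DifferentiableOn ℝ (fun p : ℝ × ℝ => u p.1 p.2) (Icc 0 L ×ˢ Icc 0 T)) {x t : ℝ}
    (hx : x ∈ Icc 0 L) (ht : t ∈ Icc 0 T) :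
    fderivWithin ℝ (fun p : ℝ × ℝ => u p.1 p.2) (Icc 0 L ×ˢ Icc 0 T) (x, t) (1, 0)
      = derivWithin (fun y => u y t) (Icc 0 L) x := by
  have h1 : HasDerivWithinAt (fun y : ℝ => (y, t)) ((1 : ℝ), (0 : ℝ)) (Icc 0 L) x :=
    ((hasDerivAt_id x).prodMk (hasDerivAt_const x t)).hasDerivWithinAt
  have h2 := (hu (x, t) ⟨hx, ht⟩).hasFDerivWithinAt.comp_hasDerivWithinAt x h1
    fun y hy => (⟨hy, ht⟩ : (y, t) ∈ Icc 0 L ×ˢ Icc 0 T)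
  exact (h2.derivWithin (uniqueDiffOn_Icc hL x hx)).symm

theorem fderivWithin_snd_eq (hT : 0 < T)
    (hu : DifferentiableOn ℝ (fun p : ℝ × ℝ => u p.1 p.2) (Icc 0 L ×ˢ Icc 0 T)) {x t : ℝ}
    (hx : x ∈ Icc 0 L) (ht : t ∈ Icc 0 T) :
    fderivWithin ℝ (fun p : ℝ × ℝ => u p.1 p.2) (Icc 0 L ×ˢ Icc 0 T) (x, t) (0, 1)
      = derivWithin (fun s => u x s) (Icc 0 T) t := by
  have h1 : HasDerivWithinAt (fun s : ℝ => (x, s)) ((0 : ℝ), (1 : ℝ)) (Icc 0 T) t :=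
    ((hasDerivAt_const t x).prodMk (hasDerivAt_id t)).hasDerivWithinAt
  have h2 := (hu (x, t) ⟨hx, ht⟩).hasFDerivWithinAt.comp_hasDerivWithinAt t h1
    fun s hs => (⟨hx, hs⟩ : (x, s) ∈ Icc 0 L ×ˢ Icc 0 T)
  exact (h2.derivWithin (uniqueDiffOn_Icc hT t ht)).symm

/-- Every function which is `C²` up to the boundary of the rectangle has a Taylor bound, with its
one-sided partial derivatives. -/
theorem exists_isTaylorBound (hL : 0 < L) (hT : 0 < T)
    (hu : ContDiffOn ℝ 2 (fun p : ℝ × ℝ => u p.1 p.2) (Icc 0 L ×ˢ Icc 0 T)) :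
    ∃ B, 0 ≤ B ∧ IsTaylorBound (Icc 0 L) (Icc 0 T) B u
      (fun x t => derivWithin (fun y => u y t) (Icc 0 L) x)
      fun x t => derivWithin (fun s => u x s) (Icc 0 T) t := by
  set S := Icc (0 : ℝ) L ×ˢ Icc (0 : ℝ) T with hSdef
  set h : ℝ × ℝ → ℝ := fun p => u p.1 p.2 with hh
  have hS : Convex ℝ S := (convex_Icc 0 L).prod (convex_Icc 0 T)
  have hS' : IsCompact S := isCompact_Icc.prod isCompact_Icc
  have hd : DifferentiableOn ℝ h S := hu.differentiableOn (by norm_num)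
  obtain ⟨K₀, h0⟩ := hu.exists_lipschitzOnWith (by norm_num) hS hS'
  obtain ⟨K₁, h1⟩ := (hu.fderivWithin (m := 1) (uniqueDiffOn_rectangle hL hT)
    (by norm_num)).exists_lipschitzOnWith (by norm_num) hS hS'
  have tay : ∀ p ∈ S, ∀ q ∈ S, ‖h q - h p - fderivWithin ℝ h S p (q - p)‖ ≤ K₁ * ‖q - p‖ ^ 2 := by
    intro p hp q hq
    have hsub : segment ℝ p q ⊆ S := hS.segment_subset hp hq
    have := (convex_segment p q).norm_image_sub_le_of_norm_hasFDerivWithin_le'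
      (f := h) (f' := fderivWithin ℝ h S) (φ := fderivWithin ℝ h S p) (C := K₁ * ‖q - p‖)
      (fun x hx => (hd x (hsub hx)).hasFDerivWithinAt.mono hsub)
      (fun x hx => (h1.norm_sub_le (hsub hx) hp).trans
        (mul_le_mul_of_nonneg_left (norm_sub_le_of_mem_segment hx) K₁.2))
      (left_mem_segment ℝ p q) (right_mem_segment ℝ p q)
    rwa [mul_assoc, ← sq] at this
  refine ⟨K₀ + K₁, by positivity, fun x hx y hy t ht => ?_, fun x hx t ht s hs => ?_,
    fun x hx y hy t ht s hs => ?_⟩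
  · have h2 := tay (x, t) ⟨hx, ht⟩ (y, t) ⟨hy, ht⟩
    have e : ((y, t) : ℝ × ℝ) - (x, t) = (y - x) • ((1, 0) : ℝ × ℝ) := by ext <;> simp
    rw [e, map_smul, fderivWithin_fst_eq hL hd hx ht] at h2
    have e2 : ‖(y - x) • ((1, 0) : ℝ × ℝ)‖ ^ 2 = (y - x) ^ 2 := by simp [Prod.norm_def]
    rw [e2] at h2
    refine h2.trans (mul_le_mul_of_nonneg_right ?_ (sq_nonneg _))
    exact le_add_of_nonneg_left K₀.2
  · have h2 := tay (x, t) ⟨hx, ht⟩ (x, s) ⟨hx, hs⟩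
    have e : ((x, s) : ℝ × ℝ) - (x, t) = (s - t) • ((0, 1) : ℝ × ℝ) := by ext <;> simp
    rw [e, map_smul, fderivWithin_snd_eq hT hd hx ht] at h2
    have e2 : ‖(s - t) • ((0, 1) : ℝ × ℝ)‖ ^ 2 = (s - t) ^ 2 := by simp [Prod.norm_def]
    rw [e2] at h2
    refine h2.trans (mul_le_mul_of_nonneg_right ?_ (sq_nonneg _))
    exact le_add_of_nonneg_left K₀.2
  · refine (h0.norm_sub_le (x := (y, s)) ⟨hy, hs⟩ (y := (x, t)) ⟨hx, ht⟩).trans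
      (mul_le_mul ?_ ?_ (norm_nonneg _) (by positivity))
    · exact le_add_of_nonneg_right K₁.2
    · exact max_le (le_add_of_nonneg_right (abs_nonneg _)) (le_add_of_nonneg_left (abs_nonneg _))

end Slices

/-- At a maximum which is not the left end point the derivative from the left is nonnegative. -/
theorem derivWithin_nonneg_of_isMaxOn {f : ℝ → ℝ} {ℓ x : ℝ} (hx : x ∈ Ioc 0 ℓ)
    (hd : DifferentiableWithinAt ℝ f (Icc 0 ℓ) x) (hm : IsMaxOn f (Icc 0 ℓ) x) :
    0 ≤ derivWithin f (Icc 0 ℓ) x := by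
  have hy : (0 : ℝ) - x ∈ posTangentConeAt (Icc 0 ℓ) x :=
    sub_mem_posTangentConeAt_of_segment_subset
      ((convex_Icc 0 ℓ).segment_subset ⟨hx.1.le, hx.2⟩ ⟨le_rfl, hx.1.le.trans hx.2⟩)
  have h := hm.localize.hasFDerivWithinAt_nonpos hd.hasDerivWithinAt.hasFDerivWithinAt hy
  have h' : (0 - x) * derivWithin f (Icc 0 ℓ) x ≤ 0 := h
  by_contra! hneg
  have := mul_pos_of_neg_of_neg (by linarith [hx.1] : 0 - x < 0) hneg
  linarith

namespace IsClassicalSolution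

variable {L T : ℝ} {a : ℝ → ℝ → ℝ} {F F' ψ ψ' φ φ' : ℝ → ℝ} {u u' : ℝ → ℝ → ℝ}

theorem differentiableOn (hu : IsClassicalSolution L T a F ψ φ u) :
    DifferentiableOn ℝ (fun p : ℝ × ℝ => u p.1 p.2) (Icc 0 L ×ˢ Icc 0 T) :=
  hu.contDiffOn.differentiableOn (by norm_num)

theorem sub (hu : IsClassicalSolution L T a F ψ φ u) (hu' : IsClassicalSolution L T a F' ψ' φ' u') :
    IsClassicalSolution L T a (fun x => F x - F' x) (fun t => ψ t - ψ' t) (fun x => φ x - φ' x)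
      fun x t => u x t - u' x t where
  contDiffOn := hu.contDiffOn.sub hu'.contDiffOn
  pde x hx t ht := by
    have hx' := Ioc_subset_Icc_self hx
    have ht' := Ioc_subset_Icc_self ht
    rw [derivWithin_fun_sub (differentiableWithinAt_slice_snd hu.differentiableOn hx' ht')
        (differentiableWithinAt_slice_snd hu'.differentiableOn hx' ht'),
      derivWithin_fun_sub (differentiableWithinAt_slice_fst hu.differentiableOn hx' ht')
        (differentiableWithinAt_slice_fst hu'.differentiableOn hx' ht')]
    linear_combination hu.pde x hx t ht - hu'.pde x hx t ht
  left t ht := by rw [hu.left t ht, hu'.left t ht]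
  initial x hx := by rw [hu.initial x hx, hu'.initial x hx]

/-- The maximum principle: subtracting `δ t` makes the equation strict. -/
theorem nonpos (hL : 0 ≤ L) (hT : 0 ≤ T) (ha : ∀ x ∈ Icc 0 L, ∀ t ∈ Icc 0 T, 0 ≤ a x t)
    (hu : IsClassicalSolution L T a F ψ φ u) (hF : ∀ x ∈ Icc 0 L, F x ≤ 0)
    (hψ : ∀ t ∈ Icc 0 T, ψ t ≤ 0) (hφ : ∀ x ∈ Icc 0 L, φ x ≤ 0) :
    ∀ x ∈ Icc 0 L, ∀ t ∈ Icc 0 T, u x t ≤ 0 := by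
  have main : ∀ δ > 0, ∀ x ∈ Icc 0 L, ∀ t ∈ Icc 0 T, u x t - δ * t ≤ 0 := by
    intro δ hδ
    have hc : ContinuousOn (fun p : ℝ × ℝ => u p.1 p.2 - δ * p.2) (Icc 0 L ×ˢ Icc 0 T) :=
      hu.contDiffOn.continuousOn.sub (by fun_prop)
    obtain ⟨⟨x₀, t₀⟩, ⟨hx₀, ht₀⟩, hmax⟩ := (isCompact_Icc.prod isCompact_Icc).exists_isMaxOn
      (⟨(0, 0), ⟨le_rfl, hL⟩, le_rfl, hT⟩ : (Icc 0 L ×ˢ Icc 0 T).Nonempty) hc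
    simp only at hx₀ ht₀
    suffices h : u x₀ t₀ - δ * t₀ ≤ 0 from fun x hx t ht =>
      (hmax (show (x, t) ∈ Icc 0 L ×ˢ Icc 0 T from ⟨hx, ht⟩)).trans h
    rcases hx₀.1.eq_or_lt with h0 | h0
    · rw [← h0, hu.left t₀ ht₀]
      linarith [hψ t₀ ht₀, mul_nonneg hδ.le ht₀.1]
    rcases ht₀.1.eq_or_lt with h1 | h1
    · rw [← h1, hu.initial x₀ hx₀]
      linarith [hφ x₀ hx₀]
    exfalso
    have d1 := differentiableWithinAt_slice_fst hu.differentiableOn hx₀ ht₀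
    have d2 := differentiableWithinAt_slice_snd hu.differentiableOn hx₀ ht₀
    have m1 := derivWithin_nonneg_of_isMaxOn ⟨h0, hx₀.2⟩ d1 fun y hy => by
      have := hmax (show (y, t₀) ∈ Icc 0 L ×ˢ Icc 0 T from ⟨hy, ht₀⟩)
      simpa using this
    have d3 : HasDerivWithinAt (fun s => u x₀ s - δ * s)
        (derivWithin (fun s => u x₀ s) (Icc 0 T) t₀ - δ * 1) (Icc 0 T) t₀ :=
      d2.hasDerivWithinAt.sub ((hasDerivWithinAt_id _ _).const_mul δ)
    have m2 := derivWithin_nonneg_of_isMaxOn ⟨h1, ht₀.2⟩ d3.differentiableWithinAt fun s hs =>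
      hmax (show (x₀, s) ∈ Icc 0 L ×ˢ Icc 0 T from ⟨hx₀, hs⟩)
    rw [d3.derivWithin (uniqueDiffOn_Icc (h1.trans_le ht₀.2) t₀ ht₀)] at m2
    have := hu.pde x₀ ⟨h0, hx₀.2⟩ t₀ ⟨h1, ht₀.2⟩
    have := mul_nonneg (ha x₀ hx₀ t₀ ht₀) m1
    have := hF x₀ hx₀
    linarith
  intro x hx t ht
  have hlim : Tendsto (fun δ : ℝ => u x t - δ * t) (𝓝[>] 0) (𝓝 (u x t - 0 * t)) :=
    (Continuous.tendsto (by fun_prop) 0).mono_left nhdsWithin_le_nhds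
  rw [zero_mul, sub_zero] at hlim
  exact le_of_tendsto hlim (eventually_mem_nhdsWithin.mono fun δ hδ => main δ hδ x hx t ht)

theorem unique (hL : 0 ≤ L) (hT : 0 ≤ T) (ha : ∀ x ∈ Icc 0 L, ∀ t ∈ Icc 0 T, 0 ≤ a x t)
    (hu : IsClassicalSolution L T a F ψ φ u) (hu' : IsClassicalSolution L T a F ψ φ u') :
    ∀ x ∈ Icc 0 L, ∀ t ∈ Icc 0 T, u x t = u' x t := fun x hx t ht => by
  have h1 := (hu.sub hu').nonpos hL hT ha (by simp) (by simp) (by simp) x hx t ht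
  have h2 := (hu'.sub hu).nonpos hL hT ha (by simp) (by simp) (by simp) x hx t ht
  linarith

/-- A global `C²` function restricts to a classical solution. -/
theorem of_contDiff (hL : 0 < L) (hT : 0 < T) {h : ℝ × ℝ → ℝ} (hh : ContDiff ℝ 2 h)
    (hp : ∀ x ∈ Icc 0 L, ∀ t ∈ Icc 0 T, dt h (x, t) + a x t * dx h (x, t) = F x)
    (hl : ∀ t ∈ Icc 0 T, h (0, t) = ψ t) (hi : ∀ x ∈ Icc 0 L, h (x, 0) = φ x) :
    IsClassicalSolution L T a F ψ φ fun x t => h (x, t) where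
  contDiffOn := hh.contDiffOn
  pde x hx t ht := by
    have hx' := Ioc_subset_Icc_self hx
    have ht' := Ioc_subset_Icc_self ht
    have hd : Differentiable ℝ h := hh.differentiable (by norm_num)
    rw [(hasDerivAt_snd hd x t).hasDerivWithinAt.derivWithin (uniqueDiffOn_Icc hT t ht'),
      (hasDerivAt_fst hd x t).hasDerivWithinAt.derivWithin (uniqueDiffOn_Icc hL x hx')]
    exact hp x hx' t ht'
  left := hl
  initial := hi

end IsClassicalSolution

/-! ### The characteristic through the origin -/

namespace IsCharacteristic

variable {T α : ℝ} {a : ℝ → ℝ → ℝ} {g : ℝ → ℝ}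

theorem continuousOn (hg : IsCharacteristic T a g) : ContinuousOn g (Icc 0 T) :=
  fun t ht => (hg.ode t ht).continuousWithinAt

theorem hasDerivWithinAt_Ici (hg : IsCharacteristic T a g) {t : ℝ} (ht : t ∈ Ico 0 T) :
    HasDerivWithinAt g (a (g t) t) (Ici t) t :=
  (hg.ode t (Ico_subset_Icc_self ht)).mono_of_mem_nhdsWithin
    (mem_of_superset (Icc_mem_nhdsGE ht.2) (Icc_subset_Icc_left ht.1))

/-- The characteristic does not leave the half plane where the speed is prescribed. -/
theorem nonneg (hg : IsCharacteristic T a g) (hα : 0 < α)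
    (ha : ∀ t ∈ Icc 0 T, α ≤ a 0 t) {t : ℝ} (ht : t ∈ Icc 0 T) : 0 ≤ g t := by
  have := image_le_of_deriv_right_lt_deriv_boundary (f := fun t => -g t)
    (f' := fun t => -a (g t) t) (B := fun _ => 0) (B' := fun _ => 0) hg.continuousOn.neg
    (fun t ht => (hg.hasDerivWithinAt_Ici ht).neg) (by simp [hg.start])
    (fun x => hasDerivAt_const x 0) (fun t ht h0 => by
      have h1 : g t = 0 := neg_eq_zero.1 h0
      have := ha t (Ico_subset_Icc_self ht)
      rw [h1]
      linarith) ht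
  linarith

theorem exists_le (hg : IsCharacteristic T a g) : ∃ R, ∀ t ∈ Icc 0 T, g t ≤ R := by
  obtain ⟨R, hR⟩ := (isCompact_Icc.image_of_continuousOn hg.continuousOn).bddAbove
  exact ⟨R, fun t ht => hR (mem_image_of_mem g ht)⟩

theorem eq_flow {K : ℝ} {A Y ξ : ℝ × ℝ → ℝ} (hA : IsGlobalSpeed α K A) (hY : IsFlow A Y ξ)
    (hg : IsCharacteristic T a g) (hagree : ∀ t ∈ Icc 0 T, A (g t, t) = a (g t) t) :
    EqOn g (fun t => Y (0, t)) (Icc 0 T) :=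
  ODE_solution_unique (v := fun t x => A (x, t)) hA.lipschitzWith hg.continuousOn
    (fun t ht => by
      rw [hagree t (Ico_subset_Icc_self ht)]
      exact hg.hasDerivWithinAt_Ici ht)
    (fun t _ => (hY.ode 0 t).continuousAt.continuousWithinAt)
    (fun t _ => (hY.ode 0 t).hasDerivWithinAt) (by simp [hg.start, hY.flow_zero])

end IsCharacteristic

/-! ### Errors of the three components -/

/-- The error of the scheme for the boundary layer component on the initial line. -/
theorem initial_scheme_error {X : ℕ → ℝ} {L T h B : ℝ} {N : ℕ} {a : ℝ → ℝ → ℝ} {f : ℝ → ℝ}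
    {u ux ut : ℝ → ℝ → ℝ} {W : ℕ → ℕ → ℝ} (hT : 0 ≤ T) (hX : IsMesh X L h N) (hB : 0 ≤ B)
    (hu : IsTaylorBound (Icc 0 L) (Icc 0 T) B u ux ut) (hu0 : u 0 0 = 0)
    (ha : ∀ x ∈ Icc 0 L, a x 0 ≠ 0) (hux : ∀ x ∈ Icc 0 L, a x 0 * ux x 0 = f x)
    (hW0 : W 0 0 = 0) (hW : ∀ i ∈ Finset.Icc 1 N, a (X i) 0 * Dx X W i 0 = f (X i)) :
    ∀ i ≤ N, |W i 0 - u (X i) 0| ≤ B * h * X i := by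
  intro i
  induction i with
  | zero => intro _; rw [hX.first, hW0, hu0]; simp
  | succ i ih =>
    intro hi
    have hi' : i + 1 ∈ Finset.Icc 1 N := Finset.mem_Icc.2 ⟨by omega, hi⟩
    have hx := hX.mem_Icc hi
    have hδ := sub_pos.2 (hX.lt_succ i hi)
    have hδh := hX.step_le i hi
    have e1 : Dx X W (i + 1) 0 = ux (X (i + 1)) 0 :=
      mul_left_cancel₀ (ha _ hx) ((hW _ hi').trans (hux _ hx).symm)
    have e2 : W (i + 1) 0 - W i 0 = (X (i + 1) - X i) * ux (X (i + 1)) 0 := by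
      rw [← e1, Dx, Nat.add_sub_cancel]
      field_simp
    have e3 := hu.space _ hx _ (hX.mem_Icc (i := i) (by omega)) 0 ⟨le_rfl, hT⟩
    have e4 : W (i + 1) 0 - u (X (i + 1)) 0 = (W i 0 - u (X i) 0)
        + (u (X i) 0 - u (X (i + 1)) 0 - (X i - X (i + 1)) * ux (X (i + 1)) 0) := by
      linear_combination e2
    have e5 : B * (X i - X (i + 1)) ^ 2 ≤ B * h * (X (i + 1) - X i) := by
      calc B * (X i - X (i + 1)) ^ 2 = B * (X (i + 1) - X i) * (X (i + 1) - X i) := by ring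
        _ ≤ B * h * (X (i + 1) - X i) := by gcongr
    rw [e4]
    refine (abs_add_le _ _).trans ((add_le_add (ih (by omega)) (e3.trans e5)).trans ?_)
    rw [← mul_add, add_sub_cancel]

/-- The initial value of the boundary layer component in terms of the extended data. -/
theorem layerInitial_eq {L : ℝ} {a : ℝ → ℝ → ℝ} {A : ℝ × ℝ → ℝ} {F f : ℝ → ℝ}
    (hag : ∀ x ∈ Icc 0 L, A (x, 0) = a x 0) (hFf : EqOn F f (Icc 0 L)) {x : ℝ}
    (hx : x ∈ Icc 0 L) : layerInitial a f x = initialPrimitive A F x := by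
  rw [layerInitial, initialPrimitive, weightedPrimitive]
  refine intervalIntegral.integral_congr fun y hy => ?_
  rw [uIcc_of_le hx.1] at hy
  have hy' : y ∈ Icc 0 L := ⟨hy.1, hy.2.trans hx.2⟩
  simp only [initialWeight]
  rw [hFf hy', hag y hy', mul_one_div]

section Components

variable {L R T α K C₁ : ℝ} {a : ℝ → ℝ → ℝ} {A Y ξ : ℝ × ℝ → ℝ}

/-- The error of the scheme for the regular component. Its data do not involve the source, so by
uniqueness a single constant serves all sources. -/
theorem exists_regular_error (hL : 0 < L) (hT : 0 < T) (ψ φ : ℝ → ℝ)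
    (ha0 : ∀ x ∈ Icc 0 L, ∀ t ∈ Icc 0 T, 0 ≤ a x t)
    (haK : ∀ x ∈ Icc 0 L, ∀ t ∈ Icc 0 T, a x t ≤ K) :
    ∃ C, 0 ≤ C ∧ ∀ v, IsClassicalSolution L T a (fun _ => 0) ψ φ v →
      ∀ (N M : ℕ) (V : ℕ → ℕ → ℝ), 0 < N → 0 < M → IsRegularScheme L T a ψ φ N M V →
      ∀ x ∈ Icc 0 L, ∀ t ∈ Icc 0 T,
        |interpolant (uniformMesh L N) (uniformMesh T M) N M V x t - v x t|
          ≤ C * (L / N + T / M) := by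
  by_cases hex : ∃ v, IsClassicalSolution L T a (fun _ => 0) ψ φ v
  swap
  · exact ⟨0, le_rfl, fun v hv => (hex ⟨v, hv⟩).elim⟩
  obtain ⟨v, hv⟩ := hex
  have hK : 0 ≤ K := (ha0 0 ⟨le_rfl, hL.le⟩ 0 ⟨le_rfl, hT.le⟩).trans
    (haK 0 ⟨le_rfl, hL.le⟩ 0 ⟨le_rfl, hT.le⟩)
  obtain ⟨B, hB, hTB⟩ := exists_isTaylorBound hL hT hv.contDiffOn
  refine ⟨B * (1 + K) * T + B, by positivity, fun v' hv' N M V hN hM hV x hx t ht => ?_⟩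
  rw [hv'.unique hL.le hT.le ha0 hv x hx t ht]
  have hX := isMesh_uniformMesh hL hN
  have hτ := isMesh_uniformMesh hT hM
  have h1 := upwind_interpolant_error hX hτ hB hTB hv.pde ha0 haK hV.interior
    (fun j hj => by
      rw [hV.left j hj, hv.left _ (hτ.mem_Icc (Finset.mem_Icc.1 hj).2)]) le_rfl
    (fun i hi => by
      rw [hV.initial i (Finset.mem_Icc.2 ⟨Nat.zero_le i, hi⟩), hv.initial _ (hX.mem_Icc hi),
        sub_self, abs_zero]) hx ht
  refine h1.trans ?_
  have h2 : 0 ≤ B * T * (L / N) := by positivity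
  have h3 : 0 ≤ B * T * K * (T / M) := by positivity
  linarith

/-- The error of the scheme for the boundary layer component, with a constant which depends neither
on the profile nor on the grading of the mesh. -/
theorem exists_boundaryLayer_error (hA : IsGlobalSpeed α K A) (hY : IsFlow A Y ξ) (hL : 0 < L)
    (hT : 0 < T) (hC : 0 ≤ C₁) (hag : ∀ x ∈ Icc 0 L, ∀ t ∈ Icc 0 T, A (x, t) = a x t) :
    ∃ C, 0 ≤ C ∧ ∀ F f : ℝ → ℝ, IsProfile C₁ F → EqOn F f (Icc 0 L) →
      ∀ (X : ℕ → ℝ) (h : ℝ) (N M : ℕ) (W : ℕ → ℕ → ℝ), IsMesh X L h N → 0 < M →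
      IsBoundaryLayerScheme T a f X N M W → ∀ x ∈ Icc 0 L, ∀ t ∈ Icc 0 T,
        |interpolant X (uniformMesh T M) N M W x t - boundaryLayer A Y ξ F (x, t)|
          ≤ C * (h + T / M) := by
  obtain ⟨B, hB, hBd⟩ := exists_isC2Bound_boundaryLayer hA hY hL.le hT.le hC
  have hK := hA.const_pos
  refine ⟨B * L + B * (1 + K) * T + B, by positivity,
    fun F f hF hFf X h N M W hX hM hW x hx t ht => ?_⟩
  have hτ := isMesh_uniformMesh hT hM
  have hTB := (hBd F hF).isTaylorBound hB
  have hh := hX.width_pos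
  have h0T : (0 : ℝ) ∈ Icc 0 T := ⟨le_rfl, hT.le⟩
  have hux : ∀ x ∈ Icc 0 L, a x 0 * dx (boundaryLayer A Y ξ F) (x, 0) = f x := by
    intro x hx
    have e1 : (fun y => boundaryLayer A Y ξ F (y, 0)) = initialPrimitive A F :=
      funext fun y => boundaryLayer_initial hY y
    have e2 := hasDerivAt_fst (hBd F hF).differentiable x 0
    rw [e1] at e2
    have e3 := e2.unique
      (hF.hasDerivAt_weightedPrimitive (contDiff_initialWeight hA).continuous x)
    rw [e3, initialWeight, ← hag x hx 0 h0T, hFf hx]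
    have := hA.ne_zero (x, 0)
    field_simp
  have hinit := initial_scheme_error hT.le hX hB hTB (boundaryLayer_left hA hY hF le_rfl)
    (fun x hx => by rw [← hag x hx 0 h0T]; exact hA.ne_zero _) hux
    (hW.left 0 (Finset.mem_Icc.2 ⟨le_rfl, Nat.zero_le M⟩)) hW.initial
  have h1 := upwind_interpolant_error (f := f) (b := B * h * L) hX hτ hB hTB
    (fun x hx t ht => by
      rw [← hag x (Ioc_subset_Icc_self hx) t (Ioc_subset_Icc_self ht),
        transport_boundaryLayer hA hY hF, hFf (Ioc_subset_Icc_self hx)])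
    (fun x hx t ht => by rw [← hag x hx t ht]; exact hA.pos.le.trans (hA.lower _))
    (fun x hx t ht => by rw [← hag x hx t ht]; exact hA.upper _) hW.interior
    (fun j hj => by
      rw [hW.left j (Finset.Icc_subset_Icc_left (Nat.zero_le 1) hj),
        boundaryLayer_left hA hY hF (hτ.mem_Icc (Finset.mem_Icc.1 hj).2).1])
    (by positivity)
    (fun i hi => (hinit i hi).trans (by gcongr; exact (hX.mem_Icc hi).2)) hx ht
  refine h1.trans ?_
  have h2 : 0 ≤ B * T * h := by positivity
  have h3 : 0 ≤ B * T * K * (T / M) := by positivity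
  have h4 : 0 ≤ B * L * (T / M) := by positivity
  linarith

/-- The coordinates `s = x - Y(0, t)` satisfy the assumptions on a relative speed. -/
theorem exists_isRelativeSpeed (hA : IsGlobalSpeed α K A) (hY : IsFlow A Y ξ) :
    ∃ D, IsRelativeSpeed L T α K D K (fun s t => A (s + Y (0, t), t) - A (Y (0, t), t))
      (fun t => Y (0, t)) fun t => A (Y (0, t), t) := by
  have hc : ContDiff ℝ 2 fun t : ℝ => Y (0, t) :=
    hY.contDiff_flow.comp (contDiff_const.prodMk contDiff_id)
  obtain ⟨D, hD, hDd⟩ := IsC2Bound.exists_of_contDiff (convex_Icc (0 : ℝ) T) isCompact_Icc hc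
  have hd : Differentiable ℝ fun t : ℝ => Y (0, t) := hc.differentiable (by norm_num)
  have hderiv : ∀ t, deriv (fun t => Y (0, t)) t = A (Y (0, t), t) := fun t => (hY.ode 0 t).deriv
  refine ⟨D, hA.pos, hA.const_pos.le, hD, hA.const_pos.le, hY.flow_zero 0,
    fun s _ t _ => ?_, fun s _ t _ => ?_, fun t _ r _ hrt => ?_, fun t _ r _ hrt => ?_,
    fun t ht r hr => ?_⟩
  · rw [sub_add_cancel]; exact hA.lower _
  · have h1 := hA.lower (s + Y (0, t), t)
    have h2 := hA.lower (Y (0, t), t)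
    have h3 := hA.upper (s + Y (0, t), t)
    have h4 := hA.upper (Y (0, t), t)
    have := hA.pos
    exact abs_le.2 ⟨by linarith, by linarith⟩
  · exact mul_sub_le_image_sub_of_le_deriv hd (fun s => by rw [hderiv]; exact hA.lower _) hrt
  · exact image_sub_le_mul_sub_of_deriv_le hd (fun s => by rw [hderiv]; exact hA.upper _) hrt
  · have h1 := hDd.taylor (convex_Icc 0 T) hD ht hr
    have h2 : fderiv ℝ (fun t => Y (0, t)) t (r - t) = (r - t) * A (Y (0, t), t) := by
      rw [(hY.ode 0 t).hasFDerivAt.fderiv]; simp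
    rw [h2, Real.norm_eq_abs, Real.norm_eq_abs, sq_abs] at h1
    exact h1

/-- The error of the aligned scheme for the interior layer component, with a constant which depends
neither on the profile nor on the grading of the mesh. -/
theorem exists_interiorLayer_error (hA : IsGlobalSpeed α K A) (hY : IsFlow A Y ξ) (hL : 0 < L)
    (hT : 0 < T) (hC : 0 ≤ C₁) (hag : ∀ x ∈ Icc 0 R, ∀ t ∈ Icc 0 T, A (x, t) = a x t)
    {g : ℝ → ℝ} (hg : EqOn g (fun t => Y (0, t)) (Icc 0 T)) (hg0 : ∀ t ∈ Icc 0 T, 0 ≤ g t)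
    (hgR : ∀ t ∈ Icc 0 T, L + g t ≤ R) :
    ∃ C, 0 ≤ C ∧ ∀ F ζ : ℝ → ℝ, IsProfile C₁ F →
      (∀ x ∈ Icc 0 L, ζ x = -initialPrimitive A F x) →
      ∀ (X : ℕ → ℝ) (h : ℝ) (N M : ℕ) (Z : ℕ → ℕ → ℝ), IsMesh X L h N → 0 < M →
      IsPulseScheme T a g ζ X N M Z → ∀ x ∈ Icc 0 L, ∀ t ∈ Icc 0 T,
        |pulseInterpolant g X (uniformMesh T M) N M Z x t - interiorLayer A ξ F (x, t)|
          ≤ C * (h + T / M) := by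
  obtain ⟨B, hB, hBd⟩ := exists_isC2Bound_alignedLayer hA hY hL.le hT.le hC
  obtain ⟨D, hc⟩ := exists_isRelativeSpeed (L := L) (T := T) hA hY
  have hK := hA.const_pos
  have hα := hA.pos
  have hD := hc.D_nonneg
  have hθ := barrierRate_pos hα hK.le hK.le
  refine ⟨B * (1 + K) * T + (2 * B / (barrierRate α K K * α)) * Real.exp 1
    + 4 * D * B * T / α + B, by positivity, fun F ζ hF hζ X h N M Z hX hM hZ x hx t ht => ?_⟩
  have hτ := isMesh_uniformMesh hT hM
  have hh := hX.width_pos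
  have hk := hτ.width_pos
  rw [pulseInterpolant]
  split_ifs with hgx
  · have hTB := (hBd F hF).isTaylorBound hB
    have hs : x - g t ∈ Icc 0 L := ⟨sub_nonneg.2 hgx, by linarith [hg0 t ht, hx.2]⟩
    have e1 : interiorLayer A ξ F (x, t) = alignedLayer A Y ξ F (x - g t, t) := by
      rw [hg ht]; exact (alignedLayer_eq x t).symm
    rw [e1]
    -- The boundary condition at `s = 0` says that the initial value, which is zero, is kept.
    have hZ0 : ∀ j ≤ M, Z 0 j = 0 := by
      intro j
      induction j with
      | zero =>
        intro _
        rw [hZ.initial 0 (by simp), hX.first, hζ 0 ⟨le_rfl, hL.le⟩, initialPrimitive,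
          hF.weightedPrimitive_eq_zero le_rfl, neg_zero]
      | succ j ih =>
        intro hj
        have hj' : j + 1 ∈ Finset.Icc 1 M := Finset.mem_Icc.2 ⟨by omega, hj⟩
        have h1 := hZ.left (j + 1) hj'
        rw [Dt, div_eq_zero_iff, Nat.add_sub_cancel, ih (by omega), sub_zero] at h1
        exact h1.resolve_right (sub_pos.2 (hτ.lt_succ j hj)).ne'
    refine pulse_interpolant_error hc hX hτ hT.le hB hTB
      (fun s _ t _ => transport_alignedLayer hA hY hF (hBd F hF).differentiable s t)
      (fun i hi j hj => ?_) (fun j hj => by rw [hZ0 j hj, alignedLayer_left hY hF])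
      (fun j hj => by rw [hZ.right j hj, hX.last, hζ L ⟨hL.le, le_rfl⟩, alignedLayer_initial hY])
      (fun i hi => by
        rw [hZ.initial i (Finset.mem_Icc.2 ⟨Nat.zero_le i, hi⟩), hζ _ (hX.mem_Icc hi),
          alignedLayer_initial hY]) hs ht (by linarith [hx.2, show g t = Y (0, t) from hg ht])
    have hXi := hX.mem_Icc (Finset.mem_Ioo.1 hi).2.le
    have htj := hτ.mem_Icc (Finset.mem_Icc.1 hj).2
    have hgt := hg0 _ htj
    have hgt' := hgR _ htj
    have e2 : A (X i + Y (0, uniformMesh T M j), uniformMesh T M j)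
        - A (Y (0, uniformMesh T M j), uniformMesh T M j)
        = shiftedSpeed a g (X i) (uniformMesh T M j) := by
      have e3 : Y (0, uniformMesh T M j) = g (uniformMesh T M j) := (hg htj).symm
      rw [shiftedSpeed, e3, hag _ ⟨by linarith [hXi.1], by linarith [hXi.2]⟩ _ htj,
        hag _ ⟨hgt, by linarith⟩ _ htj]
    simp only [relOp]
    rw [e2]
    exact hZ.interior i hi j hj
  · rw [interiorLayer_eq_zero hY hF (by linarith [show g t = Y (0, t) from hg ht]),
      sub_zero, abs_zero]
    positivity

theorem isClassicalSolution_boundaryLayer (hA : IsGlobalSpeed α K A) (hY : IsFlow A Y ξ)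
    (hL : 0 < L) (hT : 0 < T) (hag : ∀ x ∈ Icc 0 L, ∀ t ∈ Icc 0 T, A (x, t) = a x t)
    {F f : ℝ → ℝ} (hF : IsProfile C₁ F) (hFf : EqOn F f (Icc 0 L)) :
    IsClassicalSolution L T a f (fun _ => 0) (layerInitial a f)
      fun x t => boundaryLayer A Y ξ F (x, t) :=
  .of_contDiff hL hT (contDiff_boundaryLayer hA hY hF)
    (fun x hx t ht => by rw [← hag x hx t ht, transport_boundaryLayer hA hY hF, hFf hx])
    (fun _ ht => boundaryLayer_left hA hY hF ht.1) fun x hx => by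
      rw [boundaryLayer_initial hY, layerInitial_eq (fun x hx => hag x hx 0 ⟨le_rfl, hT.le⟩) hFf hx]

theorem isClassicalSolution_interiorLayer (hA : IsGlobalSpeed α K A) (hY : IsFlow A Y ξ)
    (hL : 0 < L) (hT : 0 < T) (hag : ∀ x ∈ Icc 0 L, ∀ t ∈ Icc 0 T, A (x, t) = a x t)
    {F f : ℝ → ℝ} (hF : IsProfile C₁ F) (hFf : EqOn F f (Icc 0 L)) :
    IsClassicalSolution L T a (fun _ => 0) (fun _ => 0) (fun x => -layerInitial a f x)
      fun x t => interiorLayer A ξ F (x, t) :=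
  .of_contDiff hL hT (contDiff_interiorLayer hA hY hF)
    (fun x hx t ht => by rw [← hag x hx t ht, transport_interiorLayer hA hY hF])
    (fun t ht => interiorLayer_eq_zero hY hF ((hY.flow_zero 0).symm.trans_le
      (flow_monotone hA hY 0 ht.1))) fun x hx => by
      rw [interiorLayer_initial hY,
        layerInitial_eq (fun x hx => hag x hx 0 ⟨le_rfl, hT.le⟩) hFf hx]

end Components

/-- Since `N ≥ 2`, the bound `1 / N` is dominated by `(log N)² / N`. -/
theorem inv_le_log_sq {N : ℕ} (hN : 2 ≤ N) :
    (N : ℝ)⁻¹ ≤ (Real.log 2 ^ 2)⁻¹ * ((N : ℝ)⁻¹ * Real.log N ^ 2) := by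
  have h2 : 0 < Real.log 2 := Real.log_pos (by norm_num)
  have h3 : Real.log 2 ≤ Real.log N := Real.log_le_log (by norm_num) (by exact_mod_cast hN)
  have hN0 : (0 : ℝ) < N := by positivity
  rw [mul_left_comm]
  refine le_mul_of_one_le_right (by positivity) ?_
  rw [← div_eq_inv_mul, one_le_div (by positivity)]
  gcongr

end FlowAway

/-! ### The decomposition and the error bound -/

open FlowAway in
theorem mainTheorem2
    (L T α C₁ κ : ℝ) (hL : 0 < L) (hT : 0 < T) (hα : 0 < α) (hκ : 0 < κ)
    (a : ℝ → ℝ → ℝ) (ψ φ g : ℝ → ℝ)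
    (ha : ContDiffOn ℝ 3 (fun p : ℝ × ℝ => a p.1 p.2) (Set.Ici 0 ×ˢ Set.Icc 0 T))
    (haα : ∀ x ∈ Set.Ici (0 : ℝ), ∀ t ∈ Set.Icc 0 T, α ≤ a x t)
    (hat0 : derivWithin (fun t => a 0 t) (Set.Icc 0 T) 0 = 0)
    (hψ : ContDiffOn ℝ 2 ψ (Set.Icc 0 T))
    (hφ : ContDiffOn ℝ 2 φ (Set.Icc 0 L))
    (hg : FlowAway.IsCharacteristic T a g) :
    ∃ C : ℝ, 0 < C ∧
      ∀ (ε : ℝ) (f : ℝ → ℝ) (u : ℝ → ℝ → ℝ), 0 < ε → ε ≤ 1 →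
        FlowAway.HasInflowLayer L C₁ ε f →
        FlowAway.Compatible L T a f ψ φ →
        FlowAway.IsClassicalSolution L T a f ψ φ u →
        (∃ v w z : ℝ → ℝ → ℝ,
          FlowAway.IsClassicalSolution L T a (fun _ => 0) ψ φ v ∧
          FlowAway.IsClassicalSolution L T a f (fun _ => 0)
            (FlowAway.layerInitial a f) w ∧
          FlowAway.IsClassicalSolution L T a (fun _ => 0) (fun _ => 0)
            (fun x => - FlowAway.layerInitial a f x) z ∧
          ∀ x ∈ Set.Icc 0 L, ∀ t ∈ Set.Icc 0 T, u x t = v x t + w x t + z x t) ∧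
        ∀ (N M : ℕ) (V W Z : ℕ → ℕ → ℝ), Even N → 0 < N → 0 < M →
          FlowAway.IsRegularScheme L T a ψ φ N M V →
          FlowAway.IsBoundaryLayerScheme T a f
            (FlowAway.shishkinMesh L (FlowAway.transition L 1 ε N) N) N M W →
          FlowAway.IsPulseScheme T a g (fun x => - FlowAway.layerInitial a f x)
            (FlowAway.shishkinMesh L (FlowAway.transition L κ ε N) N) N M Z →
          ∀ x ∈ Set.Icc 0 L, ∀ t ∈ Set.Icc 0 T,
            |FlowAway.interpolant (FlowAway.uniformMesh L N) (FlowAway.uniformMesh T M) N M V x t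
              + FlowAway.interpolant
                  (FlowAway.shishkinMesh L (FlowAway.transition L 1 ε N) N)
                  (FlowAway.uniformMesh T M) N M W x t
              + FlowAway.pulseInterpolant g
                  (FlowAway.shishkinMesh L (FlowAway.transition L κ ε N) N)
                  (FlowAway.uniformMesh T M) N M Z x t
              - u x t|
            ≤ C * (N : ℝ)⁻¹ * (Real.log N) ^ 2 + C * (M : ℝ)⁻¹ := by
  have h0T : (0 : ℝ) ∈ Set.Icc 0 T := ⟨le_rfl, hT.le⟩
  obtain ⟨R, hR⟩ := hg.exists_le
  have hg0 : ∀ t ∈ Set.Icc 0 T, 0 ≤ g t := fun t ht => hg.nonneg hα (haα 0 Set.self_mem_Ici) ht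
  have hR0 : 0 ≤ R := (hg0 0 h0T).trans (hR 0 h0T)
  -- On `[0, L + R]` the speed is needed by the scheme in the coordinates `x - g(t)`.
  obtain ⟨K, A, hA, hAa⟩ := exists_isGlobalSpeed (R := L + R) (by linarith) hT hα ha
    fun p hp => haα _ hp.1 _ hp.2
  obtain ⟨Y, ξ, hY⟩ := exists_isFlow hA
  have hag : ∀ x ∈ Set.Icc 0 (L + R), ∀ t ∈ Set.Icc 0 T, A (x, t) = a x t :=
    fun x hx t ht => hAa ⟨hx, ht⟩
  have hagL : ∀ x ∈ Set.Icc 0 L, ∀ t ∈ Set.Icc 0 T, A (x, t) = a x t :=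
    fun x hx => hag x ⟨hx.1, by linarith [hx.2]⟩
  have hgY := hg.eq_flow hA hY fun t ht => hag _ ⟨hg0 t ht, by linarith [hR t ht]⟩ t ht
  by_cases hC : 0 ≤ C₁
  swap
  -- For negative `C₁` no source satisfies the layer bounds.
  · refine ⟨1, one_pos, fun ε f u hε _ hf => ?_⟩
    obtain ⟨F, hF, -⟩ := exists_isProfile hL hε hf
    exact (hC hF.const_nonneg).elim
  obtain ⟨CV, hCV, hV'⟩ := exists_regular_error (K := K) hL hT ψ φ
    (fun x hx t ht => hα.le.trans (haα x hx.1 t ht))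
    (fun x hx t ht => (hagL x hx t ht).symm.trans_le (hA.upper _))
  obtain ⟨CW, hCW, hW'⟩ := exists_boundaryLayer_error hA hY hL hT hC hagL
  obtain ⟨CZ, hCZ, hZ'⟩ := exists_interiorLayer_error hA hY hL hT hC hag hgY hg0
    fun t ht => by linarith [hR t ht]
  set S := CV + CW + CZ with hS
  have hS0 : 0 ≤ S := by positivity
  set q := (Real.log 2 ^ 2)⁻¹ with hq
  have hq0 : 0 ≤ q := by positivity
  refine ⟨S * (2 * L * q) + S * T + 1, by positivity, fun ε f u hε _ hf _ hu => ?_⟩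
  obtain ⟨F, hF, hFf⟩ := exists_isProfile hL hε hf
  have hw := isClassicalSolution_boundaryLayer hA hY hL hT hagL hF hFf
  have hz := isClassicalSolution_interiorLayer hA hY hL hT hagL hF hFf
  -- The regularity of `v` is inherited from `u`, `w` and `z`.
  have hv : IsClassicalSolution L T a (fun _ => 0) ψ φ
      fun x t => u x t - boundaryLayer A Y ξ F (x, t) - interiorLayer A ξ F (x, t) := by
    simpa using (hu.sub hw).sub hz
  refine ⟨⟨_, _, _, hv, hw, hz, fun x _ t _ => by ring⟩, ?_⟩
  intro N M V W Z hE hN hM hV hW hZ x hx t ht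
  have hN2 : 2 ≤ N := by
    obtain ⟨n, rfl⟩ := hE
    omega
  have e1 := hV' _ hv N M V hN hM hV x hx t ht
  have e2 := hW' F f hF hFf _ _ N M W
    (isMesh_shishkinMesh (transition_pos hL one_pos hε hN2) (min_le_left _ _) hN hE) hM hW x hx t ht
  have e3 := hZ' F _ hF
    (fun x hx => by rw [layerInitial_eq (fun x hx => hagL x hx 0 h0T) hFf hx]) _ _ N M Z
    (isMesh_shishkinMesh (transition_pos hL hκ hε hN2) (min_le_left _ _) hN hE) hM hZ x hx t ht
  have hN0 : (0 : ℝ) < N := by exact_mod_cast hN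
  have hM0 : (0 : ℝ) < M := by exact_mod_cast hM
  have e4 : CV * (L / N + T / M) ≤ CV * (2 * L / N + T / M) := by
    gcongr
    linarith
  have e5 : S * (2 * L / N + T / M)
      ≤ S * (2 * L * q) * ((N : ℝ)⁻¹ * Real.log N ^ 2) + S * T * (M : ℝ)⁻¹ := by
    have h1 : S * (2 * L) * (N : ℝ)⁻¹ ≤ S * (2 * L) * (q * ((N : ℝ)⁻¹ * Real.log N ^ 2)) :=
      mul_le_mul_of_nonneg_left (inv_le_log_sq hN2) (by positivity)
    rw [div_eq_mul_inv, div_eq_mul_inv]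
    linarith
  have h1 : 0 ≤ S * (2 * L * q) := by positivity
  have h2 : 0 ≤ S * T := by positivity
  have h3 : 0 ≤ (N : ℝ)⁻¹ * Real.log N ^ 2 := by positivity
  have h4 : 0 ≤ (M : ℝ)⁻¹ := by positivity
  have h5 := mul_nonneg h2 h3
  have h6 := mul_nonneg h1 h4
  have e6 : ∀ p q r v w z s : ℝ, s - v = w + z → |p + q + r - s| ≤ |p - v| + |q - w| + |r - z| := by
    intro p q r v w z s h
    have : p + q + r - s = (p - v) + (q - w) + (r - z) := by linear_combination -h
    rw [this]
    exact abs_add_three _ _ _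
  refine (e6 _ _ _ _ _ _ _ (by ring)).trans ((add_le_add (add_le_add (e1.trans e4) e2) e3).trans ?_)
  rw [← add_mul, ← add_mul]
  refine e5.trans ?_
  linarith
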